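/- Let $M$ be a smooth, Hausdorff, second countable, connected manifold of dimension $n\ge 2$, and let $g$ be a locally Lipschitz Lorentzian metric on $M$ of signature $(-,+,\dots,+)$ which admits a smooth timelike vector field. Let $h$ be a smooth Riemannian metric on $M$. Regularisation: let $(U_\alpha,\psi_\alpha)_{\alpha\in\mathbb N}$ be a locally finite cover of $M$ by relatively compact chart domains, $(\xi_\alpha)$ a subordinate smooth partition of unity, $\chi_\alpha\in C_c^\infty(U_\alpha)$ with $\chi_\alpha=1$ near $\operatorname{supp}\xi_\alpha$, and $\rho\ge 0$ a smooth function on $\mathbb R^n$ with compact support in the open unit ball and $\int\rho=1$; put $\rho_\varepsilon(y)=\varepsilon^{-n}\rho(y/\varepsilon)$ and $$g_\varepsilon:=\sum_\alpha \chi_\alpha\,\psi_\alpha^*\big[\big((\psi_\alpha)_*(\xi_\alpha g)\big)*\rho_\varepsilon\big],$$ the convolution being taken componentwise. Let $\varepsilon_k>0$, $\varepsilon_k\to 0$, and let $g_k$ be smooth Lorentzian metrics on $M$ such that * $g_k\prec g$, i.e. $g_k(X,X)\le 0$ implies $g(X,X)<0$ for every tangent vector $X\neq 0$; * $g_k-g_{\varepsilon_k}\to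 0$ in $C^\infty_{\mathrm{loc}}(M)$; * $\mathrm{Ric}[g_k]-\mathrm{Ric}[g_{\varepsilon_k}]$ is bounded on every compact set, uniformly for all large $k$. Suppose that there is $C\in\mathbb R$ such that, for every smooth $g$-timelike vector field $X$ on $M$, $\mathrm{Ric}[g](X,X)\ge C\,g(X,X)$ in the sense of distributions, i.e. $\mathrm{Ric}[g](X,X)-C\,g(X,X)$ is nonnegative on all nonnegative test densities. Here $\mathrm{Ric}[g]$ is the distributional Ricci tensor, given in charts by $\mathrm{Ric}_{ij}=\partial_m\Gamma^m_{ij}-\partial_j\Gamma^m_{im}+\Gamma^m_{ml}\Gamma^l_{ij}-\Gamma^m_{jl}\Gamma^l_{im}$ with $\Gamma^m_{ij}\in L^\infty_{\mathrm{loc}}$. Then for every compact $K\subseteq M$ there is a constant $B\ge 0$ such that, for all $D>0$ and all $\eta<0$, there is $k_0\in\mathbb N$ such that, with $$\tilde C:=C-\frac{B D^2}{\eta},$$ for all $k\ge k_0$ and all tangent vectors $X$ at points of $K$ with $\|X\|_h\le D$ and $g(X,X)\le\eta$, $$\mathrm{Ric}[g_k](X,X)\ \ge\ \tilde C\, g_k(X,X).$$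 -/

import Mathlib

open Set Filter Topology MeasureTheory
open scoped Manifold ContDiff

noncomputable section

namespace LipschitzRicci

/-- Model space `ℝⁿ` with its Euclidean norm. -/
abbrev Model (n : ℕ) : Type := EuclideanSpace ℝ (Fin n)

/-! ### Coordinate expressions on open subsets of `ℝⁿ` -/

/-- `∂_i f`. For a locally Lipschitz `f` this exists almost everywhere and is the weak
derivative of `f`. -/
def pd {n : ℕ} (i : Fin n) (f : Model n → ℝ) (y : Model n) : ℝ :=
  fderiv ℝ f y (EuclideanSpace.single i 1)

/-- Christoffel symbol `Γ^m_{ij}` of the metric with components `G`. -/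
def christoffel {n : ℕ} (G : Model n → Matrix (Fin n) (Fin n) ℝ) (m i j : Fin n)
    (y : Model n) : ℝ :=
  (1 / 2 : ℝ) * ∑ l, (G y)⁻¹ m l *
    (pd i (fun z => G z j l) y + pd j (fun z => G z i l) y - pd l (fun z => G z i j) y)

/-- The part of the Ricci tensor that is quadratic in the Christoffel symbols:
`Γ^m_{ml} Γ^l_{ij} - Γ^m_{jl} Γ^l_{im}`. -/
def ricciQuad {n : ℕ} (G : Model n → Matrix (Fin n) (Fin n) ℝ) (i j : Fin n)
    (y : Model n) : ℝ :=
  ∑ m, ∑ l, (christoffel G m m l y * christoffel G l i j y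
    - christoffel G m j l y * christoffel G l i m y)

/-- Classical Ricci components
`∂_m Γ^m_{ij} - ∂_j Γ^m_{im} + Γ^m_{ml} Γ^l_{ij} - Γ^m_{jl} Γ^l_{im}`. -/
def ricciCoord {n : ℕ} (G : Model n → Matrix (Fin n) (Fin n) ℝ) (i j : Fin n)
    (y : Model n) : ℝ :=
  (∑ m, pd m (christoffel G m i j) y) - (∑ m, pd j (christoffel G m i m) y)
    + ricciQuad G i j y

/-- Distributional Ricci components on the open set `U`, evaluated on a test function `φ`
supported in `U`: the outer derivatives `∂_m`, `∂_j` act in the sense of distributions on the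
locally bounded Christoffel symbols. -/
def distRicciCoord {n : ℕ} (U : Set (Model n)) (G : Model n → Matrix (Fin n) (Fin n) ℝ)
    (i j : Fin n) (φ : Model n → ℝ) : ℝ :=
  ∫ y in U, (-(∑ m, christoffel G m i j y * pd m φ y)
    + (∑ m, christoffel G m i m y * pd j φ y) + ricciQuad G i j y * φ y)

/-! ### Tensor fields and vector fields on a manifold -/

/-- Tensor fields of type `(0,2)`, without any regularity. -/
abbrev CovTwo (n : ℕ) (M : Type*) [TopologicalSpace M] [ChartedSpace (Model n) M] : Type _ :=
  ∀ x : M, TangentSpace (𝓡 n) x →L[ℝ] TangentSpace (𝓡 n) x →L[ℝ] ℝ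

/-- Vector fields, without any regularity. -/
abbrev VecField (n : ℕ) (M : Type*) [TopologicalSpace M] [ChartedSpace (Model n) M] : Type _ :=
  ∀ x : M, TangentSpace (𝓡 n) x

section Manifold

variable {n : ℕ} {M : Type*} [TopologicalSpace M] [ChartedSpace (Model n) M]

/-- The coordinate differential `dx^i` of the chart `e` at `x`. -/
def dcoord (e : OpenPartialHomeomorph M (Model n)) (x : M) (i : Fin n) :
    TangentSpace (𝓡 n) x →L[ℝ] ℝ :=
  (EuclideanSpace.proj i : Model n →L[ℝ] ℝ).comp (mfderiv (𝓡 n) (𝓡 n) e x)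

/-- The coordinate vector `∂_i` of the chart `e` at the point with coordinates `y`. -/
def coordVec (e : OpenPartialHomeomorph M (Model n)) (y : Model n) (i : Fin n) :
    TangentSpace (𝓡 n) (e.symm y) :=
  mfderiv (𝓡 n) (𝓡 n) e.symm y (EuclideanSpace.single i (1 : ℝ) : Model n)

/-- Components `T_{ij}` in the chart `e`, as functions of the coordinates; only their values
on `e.target` are meaningful. -/
def comp (e : OpenPartialHomeomorph M (Model n)) (T : CovTwo n M) (y : Model n) :
    Matrix (Fin n) (Fin n) ℝ :=
  Matrix.of fun i j => T (e.symm y) (coordVec e y i) (coordVec e y j)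

/-- Components `X^i` in the chart `e`, as functions of the coordinates. -/
def vecComp (e : OpenPartialHomeomorph M (Model n)) (X : VecField n M) (i : Fin n)
    (y : Model n) : ℝ :=
  dcoord e (e.symm y) i (X (e.symm y))

/-- Smooth vector fields. -/
def IsSmoothVec [IsManifold (𝓡 n) ∞ M] (X : VecField n M) : Prop :=
  ContMDiff (𝓡 n) (𝓡 n).tangent ∞ (fun x => (⟨x, X x⟩ : TangentBundle (𝓡 n) M))

/-- Smooth `(0,2)`-tensor fields. -/
def IsSmoothCov (T : CovTwo n M) : Prop :=
  ∀ e ∈ IsManifold.maximalAtlas (𝓡 n) ∞ M, ∀ i j : Fin n,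
    ContDiffOn ℝ ∞ (fun y => comp e T y i j) e.target

/-- Locally Lipschitz `(0,2)`-tensor fields. -/
def IsLocLipCov (T : CovTwo n M) : Prop :=
  ∀ e ∈ IsManifold.maximalAtlas (𝓡 n) ∞ M, ∀ i j : Fin n,
    LocallyLipschitzOn e.target (fun y => comp e T y i j)

/-- Lorentzian signature `(-,+,…,+)` at every point. -/
def IsLorentzian (g : CovTwo n M) : Prop :=
  ∀ x : M, (∀ v w, g x v w = g x w v) ∧
    ∃ v, g x v v < 0 ∧ ∀ w, g x v w = 0 → w ≠ 0 → 0 < g x w w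

/-- `g`-timelike vector fields. -/
def IsTimelike (g : CovTwo n M) (X : VecField n M) : Prop :=
  ∀ x : M, g x (X x) (X x) < 0

/-- `g₁ ≺ g₂`: the light cones of `g₁` are strictly narrower than those of `g₂`. -/
def Narrower (g₁ g₂ : CovTwo n M) : Prop :=
  ∀ (x : M) (v : TangentSpace (𝓡 n) x), v ≠ 0 → g₁ x v v ≤ 0 → g₂ x v v < 0

/-- `T_k → 0` in `C^∞_loc`: in every chart all partial derivatives of all components converge
to `0` uniformly on compact sets. -/
def TendstoZeroSmoothLoc (T : ℕ → CovTwo n M) : Prop :=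
  ∀ e ∈ IsManifold.maximalAtlas (𝓡 n) ∞ M, ∀ i j : Fin n, ∀ m : ℕ,
    ∀ L : Set (Model n), IsCompact L → L ⊆ e.target →
      TendstoUniformlyOn (fun k y => iteratedFDeriv ℝ m (fun z => comp e (T k) z i j) y)
        (fun _ => 0) atTop L

/-- `Ric[g](v,v)` for a smooth metric `g` and a tangent vector `v` at `x`. -/
def ricci (g : CovTwo n M) (x : M) (v : TangentSpace (𝓡 n) x) : ℝ :=
  ∑ i, ∑ j, ricciCoord (comp (chartAt (Model n) x) g) i j (chartAt (Model n) x x)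
    * dcoord (chartAt (Model n) x) x i v * dcoord (chartAt (Model n) x) x j v

/-- The pairing `⟨Ric[g](X,X), φ |dy|⟩` of the distribution `Ric[g](X,X)` with the test density
`φ |dy|` supported in the domain of the chart `e` with coordinates `y`. -/
def distRicci (e : OpenPartialHomeomorph M (Model n)) (g : CovTwo n M) (X : VecField n M)
    (φ : Model n → ℝ) : ℝ :=
  ∑ i, ∑ j, distRicciCoord e.target (comp e g) i j
    (fun y => vecComp e X i y * vecComp e X j y * φ y)

/-- `Ric[g](X,X) ≥ C g(X,X)` as scalar distributions: the difference is nonnegative on every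
nonnegative test density. By a partition of unity it is enough to
consider densities `φ |dy|` supported in the domain of some chart. -/
def DistRicciGE (g : CovTwo n M) (C : ℝ) (X : VecField n M) : Prop :=
  ∀ e ∈ IsManifold.maximalAtlas (𝓡 n) ∞ M, ∀ φ : Model n → ℝ,
    ContDiff ℝ ∞ φ → HasCompactSupport φ → tsupport φ ⊆ e.target → (∀ y, 0 ≤ φ y) →
      C * (∫ y in e.target, g (e.symm y) (X (e.symm y)) (X (e.symm y)) * φ y)
        ≤ distRicci e g X φ

end Manifold

/-! ### Regularisation by convolution in charts -/

/-- The choices that enter the convolution on the manifold: a countable locally finite cover by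
relatively compact chart domains, a subordinate partition of unity, cut-off functions, and a
mollifier. -/
structure Mollification (n : ℕ) (M : Type*) [TopologicalSpace M] [ChartedSpace (Model n) M] where
  /-- The charts `ψ_α`. -/
  chart : ℕ → OpenPartialHomeomorph M (Model n)
  chart_mem : ∀ α, chart α ∈ IsManifold.maximalAtlas (𝓡 n) ∞ M
  isCompact_closure : ∀ α, IsCompact (closure (chart α).source)
  locallyFinite : LocallyFinite fun α => (chart α).source
  cover : ⋃ α, (chart α).source = univ
  /-- The partition of unity `ξ_α`. -/
  ξ : SmoothPartitionOfUnity ℕ (𝓡 n) M univ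
  subordinate : ξ.IsSubordinate fun α => (chart α).source
  /-- The cut-off functions `χ_α`. -/
  χ : ℕ → M → ℝ
  χ_smooth : ∀ α, ContMDiff (𝓡 n) 𝓘(ℝ, ℝ) ∞ (χ α)
  χ_compact : ∀ α, HasCompactSupport (χ α)
  χ_support : ∀ α, tsupport (χ α) ⊆ (chart α).source
  χ_eq_one : ∀ α, ∀ᶠ x in 𝓝ˢ (tsupport (ξ α)), χ α x = 1
  /-- The mollifier `ρ`. -/
  ρ : Model n → ℝ
  ρ_smooth : ContDiff ℝ ∞ ρ
  ρ_support : tsupport ρ ⊆ Metric.ball 0 1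
  ρ_nonneg : ∀ y, 0 ≤ ρ y
  ρ_integral : ∫ y, ρ y = 1

section Regularisation

variable {n : ℕ} {M : Type*} [TopologicalSpace M] [ChartedSpace (Model n) M]

/-- `ρ_ε(y) = ε⁻ⁿ ρ(y/ε)`. -/
def Mollification.ρε (R : Mollification n M) (ε : ℝ) (y : Model n) : ℝ :=
  (ε ^ n)⁻¹ * R.ρ (ε⁻¹ • y)

/-- `((ψ_α)_*(ξ_α T))_{ij} * ρ_ε` at `y`. -/
def Mollification.convComp (R : Mollification n M) (ε : ℝ) (T : CovTwo n M) (α : ℕ)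
    (i j : Fin n) (y : Model n) : ℝ :=
  ∫ z in (R.chart α).target,
    R.ξ α ((R.chart α).symm z) * comp (R.chart α) T z i j * R.ρε ε (y - z)

/-- `T ⋆_M ρ_ε = ∑_α χ_α (ψ_α)^* [((ψ_α)_*(ξ_α T)) * ρ_ε]`, a locally finite sum. -/
def Mollification.conv (R : Mollification n M) (ε : ℝ) (T : CovTwo n M) : CovTwo n M :=
  fun x => ∑ᶠ α, R.χ α x • ∑ i, ∑ j, R.convComp ε T α i j (R.chart α x) •
    (dcoord (R.chart α) x i).smulRight (dcoord (R.chart α) x j)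

/-- The sequence `g_k` of smooth Lorentzian metrics with narrower light cones than `g`, close
to the regularisations `g ⋆_M ρ_{ε_k}`. -/
structure IsInnerApprox (R : Mollification n M) (g : CovTwo n M) (ε : ℕ → ℝ)
    (gk : ℕ → CovTwo n M) : Prop where
  ε_pos : ∀ k, 0 < ε k
  ε_tendsto : Tendsto ε atTop (𝓝 0)
  smooth : ∀ k, IsSmoothCov (gk k)
  lorentzian : ∀ k, IsLorentzian (gk k)
  narrower : ∀ k, Narrower (gk k) g
  close : TendstoZeroSmoothLoc fun k x => gk k x - R.conv (ε k) g x
  /-- `Ric[g_k] - Ric[g ⋆_M ρ_{ε_k}]` stays bounded on compact sets. -/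
  ricci_close : ∀ e ∈ IsManifold.maximalAtlas (𝓡 n) ∞ M,
    ∀ L : Set (Model n), IsCompact L → L ⊆ e.target →
      ∃ c : ℝ, ∀ᶠ k in atTop, ∀ y ∈ L, ∀ i j : Fin n,
        |ricciCoord (comp e (gk k)) i j y - ricciCoord (comp e (R.conv (ε k) g)) i j y| ≤ c

end Regularisation

end LipschitzRicci

end

open LipschitzRicci

open Set Filter Topology MeasureTheory
open scoped Manifold ContDiff

noncomputable section

namespace LipschitzRicci

/-! ### Calculus of partial derivatives -/

section PartialDerivatives

variable {n : ℕ} {f f' : Model n → ℝ} {y : Model n} {i j : Fin n}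

/-! Write g_ε for the regularisation and L for a Lipschitz constant of g near a point. Mollifying a
Lipschitz function costs O(ε), leaves first derivatives bounded, and makes second derivatives
O(1/ε), because the derivatives of the mollifier have mean zero. The Ricci tensor of g_ε is
therefore, up to O(1), its principal part: the inverse metric contracted with second derivatives. A
factor of size ε in front of those derivatives is harmless, so g_ε⁻¹ may be replaced by g⁻¹.

The core is a commutator estimate. In the chart ψ_α, test the distribution Ric[g] against ξ_α ρ_ε(y
- ·). Integration by parts puts one derivative on the kernel; the Lipschitz factor g⁻¹ may then be
frozen at y with error (1/ε)·Lε = O(1) (`IsKernel.bddAlong_freeze`). What remains is the principal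
part formed with g⁻¹(y) and the second derivatives of (ξ_α g) * ρ_ε
(`bddAlong_distRicci_sub_principal`). The principal part transforms as a tensor under linear
pull-back (`principal_pull4`), and derivatives falling on transition maps contribute only O(1).
Summing over the charts near a point shows that Ric[g_ε] differs from the sum of the tested Ricci
tensors by a locally bounded term (`bddAlong_ricciCoord_conv_sub`).

The curvature hypothesis concerns global timelike fields, whereas the test needs a vector V with
constant coordinates. If g(V,V) ≤ η < 0 at one point and V is bounded, then V stays timelike on a
ball of uniform radius. After a choice of sign it lies in the same half cone as the given timelike
field, and a bump function glues the two (`exists_timelike_extension`). For small ε the test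
function lives where the glued field is ±V, so the tested Ricci tensor is at least C times the
mollified metric on V (`eventually_le_testRicci`).

Adding up over charts and passing from g_ε to g_k gives Ric[g_k](v,v) ≥ C g_k(v,v) - B‖v‖², with B
local and independent of D and η (`IsInnerApprox.exists_nhds_le_ricci`). Since g_k(v,v) ≤ η/2 for
large k, the error is absorbed into a multiple of g_k(v,v). Uniformity in the base point is encoded
by the product filters `atTop ×ˢ 𝓝 x₀`, and compactness does the rest. Coordinate invariance of the
classical Ricci tensor is needed because `ricci` is evaluated in a chart that varies with the point.
-/

theorem pd_congr (h : f =ᶠ[𝓝 y] f') (i : Fin n) : pd i f y = pd i f' y := by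
  simp only [pd, h.fderiv_eq]

theorem eventuallyEq_pd (h : f =ᶠ[𝓝 y] f') (i : Fin n) : pd i f =ᶠ[𝓝 y] pd i f' :=
  h.eventuallyEq_nhds.mono fun _ hz => pd_congr hz i

theorem pd_const (c : ℝ) : pd i (fun _ => c) y = 0 := by simp [pd]

theorem pd_add (hf : DifferentiableAt ℝ f y) (hf' : DifferentiableAt ℝ f' y) :
    pd i (fun z => f z + f' z) y = pd i f y + pd i f' y := by
  simp only [pd]; rw [fderiv_fun_add hf hf']; rfl

theorem pd_sub (hf : DifferentiableAt ℝ f y) (hf' : DifferentiableAt ℝ f' y) :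
    pd i (fun z => f z - f' z) y = pd i f y - pd i f' y := by
  simp only [pd]; rw [fderiv_fun_sub hf hf']; rfl

theorem pd_mul (hf : DifferentiableAt ℝ f y) (hf' : DifferentiableAt ℝ f' y) :
    pd i (fun z => f z * f' z) y = pd i f y * f' y + f y * pd i f' y := by
  simp only [pd]; rw [fderiv_fun_mul hf hf']; simp; ring

theorem pd_const_mul (c : ℝ) (hf : DifferentiableAt ℝ f y) :
    pd i (fun z => c * f z) y = c * pd i f y := by
  simp only [pd]; rw [fderiv_const_mul hf]; rfl

theorem pd_sum {ι : Type*} {s : Finset ι} {F : ι → Model n → ℝ}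
    (h : ∀ a ∈ s, DifferentiableAt ℝ (F a) y) :
    pd i (fun z => ∑ a ∈ s, F a z) y = ∑ a ∈ s, pd i (F a) y := by
  simp only [pd]; rw [fderiv_fun_sum h]; simp

theorem sum_smul_single (v : Model n) :
    ∑ a, v a • (EuclideanSpace.single a (1 : ℝ) : Model n) = v := by
  ext b
  simp [Finset.sum_apply, Pi.single_apply]

theorem clm_apply_eq_sum {F : Type*} [AddCommGroup F] [Module ℝ F] [TopologicalSpace F]
    (L : Model n →L[ℝ] F) (v : Model n) :
    L v = ∑ a, v a • L (EuclideanSpace.single a (1 : ℝ)) := by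
  conv_lhs => rw [← sum_smul_single v]
  simp

theorem fderiv_apply_eq_sum_pd (f : Model n → ℝ) (y v : Model n) :
    fderiv ℝ f y v = ∑ a, v a * pd a f y := by
  rw [clm_apply_eq_sum]; rfl

theorem fderiv_coord {τ : Model n → Model n} (hτ : DifferentiableAt ℝ τ y) (a : Fin n)
    (v : Model n) : fderiv ℝ (fun z => τ z a) y v = (fderiv ℝ τ y v) a := by
  have := ((EuclideanSpace.proj a : Model n →L[ℝ] ℝ).hasFDerivAt.comp y hτ.hasFDerivAt)
  exact congrArg (fun L => L v) this.fderiv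

theorem pd_comp {τ : Model n → Model n} (hf : DifferentiableAt ℝ f (τ y))
    (hτ : DifferentiableAt ℝ τ y) :
    pd i (fun z => f (τ z)) y = ∑ a, pd a f (τ y) * pd i (fun z => τ z a) y := by
  have h := (hf.hasFDerivAt.comp y hτ.hasFDerivAt).fderiv
  have h' : fderiv ℝ (fun z => f (τ z)) y = (fderiv ℝ f (τ y)).comp (fderiv ℝ τ y) := h
  simp only [pd]
  rw [h', ContinuousLinearMap.comp_apply, fderiv_apply_eq_sum_pd]
  refine Finset.sum_congr rfl fun a _ => ?_
  rw [fderiv_coord hτ, mul_comm]; rfl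

theorem contDiffAt_pd (hf : ContDiffAt ℝ ∞ f y) (i : Fin n) : ContDiffAt ℝ ∞ (pd i f) y :=
  (hf.fderiv_right (m := ∞) (by simp)).clm_apply contDiffAt_const

theorem contDiff_pd (hf : ContDiff ℝ ∞ f) (i : Fin n) : ContDiff ℝ ∞ (pd i f) :=
  contDiff_iff_contDiffAt.2 fun _ => contDiffAt_pd hf.contDiffAt i

theorem differentiableAt_of_smooth {F : Type*} [NormedAddCommGroup F] [NormedSpace ℝ F]
    {f : Model n → F} (hf : ContDiffAt ℝ ∞ f y) : DifferentiableAt ℝ f y :=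
  hf.differentiableAt (by simp)

theorem pd_comm (hf : ContDiffAt ℝ ∞ f y) (i j : Fin n) :
    pd i (pd j f) y = pd j (pd i f) y := by
  have hd : DifferentiableAt ℝ (fderiv ℝ f) y :=
    (hf.fderiv_right (m := ∞) (by simp)).differentiableAt (by simp)
  have key : ∀ a b : Fin n, pd a (pd b f) y =
      fderiv ℝ (fderiv ℝ f) y (EuclideanSpace.single a 1) (EuclideanSpace.single b 1) := by
    intro a b
    have : HasFDerivAt (pd b f) _ y := hd.hasFDerivAt.clm_apply (hasFDerivAt_const _ _)
    simp only [pd] at this ⊢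
    rw [this.fderiv]; simp
  rw [key, key]
  exact (hf.isSymmSndFDerivAt (by simpa using ENat.LEInfty.out)).eq _ _

theorem measurable_pd (f : Model n → ℝ) (i : Fin n) : Measurable (pd i f) :=
  measurable_fderiv_apply_const ℝ f _

theorem pd_eq_zero_of_notMem_tsupport (h : y ∉ tsupport f) (i : Fin n) : pd i f y = 0 := by
  have : f =ᶠ[𝓝 y] fun _ => (0 : ℝ) := notMem_tsupport_iff_eventuallyEq.1 h
  rw [pd_congr this, pd_const]

theorem abs_pd_le {c : NNReal} {s : Set (Model n)} (hs : s ∈ 𝓝 y)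
    (hf : LipschitzOnWith c f s) : |pd i f y| ≤ c := by
  have h := norm_fderiv_le_of_lipschitzOn ℝ hs hf
  have h2 := (fderiv ℝ f y).le_opNorm (EuclideanSpace.single i (1 : ℝ))
  rw [show ‖(EuclideanSpace.single i (1 : ℝ) : Model n)‖ = 1 by simp, mul_one] at h2
  exact (Real.norm_eq_abs _ ▸ h2).trans h

end PartialDerivatives

/-! ### Bounded families along a filter -/

section Bounded

variable {ι : Type*} {l : Filter ι}

/-- The family `f` is bounded along the filter `l`. -/
def BddAlong (l : Filter ι) (f : ι → ℝ) : Prop := f =O[l] fun _ => (1 : ℝ)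

theorem bddAlong_iff {f : ι → ℝ} : BddAlong l f ↔ ∃ c, ∀ᶠ p in l, |f p| ≤ c := by
  simp [BddAlong, Asymptotics.isBigO_iff]

variable {f f' f'' : ι → ℝ}

theorem BddAlong.congr (hf : BddAlong l f) (h : f =ᶠ[l] f') : BddAlong l f' :=
  Asymptotics.IsBigO.congr' hf h EventuallyEq.rfl

theorem BddAlong.add (hf : BddAlong l f) (hf' : BddAlong l f') :
    BddAlong l fun p => f p + f' p := Asymptotics.IsBigO.add hf hf'

theorem BddAlong.sub (hf : BddAlong l f) (hf' : BddAlong l f') :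
    BddAlong l fun p => f p - f' p := Asymptotics.IsBigO.sub hf hf'

theorem BddAlong.neg (hf : BddAlong l f) : BddAlong l fun p => - f p :=
  Asymptotics.IsBigO.neg_left hf

theorem BddAlong.mul (hf : BddAlong l f) (hf' : BddAlong l f') :
    BddAlong l fun p => f p * f' p := by
  simpa [BddAlong] using Asymptotics.IsBigO.mul hf hf'

theorem bddAlong_const (c : ℝ) : BddAlong l fun _ => c :=
  Asymptotics.isBigO_const_const _ one_ne_zero _

theorem BddAlong.sum {κ : Type*} {s : Finset κ} {F : κ → ι → ℝ}
    (h : ∀ a ∈ s, BddAlong l (F a)) : BddAlong l fun p => ∑ a ∈ s, F a p :=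
  Asymptotics.IsBigO.fun_sum h

theorem bddAlong_of_tendsto {c : ℝ} (h : Tendsto f l (𝓝 c)) : BddAlong l f :=
  h.isBigO_one ℝ

theorem bddAlong_sub_trans (h : BddAlong l fun p => f p - f' p)
    (h' : BddAlong l fun p => f' p - f'' p) : BddAlong l fun p => f p - f'' p := by
  simpa using h.add h'

theorem bddAlong_sub_symm (h : BddAlong l fun p => f p - f' p) :
    BddAlong l fun p => f' p - f p := by
  simpa using h.neg

theorem bddAlong_sum_sub {κ : Type*} {s : Finset κ} {F F' : κ → ι → ℝ}
    (h : ∀ a ∈ s, BddAlong l fun p => F a p - F' a p) :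
    BddAlong l fun p => (∑ a ∈ s, F a p) - ∑ a ∈ s, F' a p := by
  simpa [Finset.sum_sub_distrib] using BddAlong.sum h

theorem bddAlong_mul_sub (hf : BddAlong l f) {F F' : ι → ℝ}
    (h : BddAlong l fun p => F p - F' p) : BddAlong l fun p => f p * F p - f p * F' p := by
  simpa [mul_sub] using hf.mul h

/-- The mechanism behind the cancellations: a quantity of size ε absorbs one of size 1/ε. -/
theorem BddAlong.mul_of_isBigO {e : ι → ℝ} (he : ∀ᶠ p in l, 0 < e p) (hf : f =O[l] e)
    (hf' : f' =O[l] fun p => (e p)⁻¹) : BddAlong l fun p => f p * f' p := by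
  refine (hf.mul hf').congr' EventuallyEq.rfl ?_
  filter_upwards [he] with p hp using mul_inv_cancel₀ hp.ne'

end Bounded

/-! ### Principal part of the Ricci tensor -/

section Principal

variable {n : ℕ}

theorem contDiffAt_det {k : ℕ} {A : Model n → Matrix (Fin k) (Fin k) ℝ} {y : Model n}
    (h : ∀ i j, ContDiffAt ℝ ∞ (fun z => A z i j) y) :
    ContDiffAt ℝ ∞ (fun z => (A z).det) y := by
  simp only [Matrix.det_apply]
  refine ContDiffAt.sum fun σ _ => ContDiffAt.const_smul _ ?_
  exact contDiffAt_prod fun i _ => h _ _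

theorem inv_apply_eq {k : ℕ} (A : Matrix (Fin k) (Fin k) ℝ) (i j : Fin k) :
    A⁻¹ i j = (A.det)⁻¹ * A.adjugate i j := by
  rw [Matrix.inv_def, Ring.inverse_eq_inv']; rfl

theorem contDiffAt_inv_apply {k : ℕ} {A : Model n → Matrix (Fin k) (Fin k) ℝ} {y : Model n}
    (h : ∀ i j, ContDiffAt ℝ ∞ (fun z => A z i j) y) (hd : (A y).det ≠ 0) (i j : Fin k) :
    ContDiffAt ℝ ∞ (fun z => (A z)⁻¹ i j) y := by
  simp only [inv_apply_eq]
  refine ((contDiffAt_det h).inv hd).mul ?_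
  simp only [Matrix.adjugate_apply]
  refine contDiffAt_det fun a b => ?_
  by_cases hab : a = j
  · subst hab; simpa using contDiffAt_const
  · simpa [Matrix.updateRow_ne hab] using h a b

theorem tendsto_inv_apply {ι : Type*} {l : Filter ι} {k : ℕ} {A : ι → Matrix (Fin k) (Fin k) ℝ}
    {A₀ : Matrix (Fin k) (Fin k) ℝ} (h : ∀ i j, Tendsto (fun p => A p i j) l (𝓝 (A₀ i j)))
    (hd : A₀.det ≠ 0) (i j : Fin k) : Tendsto (fun p => (A p)⁻¹ i j) l (𝓝 (A₀⁻¹ i j)) := by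
  have hA : Tendsto A l (𝓝 A₀) := tendsto_pi_nhds.2 fun i => tendsto_pi_nhds.2 fun j => h i j
  simp only [inv_apply_eq]
  refine Tendsto.mul (((continuous_id.matrix_det.tendsto A₀).comp hA).inv₀ hd) ?_
  exact (((continuous_id.matrix_adjugate.matrix_elem i j).tendsto A₀).comp hA)

theorem eventually_det_ne_zero {ι : Type*} {l : Filter ι} {k : ℕ}
    {A : ι → Matrix (Fin k) (Fin k) ℝ}
    {A₀ : Matrix (Fin k) (Fin k) ℝ} (h : ∀ i j, Tendsto (fun p => A p i j) l (𝓝 (A₀ i j)))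
    (hd : A₀.det ≠ 0) : ∀ᶠ p in l, (A p).det ≠ 0 := by
  have hA : Tendsto A l (𝓝 A₀) := tendsto_pi_nhds.2 fun i => tendsto_pi_nhds.2 fun j => h i j
  exact ((continuous_id.matrix_det.tendsto A₀).comp hA).eventually_ne hd

/-- The resolvent identity A⁻¹ - B⁻¹ = A⁻¹(B - A)B⁻¹. It makes the inverse metric Lipschitz and
compares the inverses of the regularised and original metrics to order ε. -/
theorem inv_sub_inv_apply {k : ℕ} {A B : Matrix (Fin k) (Fin k) ℝ} (hA : A.det ≠ 0)
    (hB : B.det ≠ 0) (i j : Fin k) :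
    A⁻¹ i j - B⁻¹ i j = ∑ b, (∑ a, A⁻¹ i a * (B a b - A a b)) * B⁻¹ b j := by
  have : A⁻¹ - B⁻¹ = A⁻¹ * (B - A) * B⁻¹ := by
    rw [mul_sub, sub_mul, Matrix.nonsing_inv_mul _ (isUnit_iff_ne_zero.2 hA), one_mul, mul_assoc,
      Matrix.mul_nonsing_inv _ (isUnit_iff_ne_zero.2 hB), mul_one]
  have h2 := congrArg (fun C : Matrix (Fin k) (Fin k) ℝ => C i j) this
  simpa [Matrix.mul_apply] using h2

/-- The part of the Ricci tensor that is linear in the second derivatives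
`S p q r s = ∂_p ∂_q G_{rs}` of the metric, with `H` in the place of the inverse metric. -/
def principal (H : Matrix (Fin n) (Fin n) ℝ) (S : Fin n → Fin n → Fin n → Fin n → ℝ)
    (i j : Fin n) : ℝ :=
  (∑ m, (1 / 2 : ℝ) * ∑ l, H m l * (S m i j l + S m j i l - S m l i j))
    - ∑ m, (1 / 2 : ℝ) * ∑ l, H m l * (S j i m l + S j m i l - S j l i m)

/-- Second partial derivatives of the components of `G`. -/
def secondPd (G : Model n → Matrix (Fin n) (Fin n) ℝ) (y : Model n) (p q r s : Fin n) : ℝ :=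
  pd p (pd q fun z => G z r s) y

/-- Twice the Christoffel symbol of the first kind. -/
def koszul (G : Model n → Matrix (Fin n) (Fin n) ℝ) (i j l : Fin n) (y : Model n) : ℝ :=
  pd i (fun z => G z j l) y + pd j (fun z => G z i l) y - pd l (fun z => G z i j) y

theorem christoffel_eq (G : Model n → Matrix (Fin n) (Fin n) ℝ) (m i j : Fin n) (y : Model n) :
    christoffel G m i j y = (1 / 2 : ℝ) * ∑ l, (G y)⁻¹ m l * koszul G i j l y := rfl

variable {G : Model n → Matrix (Fin n) (Fin n) ℝ} {y : Model n}

theorem contDiffAt_koszul (hG : ∀ i j, ContDiffAt ℝ ∞ (fun z => G z i j) y) (i j l : Fin n) :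
    ContDiffAt ℝ ∞ (koszul G i j l) y :=
  ((contDiffAt_pd (hG j l) i).add (contDiffAt_pd (hG i l) j)).sub (contDiffAt_pd (hG i j) l)

theorem contDiffAt_christoffel (hG : ∀ i j, ContDiffAt ℝ ∞ (fun z => G z i j) y)
    (hd : (G y).det ≠ 0) (m i j : Fin n) : ContDiffAt ℝ ∞ (christoffel G m i j) y := by
  have : christoffel G m i j = fun y => (1 / 2 : ℝ) * ∑ l, (G y)⁻¹ m l * koszul G i j l y := rfl
  rw [this]
  exact contDiffAt_const.mul (ContDiffAt.sum fun l _ =>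
    (contDiffAt_inv_apply hG hd m l).mul (contDiffAt_koszul hG i j l))

theorem pd_koszul (hG : ∀ i j, ContDiffAt ℝ ∞ (fun z => G z i j) y) (k i j l : Fin n) :
    pd k (koszul G i j l) y = secondPd G y k i j l + secondPd G y k j i l
      - secondPd G y k l i j := by
  have h : ∀ a b c, DifferentiableAt ℝ (pd a fun z => G z b c) y := fun a b c =>
    differentiableAt_of_smooth (contDiffAt_pd (hG b c) a)
  have : koszul G i j l = fun y => (pd i (fun z => G z j l) y + pd j (fun z => G z i l) y)
    - pd l (fun z => G z i j) y := rfl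
  rw [this, pd_sub ((h _ _ _).fun_add (h _ _ _)) (h _ _ _), pd_add (h _ _ _) (h _ _ _)]
  rfl

/-- Differentiate G⁻¹G = 1, an identity available only where the determinant is nonzero, and
multiply on the right by G⁻¹. -/
theorem pd_inv_apply (hG : ∀ i j, ContDiffAt ℝ ∞ (fun z => G z i j) y) (hd : (G y).det ≠ 0)
    (k m l : Fin n) : pd k (fun z => (G z)⁻¹ m l) y
      = -∑ b, (∑ a, (G y)⁻¹ m a * pd k (fun z => G z a b) y) * (G y)⁻¹ b l := by
  have hev : ∀ᶠ z in 𝓝 y, (G z).det ≠ 0 :=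
    (contDiffAt_det hG).continuousAt.eventually_ne hd
  have hI : ∀ a b, DifferentiableAt ℝ (fun z => (G z)⁻¹ a b) y := fun a b =>
    differentiableAt_of_smooth (contDiffAt_inv_apply hG hd a b)
  have hG' : ∀ a b, DifferentiableAt ℝ (fun z => G z a b) y := fun a b =>
    differentiableAt_of_smooth (hG a b)
  have e1 : ∀ b, ∑ a, pd k (fun z => (G z)⁻¹ m a) y * G y a b
      = - ∑ a, (G y)⁻¹ m a * pd k (fun z => G z a b) y := by
    intro b
    have hc : (fun z => ∑ a, (G z)⁻¹ m a * G z a b) =ᶠ[𝓝 y]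
        fun _ => (1 : Matrix (Fin n) (Fin n) ℝ) m b := by
      filter_upwards [hev] with z hz
      rw [← Matrix.mul_apply, Matrix.nonsing_inv_mul _ (isUnit_iff_ne_zero.2 hz)]
    have := pd_congr hc k
    rw [pd_const, pd_sum fun a _ => (hI m a).fun_mul (hG' a b)] at this
    rw [Finset.sum_congr rfl fun a _ => pd_mul (hI m a) (hG' a b), Finset.sum_add_distrib] at this
    linarith
  have e2 : ∀ a, ∑ b, G y a b * (G y)⁻¹ b l = (1 : Matrix (Fin n) (Fin n) ℝ) a l := by
    intro a
    rw [← Matrix.mul_apply, Matrix.mul_nonsing_inv _ (isUnit_iff_ne_zero.2 hd)]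
  calc pd k (fun z => (G z)⁻¹ m l) y
      = ∑ a, pd k (fun z => (G z)⁻¹ m a) y * ∑ b, G y a b * (G y)⁻¹ b l := by
        simp [e2, Matrix.one_apply]
    _ = ∑ b, (∑ a, pd k (fun z => (G z)⁻¹ m a) y * G y a b) * (G y)⁻¹ b l := by
        simp only [Finset.mul_sum, Finset.sum_mul, mul_assoc]
        exact Finset.sum_comm
    _ = _ := by simp [e1, Finset.sum_neg_distrib]

theorem pd_christoffel (hG : ∀ i j, ContDiffAt ℝ ∞ (fun z => G z i j) y) (hd : (G y).det ≠ 0)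
    (k m i j : Fin n) : pd k (christoffel G m i j) y =
      (1 / 2 : ℝ) * ∑ l, pd k (fun z => (G z)⁻¹ m l) y * koszul G i j l y
      + (1 / 2 : ℝ) * ∑ l, (G y)⁻¹ m l * (secondPd G y k i j l + secondPd G y k j i l
      - secondPd G y k l i j) := by
  have hI : ∀ a b, DifferentiableAt ℝ (fun z => (G z)⁻¹ a b) y := fun a b =>
    differentiableAt_of_smooth (contDiffAt_inv_apply hG hd a b)
  have hK : ∀ l, DifferentiableAt ℝ (koszul G i j l) y := fun l =>
    differentiableAt_of_smooth (contDiffAt_koszul hG i j l)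
  have : christoffel G m i j = fun y => (1 / 2 : ℝ) * ∑ l, (G y)⁻¹ m l * koszul G i j l y := rfl
  rw [this, pd_const_mul _ (DifferentiableAt.fun_sum fun l _ => (hI m l).fun_mul (hK l)),
    pd_sum fun l _ => (hI m l).fun_mul (hK l),
    Finset.sum_congr rfl fun l _ => pd_mul (hI m l) (hK l), Finset.sum_add_distrib, mul_add]
  simp only [pd_koszul hG]

variable {ι : Type*} {l : Filter ι} {Gf : ι → Model n → Matrix (Fin n) (Fin n) ℝ}
  {yf : ι → Model n}

theorem bddAlong_koszul
    (hpd : ∀ k i j, BddAlong l fun p => pd k (fun z => Gf p z i j) (yf p)) (i j k : Fin n) :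
    BddAlong l fun p => koszul (Gf p) i j k (yf p) :=
  ((hpd _ _ _).add (hpd _ _ _)).sub (hpd _ _ _)

theorem bddAlong_christoffel (hinv : ∀ i j, BddAlong l fun p => (Gf p (yf p))⁻¹ i j)
    (hpd : ∀ k i j, BddAlong l fun p => pd k (fun z => Gf p z i j) (yf p)) (m i j : Fin n) :
    BddAlong l fun p => christoffel (Gf p) m i j (yf p) :=
  (bddAlong_const _).mul (BddAlong.sum fun _ _ => (hinv _ _).mul (bddAlong_koszul hpd _ _ _))

theorem bddAlong_ricciQuad (hinv : ∀ i j, BddAlong l fun p => (Gf p (yf p))⁻¹ i j)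
    (hpd : ∀ k i j, BddAlong l fun p => pd k (fun z => Gf p z i j) (yf p)) (i j : Fin n) :
    BddAlong l fun p => ricciQuad (Gf p) i j (yf p) := by
  have := bddAlong_christoffel hinv hpd
  exact BddAlong.sum fun _ _ => BddAlong.sum fun _ _ =>
    ((this _ _ _).mul (this _ _ _)).sub ((this _ _ _).mul (this _ _ _))

/-- Up to bounded terms, the Ricci tensor is its principal part. -/
theorem bddAlong_ricciCoord_sub_principal
    (hG : ∀ᶠ p in l, ∀ i j, ContDiffAt ℝ ∞ (fun z => Gf p z i j) (yf p))
    (hd : ∀ᶠ p in l, (Gf p (yf p)).det ≠ 0)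
    (hinv : ∀ i j, BddAlong l fun p => (Gf p (yf p))⁻¹ i j)
    (hpd : ∀ k i j, BddAlong l fun p => pd k (fun z => Gf p z i j) (yf p)) (i j : Fin n) :
    BddAlong l fun p => ricciCoord (Gf p) i j (yf p)
      - principal (Gf p (yf p))⁻¹ (secondPd (Gf p) (yf p)) i j := by
  -- The derivative of the inverse is -G⁻¹(∂G)G⁻¹, so bounds on the inverse and on first derivatives
  -- suffice.
  have hpinv : ∀ k a b, BddAlong l fun p => pd k (fun z => (Gf p z)⁻¹ a b) (yf p) := by
    intro k a b
    have h1 : BddAlong l fun p => -∑ d, (∑ c, (Gf p (yf p))⁻¹ a c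
        * pd k (fun z => Gf p z c d) (yf p)) * (Gf p (yf p))⁻¹ d b :=
      (BddAlong.sum fun _ _ => (BddAlong.sum fun _ _ => (hinv _ _).mul (hpd _ _ _)).mul
        (hinv _ _)).neg
    refine h1.congr ?_
    filter_upwards [hG, hd] with p hp hp' using (pd_inv_apply hp hp' k a b).symm
  have hE : ∀ k m a b, BddAlong l fun p =>
      (1 / 2 : ℝ) * ∑ c, pd k (fun z => (Gf p z)⁻¹ m c) (yf p) * koszul (Gf p) a b c (yf p) :=
    fun k m a b => (bddAlong_const _).mul (BddAlong.sum fun _ _ => (hpinv _ _ _).mul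
      (bddAlong_koszul hpd _ _ _))
  have := ((BddAlong.sum (s := Finset.univ) fun m _ => hE m m i j).sub
    (BddAlong.sum (s := Finset.univ) fun m _ => hE j m i m)).add (bddAlong_ricciQuad hinv hpd i j)
  refine this.congr ?_
  filter_upwards [hG, hd] with p hp hp'
  simp only [ricciCoord, principal, pd_christoffel hp hp', Finset.sum_add_distrib]
  ring

/-- The hypothesis bounds products, not the difference of the coefficients, because the second
derivatives S blow up like 1/ε and only (H - H')·S stays bounded. -/
theorem bddAlong_principal_sub_left {H H' : ι → Matrix (Fin n) (Fin n) ℝ}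
    {S : ι → Fin n → Fin n → Fin n → Fin n → ℝ}
    (h : ∀ a b c d i j, BddAlong l fun p => (H p i j - H' p i j) * S p a b c d) (i j : Fin n) :
    BddAlong l fun p => principal (H p) (S p) i j - principal (H' p) (S p) i j := by
  have key : ∀ m k a b c, BddAlong l fun p => (H p m k - H' p m k) *
      (S p a b c k + S p a c b k - S p a k b c) := by
    intro m k a b c
    refine (((h a b c k m k).add (h a c b k m k)).sub (h a k b c m k)).congr ?_
    filter_upwards with p; ring
  have := (BddAlong.sum (s := Finset.univ) fun m _ => (bddAlong_const (1 / 2 : ℝ)).mul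
    (BddAlong.sum (s := Finset.univ) fun k _ => key m k m i j)).sub
    (BddAlong.sum (s := Finset.univ) fun m _ => (bddAlong_const (1 / 2 : ℝ)).mul
    (BddAlong.sum (s := Finset.univ) fun k _ => key m k j i m))
  refine this.congr (Eventually.of_forall fun p => ?_)
  simp only [principal, sub_mul, Finset.sum_sub_distrib, mul_sub]
  ring

theorem bddAlong_principal_sub_right {H : ι → Matrix (Fin n) (Fin n) ℝ}
    {S S' : ι → Fin n → Fin n → Fin n → Fin n → ℝ} (hH : ∀ i j, BddAlong l fun p => H p i j)
    (h : ∀ a b c d, BddAlong l fun p => S p a b c d - S' p a b c d) (i j : Fin n) :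
    BddAlong l fun p => principal (H p) (S p) i j - principal (H p) (S' p) i j := by
  have key : ∀ m k a b c, BddAlong l fun p => H p m k *
      ((S p a b c k - S' p a b c k) + (S p a c b k - S' p a c b k)
        - (S p a k b c - S' p a k b c)) := fun m k a b c =>
    (hH m k).mul (((h _ _ _ _).add (h _ _ _ _)).sub (h _ _ _ _))
  have := (BddAlong.sum (s := Finset.univ) fun m _ => (bddAlong_const (1 / 2 : ℝ)).mul
    (BddAlong.sum (s := Finset.univ) fun k _ => key m k m i j)).sub
    (BddAlong.sum (s := Finset.univ) fun m _ => (bddAlong_const (1 / 2 : ℝ)).mul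
    (BddAlong.sum (s := Finset.univ) fun k _ => key m k j i m))
  refine this.congr (Eventually.of_forall fun p => ?_)
  simp only [principal, sub_eq_add_neg, neg_add, mul_add, Finset.sum_add_distrib, mul_neg,
    Finset.sum_neg_distrib, neg_neg]
  ring

end Principal

/-! ### Mollification in `ℝⁿ` -/

section Mollify

variable {n : ℕ}

/-- A smooth function supported in the open unit ball. -/
structure IsKernel (κ : Model n → ℝ) : Prop where
  smooth : ContDiff ℝ ∞ κ
  support : tsupport κ ⊆ Metric.ball 0 1

/-- The rescaling `ε⁻ⁿ κ(y/ε)`. -/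
def scaled (κ : Model n → ℝ) (ε : ℝ) (y : Model n) : ℝ := (ε ^ n)⁻¹ * κ (ε⁻¹ • y)

/-- The convolution of `f` with the rescaled kernel. -/
def moll (κ : Model n → ℝ) (ε : ℝ) (f : Model n → ℝ) (y : Model n) : ℝ :=
  ∫ z, f z * scaled κ ε (y - z)

variable {κ f : Model n → ℝ} {ε : ℝ} {y : Model n}

theorem IsKernel.partialDeriv (hκ : IsKernel κ) (i : Fin n) : IsKernel (pd i κ) where
  smooth := contDiff_pd hκ.smooth i
  support := by
    refine (closure_minimal (fun z hz => ?_) (isClosed_tsupport κ)).trans hκ.support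
    by_contra h
    exact hz (pd_eq_zero_of_notMem_tsupport h i)

theorem IsKernel.hasCompactSupport (hκ : IsKernel κ) : HasCompactSupport κ :=
  HasCompactSupport.of_support_subset_isCompact (isCompact_closedBall (0 : Model n) 1)
    ((subset_tsupport κ).trans (hκ.support.trans Metric.ball_subset_closedBall))

theorem IsKernel.contDiff_scaled (hκ : IsKernel κ) (ε : ℝ) : ContDiff ℝ ∞ (scaled κ ε) :=
  contDiff_const.mul (hκ.smooth.comp (contDiff_const_smul _))

theorem IsKernel.scaled_eq_zero (hκ : IsKernel κ) (hε : 0 < ε) (hy : ε ≤ ‖y‖) :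
    scaled κ ε y = 0 := by
  have : ε⁻¹ • y ∉ tsupport κ := fun h => by
    have := hκ.support h
    rw [mem_ball_zero_iff, norm_smul, norm_inv, Real.norm_of_nonneg hε.le,
      inv_mul_lt_iff₀ hε, mul_one] at this
    exact this.not_ge hy
  simp [scaled, image_eq_zero_of_notMem_tsupport this]

theorem IsKernel.hasCompactSupport_scaled (hκ : IsKernel κ) (hε : 0 < ε) :
    HasCompactSupport (scaled κ ε) :=
  HasCompactSupport.intro (isCompact_closedBall (0 : Model n) ε) fun z hz =>
    hκ.scaled_eq_zero hε (by simpa using (not_le.1 fun h => hz (mem_closedBall_zero_iff.2 h)).le)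

theorem pd_scaled (hκ : IsKernel κ) (ε : ℝ) (i : Fin n) :
    pd i (scaled κ ε) = fun y => ε⁻¹ * scaled (pd i κ) ε y := by
  ext y
  have h1 : DifferentiableAt ℝ κ (ε⁻¹ • y) := hκ.smooth.differentiable (by simp) _
  have h2 : HasFDerivAt (fun z : Model n => κ (ε⁻¹ • z)) _ y :=
    h1.hasFDerivAt.comp y ((hasFDerivAt_id y).const_smul ε⁻¹)
  have h3 : HasFDerivAt (scaled κ ε) _ y := h2.const_mul ((ε ^ n)⁻¹)
  simp only [pd, h3.fderiv]
  simp [scaled, pd]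
  ring

theorem integral_scaled (κ : Model n → ℝ) (hε : 0 < ε) (y : Model n) :
    ∫ z, scaled κ ε (y - z) = ∫ z, κ z := by
  rw [integral_sub_left_eq_self (scaled κ ε) volume y]
  simp only [scaled]
  rw [integral_const_mul, Measure.integral_comp_inv_smul volume κ ε]
  have : (ε ^ n) ≠ 0 := (pow_pos hε n).ne'
  simp [abs_of_pos hε, this]

theorem IsKernel.continuous_scaled_sub (hκ : IsKernel κ) (ε : ℝ) (y : Model n) :
    Continuous fun z => scaled κ ε (y - z) :=
  (hκ.contDiff_scaled ε).continuous.comp (continuous_const.sub continuous_id)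

theorem IsKernel.hasCompactSupport_scaled_sub (hκ : IsKernel κ) (hε : 0 < ε) (y : Model n) :
    HasCompactSupport fun z => scaled κ ε (y - z) :=
  HasCompactSupport.intro (isCompact_closedBall y ε) fun z hz =>
    hκ.scaled_eq_zero hε (by
      rw [← dist_eq_norm, dist_comm]; exact (not_le.1 fun h => hz (Metric.mem_closedBall.2 h)).le)

theorem IsKernel.integrable_scaled_sub (hκ : IsKernel κ) (hε : 0 < ε) (y : Model n) :
    Integrable fun z => scaled κ ε (y - z) :=
  (hκ.continuous_scaled_sub ε y).integrable_of_hasCompactSupport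
    (hκ.hasCompactSupport_scaled_sub hε y)

theorem IsKernel.scaled_sub_eq_zero (hκ : IsKernel κ) (hε : 0 < ε) {z : Model n}
    (hz : z ∉ Metric.ball y ε) : scaled κ ε (y - z) = 0 :=
  hκ.scaled_eq_zero hε (by
    rw [← dist_eq_norm, dist_comm]; exact not_lt.1 fun h => hz (Metric.mem_ball.2 h))

theorem IsKernel.abs_mul_scaled_le (hκ : IsKernel κ) (hε : 0 < ε) {w : Model n → ℝ} {b : ℝ}
    (hw : ∀ z ∈ Metric.ball y ε, |w z| ≤ b) (z : Model n) :
    |w z * scaled κ ε (y - z)| ≤ b * |scaled κ ε (y - z)| := by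
  by_cases hz : z ∈ Metric.ball y ε
  · rw [abs_mul]; exact mul_le_mul_of_nonneg_right (hw z hz) (abs_nonneg _)
  · simp [hκ.scaled_sub_eq_zero hε hz]

theorem IsKernel.abs_integral_le (hκ : IsKernel κ) (hε : 0 < ε) {w : Model n → ℝ} {b : ℝ}
    (hw : ∀ z ∈ Metric.ball y ε, |w z| ≤ b) :
    |∫ z, w z * scaled κ ε (y - z)| ≤ b * ∫ z, |κ z| := by
  have hi := hκ.integrable_scaled_sub hε y
  have h1 : ∫ z, |scaled κ ε (y - z)| = ∫ z, |κ z| := by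
    rw [← integral_scaled (fun z => |κ z|) hε y]
    simp only [scaled, abs_mul, abs_of_pos (inv_pos.2 (pow_pos hε n))]
  rw [← h1, ← integral_const_mul, ← Real.norm_eq_abs]
  exact norm_integral_le_of_norm_le (hi.abs.const_mul b)
    (Eventually.of_forall (hκ.abs_mul_scaled_le hε hw))

theorem IsKernel.integrable_mul_scaled (hκ : IsKernel κ) (hε : 0 < ε) {w : Model n → ℝ} {b : ℝ}
    (hw : ∀ z ∈ Metric.ball y ε, |w z| ≤ b) (hm : AEStronglyMeasurable w volume) :
    Integrable fun z => w z * scaled κ ε (y - z) :=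
  ((hκ.integrable_scaled_sub hε y).abs.const_mul b).mono'
    (hm.mul (hκ.continuous_scaled_sub ε y).aestronglyMeasurable)
    (Eventually.of_forall (hκ.abs_mul_scaled_le hε hw))

theorem IsKernel.integrable_mul_scaled_of_continuous (hκ : IsKernel κ) (hε : 0 < ε)
    (hf : Continuous f) (y : Model n) : Integrable fun z => f z * scaled κ ε (y - z) :=
  (hf.mul (hκ.continuous_scaled_sub ε y)).integrable_of_hasCompactSupport
    ((hκ.hasCompactSupport_scaled_sub hε y).mul_left)

theorem moll_eq_convolution (κ : Model n → ℝ) (ε : ℝ) (f : Model n → ℝ) :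
    moll κ ε f = convolution f (scaled κ ε) (ContinuousLinearMap.mul ℝ ℝ) volume := by
  ext y; simp [moll, convolution]

theorem IsKernel.contDiff_moll (hκ : IsKernel κ) (hε : 0 < ε) (hf : Continuous f) :
    ContDiff ℝ ∞ (moll κ ε f) := by
  rw [moll_eq_convolution]
  exact (hκ.hasCompactSupport_scaled hε).contDiff_convolution_right _ hf.locallyIntegrable
    (hκ.contDiff_scaled ε)

theorem IsKernel.pd_moll (hκ : IsKernel κ) (hε : 0 < ε) (hf : Continuous f) (i : Fin n) :
    pd i (moll κ ε f) = fun y => ε⁻¹ * moll (pd i κ) ε f y := by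
  ext y
  have hs := (hκ.contDiff_scaled ε).of_le (m := 1) ENat.LEInfty.out
  have hc := hκ.hasCompactSupport_scaled hε
  have h := hc.hasFDerivAt_convolution_right (ContinuousLinearMap.mul ℝ ℝ)
    (hf.locallyIntegrable (μ := volume)) hs y
  simp only [pd, moll_eq_convolution κ]
  rw [h.fderiv, convolution_precompR_apply _ hf.locallyIntegrable (hc.fderiv ℝ)
    (hs.continuous_fderiv one_ne_zero)]
  have h2 : (fun a => fderiv ℝ (scaled κ ε) a (EuclideanSpace.single i 1)) =
      fun y => ε⁻¹ * scaled (pd i κ) ε y := pd_scaled hκ ε i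
  rw [h2, moll, ← integral_const_mul]
  simp only [convolution, ContinuousLinearMap.mul_apply']
  congr 1; ext z; ring

/-- Integration by parts of κ against the constant function 1. This mean-zero property is the source
of every gain of a power of ε. -/
theorem IsKernel.integral_pd (hκ : IsKernel κ) (i : Fin n) : ∫ z, pd i κ z = 0 := by
  have hs := hκ.smooth.of_le (m := 1) ENat.LEInfty.out
  obtain ⟨c, hc⟩ := ContDiff.lipschitzWith_of_hasCompactSupport hκ.hasCompactSupport hs (by simp)
  -- The direction is negated because the integration-by-parts formula negates it once more.
  have h := LipschitzWith.integral_lineDeriv_mul_eq (μ := volume)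
    (LipschitzWith.const (1 : ℝ)) hc hκ.hasCompactSupport (-EuclideanSpace.single i (1 : ℝ))
  have h0 : ∀ x v : Model n, lineDeriv ℝ (fun _ : Model n => (1 : ℝ)) x v = 0 := by
    intro x v; simp [lineDeriv]
  have hd : ∀ x, lineDeriv ℝ κ x (EuclideanSpace.single i (1 : ℝ)) = pd i κ x := fun x =>
    (hs.differentiable (by simp) x).lineDeriv_eq_fderiv
  simp only [h0, neg_neg, hd, zero_mul, mul_one, integral_zero] at h
  exact h.symm

variable {ι : Type*} {l : Filter ι} {e : ι → ℝ} {yf : ι → Model n} {y₁ : Model n}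

/-- Once ε is small and the centre is near y₁, the mollifier sees only a prescribed neighbourhood of
y₁. Local Lipschitz and boundedness assumptions therefore suffice in all estimates below. -/
theorem eventually_ball_subset (he : Tendsto e l (𝓝[>] 0)) (hy : Tendsto yf l (𝓝 y₁))
    {s : Set (Model n)} (hs : s ∈ 𝓝 y₁) :
    ∀ᶠ p in l, 0 < e p ∧ yf p ∈ s ∧ Metric.closedBall (yf p) (e p) ⊆ s := by
  obtain ⟨r, hr, hrs⟩ := Metric.mem_nhds_iff.1 hs
  have h1 : ∀ᶠ p in l, e p ∈ Ioo 0 (r / 2) := he (Ioo_mem_nhdsGT (half_pos hr))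
  have h2 : ∀ᶠ p in l, yf p ∈ Metric.ball y₁ (r / 2) := hy (Metric.ball_mem_nhds _ (half_pos hr))
  filter_upwards [h1, h2] with p hp hp'
  refine ⟨hp.1, hrs (Metric.ball_subset_ball (by linarith) hp'), fun z hz => hrs ?_⟩
  rw [Metric.mem_ball] at *
  rw [Metric.mem_closedBall] at hz
  have := dist_triangle z (yf p) y₁
  linarith [hp.2]

/-- Rescaling preserves the integral of κ, so the difference is an integral of f(z) - f(y) over the
ε-ball, where the Lipschitz bound gives cε. The integral of κ is kept general so that derivatives of
kernels are covered as well. -/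
theorem IsKernel.moll_sub_isBigO (hκ : IsKernel κ) (he : Tendsto e l (𝓝[>] 0))
    (hy : Tendsto yf l (𝓝 y₁)) (hf : Continuous f) {c : NNReal} {s : Set (Model n)}
    (hs : s ∈ 𝓝 y₁) (hfs : LipschitzOnWith c f s) :
    (fun p => moll κ (e p) f (yf p) - f (yf p) * ∫ z, κ z) =O[l] e := by
  refine Asymptotics.IsBigO.of_bound (c * ∫ z, |κ z|) ?_
  filter_upwards [eventually_ball_subset he hy hs] with p ⟨hp, hp', hps⟩
  rw [← integral_scaled κ hp (yf p), ← integral_const_mul, moll,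
    ← integral_sub (hκ.integrable_mul_scaled_of_continuous hp hf _)
      ((hκ.integrable_scaled_sub hp _).const_mul _)]
  simp only [← sub_mul]
  rw [Real.norm_eq_abs, Real.norm_of_nonneg hp.le]
  refine (hκ.abs_integral_le (b := c * e p) hp fun z hz => ?_).trans (le_of_eq (by ring))
  have := hfs.dist_le_mul z (hps (Metric.ball_subset_closedBall hz)) (yf p) hp'
  rw [Real.dist_eq] at this
  exact this.trans (mul_le_mul_of_nonneg_left (Metric.mem_ball.1 hz).le c.2)

/-- The main term disappears because ∂κ has integral zero. The power of ε gained here offsets the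
1/ε created by one differentiation of the mollification. -/
theorem IsKernel.moll_pd_isBigO (hκ : IsKernel κ) (he : Tendsto e l (𝓝[>] 0))
    (hy : Tendsto yf l (𝓝 y₁)) (hf : Continuous f) {c : NNReal} {s : Set (Model n)}
    (hs : s ∈ 𝓝 y₁) (hfs : LipschitzOnWith c f s) (i : Fin n) :
    (fun p => moll (pd i κ) (e p) f (yf p)) =O[l] e := by
  simpa [hκ.integral_pd i] using (hκ.partialDeriv i).moll_sub_isBigO he hy hf hs hfs

theorem IsKernel.bddAlong_inv_mul_moll (hκ : IsKernel κ) (he : Tendsto e l (𝓝[>] 0))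
    (hy : Tendsto yf l (𝓝 y₁)) (hf : Continuous f) {c : NNReal} {s : Set (Model n)}
    (hs : s ∈ 𝓝 y₁) (hfs : LipschitzOnWith c f s) (i : Fin n) :
    BddAlong l fun p => (e p)⁻¹ * moll (pd i κ) (e p) f (yf p) := by
  have hpos : ∀ᶠ p in l, 0 < e p := he self_mem_nhdsWithin
  refine (BddAlong.mul_of_isBigO hpos (hκ.moll_pd_isBigO he hy hf hs hfs i)
    (Asymptotics.isBigO_refl _ _)).congr ?_
  filter_upwards with p using mul_comm _ _

theorem IsKernel.bddAlong_pd_moll (hκ : IsKernel κ) (he : Tendsto e l (𝓝[>] 0))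
    (hy : Tendsto yf l (𝓝 y₁)) (hf : Continuous f) {c : NNReal} {s : Set (Model n)}
    (hs : s ∈ 𝓝 y₁) (hfs : LipschitzOnWith c f s) (i : Fin n) :
    BddAlong l fun p => pd i (moll κ (e p) f) (yf p) := by
  have hpos : ∀ᶠ p in l, 0 < e p := he self_mem_nhdsWithin
  refine (hκ.bddAlong_inv_mul_moll he hy hf hs hfs i).congr ?_
  filter_upwards [hpos] with p hp
  rw [hκ.pd_moll hp hf]

theorem IsKernel.pd_pd_moll (hκ : IsKernel κ) (hε : 0 < ε) (hf : Continuous f) (i j : Fin n) :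
    pd i (pd j (moll κ ε f)) = fun y =>
      ε⁻¹ * (ε⁻¹ * moll (pd i (pd j κ)) ε f y) := by
  ext y
  rw [hκ.pd_moll hε hf, pd_const_mul _ (((hκ.partialDeriv j).contDiff_moll hε hf).differentiable
    (by simp) _), (hκ.partialDeriv j).pd_moll hε hf]

/-- Two derivatives cost ε⁻²; the mean-zero gain returns one power. -/
theorem IsKernel.pd_pd_moll_isBigO (hκ : IsKernel κ) (he : Tendsto e l (𝓝[>] 0))
    (hy : Tendsto yf l (𝓝 y₁)) (hf : Continuous f) {c : NNReal} {s : Set (Model n)}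
    (hs : s ∈ 𝓝 y₁) (hfs : LipschitzOnWith c f s) (i j : Fin n) :
    (fun p => pd i (pd j (moll κ (e p) f)) (yf p))
      =O[l] fun p => (e p)⁻¹ := by
  have hpos : ∀ᶠ p in l, 0 < e p := he self_mem_nhdsWithin
  have h := (Asymptotics.isBigO_refl (fun p => (e p)⁻¹) l).mul
    ((hκ.partialDeriv j).bddAlong_inv_mul_moll he hy hf hs hfs i)
  refine h.congr' ?_ (by simp)
  filter_upwards [hpos] with p hp
  rw [hκ.pd_pd_moll hp hf]

theorem IsKernel.moll_sub_isBigO_of_integral (hκ : IsKernel κ) (h1 : ∫ z, κ z = 1)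
    (he : Tendsto e l (𝓝[>] 0))
    (hy : Tendsto yf l (𝓝 y₁)) (hf : Continuous f) {c : NNReal} {s : Set (Model n)}
    (hs : s ∈ 𝓝 y₁) (hfs : LipschitzOnWith c f s) :
    (fun p => moll κ (e p) f (yf p) - f (yf p)) =O[l] e := by
  simpa [h1] using hκ.moll_sub_isBigO he hy hf hs hfs

end Mollify

/-! ### The mollified distributional Ricci tensor of a Lipschitz metric -/

section LipschitzAt

variable {n : ℕ} {f f' : Model n → ℝ} {y : Model n}

/-- `f` is Lipschitz on some neighbourhood of `y`. -/
def LipAt (f : Model n → ℝ) (y : Model n) : Prop :=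
  ∃ c : NNReal, ∃ s ∈ 𝓝 y, LipschitzOnWith c f s

theorem LipAt.of_bound {c : ℝ} {s : Set (Model n)} (hs : s ∈ 𝓝 y)
    (h : ∀ z ∈ s, ∀ z' ∈ s, |f z - f z'| ≤ c * dist z z') : LipAt f y :=
  ⟨c.toNNReal, s, hs, LipschitzOnWith.of_dist_le_mul fun z hz z' hz' =>
    (h z hz z' hz').trans (mul_le_mul_of_nonneg_right (Real.le_coe_toNNReal c) dist_nonneg)⟩

theorem LipAt.exists_bound (h : LipAt f y) : ∃ c : ℝ, 0 ≤ c ∧ ∃ s ∈ 𝓝 y, ∀ z ∈ s, ∀ z' ∈ s,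
    |f z - f z'| ≤ c * dist z z' := by
  obtain ⟨c, s, hs, hf⟩ := h
  exact ⟨c, c.2, s, hs, fun z hz z' hz' => hf.dist_le_mul z hz z' hz'⟩

theorem LipAt.continuousAt (h : LipAt f y) : ContinuousAt f y := by
  obtain ⟨c, s, hs, hf⟩ := h
  exact hf.continuousOn.continuousAt hs

theorem _root_.ContDiffAt.lipAt (h : ContDiffAt ℝ ∞ f y) : LipAt f y := by
  obtain ⟨c, s, hs, hf⟩ := (h.of_le (m := 1) ENat.LEInfty.out).exists_lipschitzOnWith
  exact ⟨c, s, hs, hf⟩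

theorem _root_.LipschitzWith.lipAt {c : NNReal} (h : LipschitzWith c f) : LipAt f y :=
  ⟨c, univ, univ_mem, h.lipschitzOnWith⟩

theorem LipAt.congr (h : LipAt f y) (hf : f =ᶠ[𝓝 y] f') : LipAt f' y := by
  obtain ⟨c, s, hs, hfs⟩ := h
  exact ⟨c, _, inter_mem hs hf, fun z hz z' hz' => by
    rw [← show f z = f' z from hz.2, ← show f z' = f' z' from hz'.2]
    exact hfs hz.1 hz'.1⟩

theorem LipAt.bddAlong (h : LipAt f y) : BddAlong (𝓝 y) f :=
  bddAlong_of_tendsto h.continuousAt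

theorem LipAt.mul (h : LipAt f y) (h' : LipAt f' y) : LipAt (fun z => f z * f' z) y := by
  obtain ⟨b, hb⟩ := bddAlong_iff.1 h.bddAlong
  obtain ⟨b', hb'⟩ := bddAlong_iff.1 h'.bddAlong
  obtain ⟨c, hc, s, hs, hf⟩ := h.exists_bound
  obtain ⟨c', hc', s', hs', hf'⟩ := h'.exists_bound
  refine LipAt.of_bound (c := b * c' + b' * c) (inter_mem (inter_mem hs hs') (inter_mem hb hb'))
    fun z hz z' hz' => ?_
  have e : f z * f' z - f z' * f' z' = f z * (f' z - f' z') + f' z' * (f z - f z') := by ring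
  rw [e]
  refine (abs_add_le _ _).trans ?_
  rw [abs_mul, abs_mul]
  have h1 := mul_le_mul hz.2.1 (hf' z hz.1.2 z' hz'.1.2) (abs_nonneg _)
    ((abs_nonneg _).trans hz.2.1)
  have h2 := mul_le_mul hz'.2.2 (hf z hz.1.1 z' hz'.1.1) (abs_nonneg _)
    ((abs_nonneg _).trans hz'.2.2)
  linarith

/-- By the resolvent identity, the variation of the inverse is that of G times two locally bounded
inverses. -/
theorem LipAt.inv_apply {G : Model n → Matrix (Fin n) (Fin n) ℝ}
    (hG : ∀ i j, LipAt (fun z => G z i j) y) (hd : (G y).det ≠ 0) (i j : Fin n) :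
    LipAt (fun z => (G z)⁻¹ i j) y := by
  have ht : ∀ i j, Tendsto (fun z => G z i j) (𝓝 y) (𝓝 (G y i j)) := fun i j =>
    (hG i j).continuousAt
  have hb : ∀ i j, ∃ b, ∀ᶠ z in 𝓝 y, |(G z)⁻¹ i j| ≤ b := fun i j =>
    bddAlong_iff.1 (bddAlong_of_tendsto (tendsto_inv_apply ht hd i j))
  choose b hb using hb
  choose c hc s hs hf using fun i j => (hG i j).exists_bound
  have hev : ∀ᶠ z in 𝓝 y, (G z).det ≠ 0 ∧ (∀ i j, |(G z)⁻¹ i j| ≤ b i j) ∧ ∀ i j, z ∈ s i j :=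
    (eventually_det_ne_zero ht hd).and ((eventually_all.2 fun i => eventually_all.2 fun j =>
      hb i j).and (eventually_all.2 fun i => eventually_all.2 fun j => hs i j))
  refine LipAt.of_bound (c := ∑ k, (∑ a, b i a * c a k) * b k j) hev fun z hz z' hz' => ?_
  have hb0 : ∀ a k, 0 ≤ b a k := fun a k => (abs_nonneg _).trans (hz.2.1 a k)
  simp only [Set.mem_ofPred_eq] at hz hz'
  rw [inv_sub_inv_apply hz.1 hz'.1, Finset.sum_mul]
  refine (Finset.abs_sum_le_sum_abs _ _).trans (Finset.sum_le_sum fun k _ => ?_)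
  rw [abs_mul, mul_right_comm]
  refine mul_le_mul ?_ (hz'.2.1 k j) (abs_nonneg _) (mul_nonneg
    (Finset.sum_nonneg fun a _ => mul_nonneg (hb0 _ _) (hc _ _)) dist_nonneg)
  rw [Finset.sum_mul]
  refine (Finset.abs_sum_le_sum_abs _ _).trans (Finset.sum_le_sum fun a _ => ?_)
  rw [abs_mul, mul_assoc]
  refine mul_le_mul (hz.2.1 i a) ?_ (abs_nonneg _) (hb0 _ _)
  rw [dist_comm]
  exact hf a k z' (hz'.2.2 a k) z (hz.2.2 a k)

end LipschitzAt

/-! ### Testing the distributional Ricci tensor against a rescaled kernel in one chart. -/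

section DistributionalRicci

variable {n : ℕ} {κ : Model n → ℝ} {ι : Type*} {l : Filter ι} {e : ι → ℝ} {yf : ι → Model n}
  {y₁ : Model n}

theorem IsKernel.bddAlong_integral (hκ : IsKernel κ) (he : Tendsto e l (𝓝[>] 0))
    (hy : Tendsto yf l (𝓝 y₁)) {w : Model n → ℝ} (hw : BddAlong (𝓝 y₁) w) :
    BddAlong l fun p => ∫ z, w z * scaled κ (e p) (yf p - z) := by
  obtain ⟨b, hb⟩ := bddAlong_iff.1 hw
  refine bddAlong_iff.2 ⟨b * ∫ z, |κ z|, ?_⟩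
  filter_upwards [eventually_ball_subset he hy hb] with p ⟨hp, _, hp'⟩
  exact hκ.abs_integral_le hp fun z hz => hp' (Metric.ball_subset_closedBall hz)

theorem IsKernel.eventually_integrable (hκ : IsKernel κ) (he : Tendsto e l (𝓝[>] 0))
    (hy : Tendsto yf l (𝓝 y₁)) {w : Model n → ℝ} (hw : BddAlong (𝓝 y₁) w)
    (hm : AEStronglyMeasurable w volume) :
    ∀ᶠ p in l, Integrable fun z => w z * scaled κ (e p) (yf p - z) := by
  obtain ⟨b, hb⟩ := bddAlong_iff.1 hw
  filter_upwards [eventually_ball_subset he hy hb] with p ⟨hp, _, hp'⟩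
  exact hκ.integrable_mul_scaled hp (fun z hz => hp' (Metric.ball_subset_closedBall hz)) hm

/-- Replacing a Lipschitz factor by its value at the centre produces a bounded error when
integrated against a differentiated mollifier. -/
theorem IsKernel.bddAlong_freeze (hκ : IsKernel κ) (he : Tendsto e l (𝓝[>] 0))
    (hy : Tendsto yf l (𝓝 y₁)) {u w : Model n → ℝ} (hu : LipAt u y₁)
    (hum : AEStronglyMeasurable u volume) (hw : BddAlong (𝓝 y₁) w)
    (hm : AEStronglyMeasurable w volume) :
    BddAlong l fun p => (e p)⁻¹ * (∫ z, u z * w z * scaled κ (e p) (yf p - z))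
      - u (yf p) * ((e p)⁻¹ * ∫ z, w z * scaled κ (e p) (yf p - z)) := by
  obtain ⟨b, hb⟩ := bddAlong_iff.1 hw
  obtain ⟨c, hc, s, hs, hf⟩ := hu.exists_bound
  refine bddAlong_iff.2 ⟨(c * b) * ∫ z, |κ z|, ?_⟩
  filter_upwards [eventually_ball_subset he hy (inter_mem hs hb),
    hκ.eventually_integrable he hy hw hm,
    hκ.eventually_integrable he hy (hu.bddAlong.mul hw) (hum.mul hm)] with p ⟨hp, hp1, hp2⟩ hi hi'
  have e1 : (e p)⁻¹ * (∫ z, u z * w z * scaled κ (e p) (yf p - z))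
      - u (yf p) * ((e p)⁻¹ * ∫ z, w z * scaled κ (e p) (yf p - z))
      = (e p)⁻¹ * ∫ z, (u z - u (yf p)) * w z * scaled κ (e p) (yf p - z) := by
    rw [mul_left_comm, ← mul_sub, ← integral_const_mul, ← integral_sub hi' (hi.const_mul _)]
    congr 2; ext z; ring
  rw [e1, abs_mul, abs_of_pos (inv_pos.2 hp), inv_mul_le_iff₀ hp]
  -- On the ε-ball u differs from its central value by at most cε, and this ε cancels the prefactor
  -- 1/ε.
  refine (hκ.abs_integral_le hp (b := c * e p * b) fun z hz => ?_).trans (le_of_eq (by ring))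
  have hz' := hp2 (Metric.ball_subset_closedBall hz)
  rw [abs_mul]
  refine mul_le_mul ((hf z hz'.1 _ hp1.1).trans ?_) hz'.2 (abs_nonneg _)
    (mul_nonneg hc hp.le)
  exact mul_le_mul_of_nonneg_left (Metric.mem_ball.1 hz).le hc

theorem pd_comp_sub {f : Model n → ℝ} {y z : Model n} (hf : DifferentiableAt ℝ f (y - z))
    (i : Fin n) : pd i (fun z => f (y - z)) z = - pd i f (y - z) := by
  have h : HasFDerivAt (fun z => f (y - z)) _ z :=
    hf.hasFDerivAt.comp z ((hasFDerivAt_id z).const_sub y)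
  simp only [pd, h.fderiv]; simp

/-- By Rademacher's theorem the pointwise derivative of a Lipschitz function agrees almost
everywhere with its line derivative, and so acts as the weak derivative. -/
theorem integral_pd_mul_eq {c : NNReal} {u ψ : Model n → ℝ} (hu : LipschitzWith c u)
    (hψ : ContDiff ℝ ∞ ψ) (hc : HasCompactSupport ψ) (i : Fin n) :
    ∫ z, pd i u z * ψ z = - ∫ z, u z * pd i ψ z := by
  have hs := hψ.of_le (m := 1) ENat.LEInfty.out
  obtain ⟨d, hd⟩ := ContDiff.lipschitzWith_of_hasCompactSupport hc hs (by simp)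
  have h := LipschitzWith.integral_lineDeriv_mul_eq (μ := volume) hu hd hc
    (EuclideanSpace.single i (1 : ℝ))
  have h1 : ∫ z, pd i u z * ψ z = ∫ z, lineDeriv ℝ u z (EuclideanSpace.single i (1 : ℝ)) * ψ z := by
    refine integral_congr_ae ?_
    filter_upwards [hu.ae_differentiableAt (μ := volume)] with z hz
    rw [hz.lineDeriv_eq_fderiv]; rfl
  rw [h1, h, ← integral_neg]
  congr 1; ext z
  rw [(hs.differentiable (by simp) z).lineDeriv_eq_fderiv, map_neg]
  simp only [pd]; ring

theorem IsKernel.pd_mul_scaled (hκ : IsKernel κ) {ξ : Model n → ℝ} (hξ : ContDiff ℝ ∞ ξ)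
    (ε : ℝ) (y z : Model n) (i : Fin n) :
    pd i (fun z => ξ z * scaled κ ε (y - z)) z =
      pd i ξ z * scaled κ ε (y - z) - ξ z * (ε⁻¹ * scaled (pd i κ) ε (y - z)) := by
  have h1 : DifferentiableAt ℝ (scaled κ ε) (y - z) :=
    (hκ.contDiff_scaled ε).differentiable (by simp) _
  have h2 : DifferentiableAt ℝ (fun z => scaled κ ε (y - z)) z :=
    h1.comp z (differentiableAt_id.const_sub y)
  rw [pd_mul (hξ.differentiable (by simp) z) h2, pd_comp_sub h1, pd_scaled hκ]
  ring

/-- Moves the derivative off the merely Lipschitz u. The part falling on the kernel carries 1/ε, the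
part falling on the cut-off ξ does not; differentiating κ_ε(y - z) in z accounts for the signs. -/
theorem IsKernel.integral_pd_mul_scaled (hκ : IsKernel κ) {c : NNReal} {u ξ : Model n → ℝ}
    (hu : LipschitzWith c u) (hξ : ContDiff ℝ ∞ ξ) {ε : ℝ} (hε : 0 < ε) (y : Model n)
    (i : Fin n) :
    ∫ z, pd i u z * ξ z * scaled κ ε (y - z) =
      ε⁻¹ * moll (pd i κ) ε (fun z => ξ z * u z) y - moll κ ε (fun z => pd i ξ z * u z) y := by
  have hs : ContDiff ℝ ∞ fun z => ξ z * scaled κ ε (y - z) :=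
    hξ.mul ((hκ.contDiff_scaled ε).comp (contDiff_const.sub contDiff_id))
  have h := integral_pd_mul_eq hu hs (hκ.hasCompactSupport_scaled_sub hε y).mul_left i
  simp only [← mul_assoc] at h
  have hu' := hu.continuous
  rw [h, moll, moll, ← integral_const_mul, ← integral_sub, ← integral_neg]
  · congr 1; ext z
    rw [hκ.pd_mul_scaled hξ]; ring
  · exact ((hκ.partialDeriv i).integrable_mul_scaled_of_continuous hε
      (hξ.continuous.mul hu') y).const_mul _
  · exact hκ.integrable_mul_scaled_of_continuous hε ((contDiff_pd hξ i).continuous.mul hu') y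

variable {c : NNReal} {G : Model n → Matrix (Fin n) (Fin n) ℝ} {ξ : Model n → ℝ}

theorem measurable_inv_apply (hG : ∀ i j, LipschitzWith c fun z => G z i j) (i j : Fin n) :
    Measurable fun z => (G z)⁻¹ i j := by
  have hc : Continuous G := continuous_pi fun i => continuous_pi fun j => (hG i j).continuous
  simp only [inv_apply_eq]
  exact hc.matrix_det.measurable.inv.mul (hc.matrix_adjugate.matrix_elem i j).measurable

theorem measurable_christoffel (hG : ∀ i j, LipschitzWith c fun z => G z i j) (m i j : Fin n) :
    Measurable (christoffel G m i j) := by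
  unfold christoffel
  refine Measurable.const_mul (Finset.measurable_fun_sum _ fun l _ => ?_) _
  exact (measurable_inv_apply hG m l).mul
    (((measurable_pd _ _).add (measurable_pd _ _)).sub (measurable_pd _ _))

theorem measurable_ricciQuad (hG : ∀ i j, LipschitzWith c fun z => G z i j) (i j : Fin n) :
    Measurable (ricciQuad G i j) := by
  unfold ricciQuad
  have := measurable_christoffel hG
  exact Finset.measurable_fun_sum _ fun m _ => Finset.measurable_fun_sum _ fun k _ =>
    ((this _ _ _).mul (this _ _ _)).sub ((this _ _ _).mul (this _ _ _))

theorem bddAlong_pd_of_lipschitz {u : Model n → ℝ} (hu : LipschitzWith c u) (i : Fin n) :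
    BddAlong (𝓝 y₁) (pd i u) :=
  bddAlong_iff.2 ⟨c, Eventually.of_forall fun _ => abs_pd_le univ_mem hu.lipschitzOnWith⟩

/-- A single term of a mollified derivative of a Christoffel symbol. -/
theorem bddAlong_term (hκ : IsKernel κ) (he : Tendsto e l (𝓝[>] 0))
    (hy : Tendsto yf l (𝓝 y₁)) (hG : ∀ i j, LipschitzWith c fun z => G z i j)
    (hd : (G y₁).det ≠ 0) (hξ : ContDiff ℝ ∞ ξ) (k m a q r s : Fin n) :
    BddAlong l fun p => (e p)⁻¹ * (∫ z, (G z)⁻¹ m a * (pd q (fun z => G z r s) z * ξ z)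
        * scaled (pd k κ) (e p) (yf p - z))
      - (G (yf p))⁻¹ m a * pd k (pd q (moll κ (e p) fun z => ξ z * G z r s)) (yf p) := by
  have hpos : ∀ᶠ p in l, 0 < e p := he self_mem_nhdsWithin
  have hI : LipAt (fun z => (G z)⁻¹ m a) y₁ := LipAt.inv_apply (fun i j => (hG i j).lipAt) hd m a
  have hw : BddAlong (𝓝 y₁) fun z => pd q (fun z => G z r s) z * ξ z :=
    (bddAlong_pd_of_lipschitz (hG r s) q).mul (bddAlong_of_tendsto hξ.continuous.continuousAt)
  -- Freeze the inverse metric at the centre. The other factor is a first derivative of the metric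
  -- and is only bounded.
  have h1 := (hκ.partialDeriv k).bddAlong_freeze he hy hI
    (measurable_inv_apply hG m a).aestronglyMeasurable hw
    ((measurable_pd _ _).mul hξ.continuous.measurable).aestronglyMeasurable
  refine bddAlong_sub_trans h1 ?_
  refine bddAlong_mul_sub (bddAlong_of_tendsto (hI.continuousAt.tendsto.comp hy)) ?_
  obtain ⟨d, t, ht, hL⟩ := ((contDiff_pd hξ q).contDiffAt.lipAt (y := y₁)).mul
    ((hG r s).lipAt (y := y₁))
  have hc1 : Continuous fun z => pd q ξ z * G z r s :=
    (contDiff_pd hξ q).continuous.mul (hG r s).continuous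
  -- After integrating by parts in the frozen term, what is left is -(1/ε) moll(∂_kκ)(∂_qξ · G_rs).
  -- This is, up to sign, a first derivative of a mollified Lipschitz function, hence bounded.
  have hc2 : Continuous fun z => ξ z * G z r s := hξ.continuous.mul (hG r s).continuous
  refine (hκ.bddAlong_inv_mul_moll he hy hc1 ht hL k).neg.congr ?_
  filter_upwards [hpos] with p hp
  have hcomm : pd q (pd k κ) = pd k (pd q κ) := by
    ext z; exact pd_comm hκ.smooth.contDiffAt q k
  rw [(hκ.partialDeriv k).integral_pd_mul_scaled (hG r s) hξ hp,
    hκ.pd_pd_moll hp hc2, hcomm]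
  ring

/-- A mollified derivative of a Christoffel symbol. -/
theorem bddAlong_christoffel_term (hκ : IsKernel κ) (he : Tendsto e l (𝓝[>] 0))
    (hy : Tendsto yf l (𝓝 y₁)) (hG : ∀ i j, LipschitzWith c fun z => G z i j)
    (hd : (G y₁).det ≠ 0) (hξ : ContDiff ℝ ∞ ξ) (k m i j : Fin n) :
    BddAlong l fun p => (e p)⁻¹ * (∫ z, christoffel G m i j z * ξ z
        * scaled (pd k κ) (e p) (yf p - z))
      - (1 / 2 : ℝ) * ∑ a, (G (yf p))⁻¹ m a *
        (pd k (pd i (moll κ (e p) fun z => ξ z * G z j a)) (yf p)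
        + pd k (pd j (moll κ (e p) fun z => ξ z * G z i a)) (yf p)
        - pd k (pd a (moll κ (e p) fun z => ξ z * G z i j)) (yf p)) := by
  have hT := bddAlong_term hκ he hy hG hd hξ k m
  have hint : ∀ a q r s, ∀ᶠ p in l, Integrable fun z => (G z)⁻¹ m a *
      (pd q (fun z => G z r s) z * ξ z) * scaled (pd k κ) (e p) (yf p - z) := by
    intro a q r s
    have hI : LipAt (fun z => (G z)⁻¹ m a) y₁ :=
      LipAt.inv_apply (fun i j => (hG i j).lipAt) hd m a
    exact (hκ.partialDeriv k).eventually_integrable he hy (hI.bddAlong.mul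
      ((bddAlong_pd_of_lipschitz (hG r s) q).mul
        (bddAlong_of_tendsto hξ.continuous.continuousAt)))
      ((measurable_inv_apply hG m a).mul
        ((measurable_pd _ _).mul hξ.continuous.measurable)).aestronglyMeasurable
  refine ((bddAlong_const (1 / 2 : ℝ)).mul (BddAlong.sum (s := Finset.univ) fun a _ =>
    ((hT a i j a).add (hT a j i a)).sub (hT a a i j))).congr ?_
  filter_upwards [eventually_all.2 fun a => hint a i j a, eventually_all.2 fun a => hint a j i a,
    eventually_all.2 fun a => hint a a i j] with p h1 h2 h3
  have e1 : ∀ z, christoffel G m i j z * ξ z * scaled (pd k κ) (e p) (yf p - z)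
      = (1 / 2 : ℝ) * ∑ a, ((G z)⁻¹ m a * (pd i (fun z => G z j a) z * ξ z)
          * scaled (pd k κ) (e p) (yf p - z) + (G z)⁻¹ m a * (pd j (fun z => G z i a) z * ξ z)
          * scaled (pd k κ) (e p) (yf p - z) - (G z)⁻¹ m a * (pd a (fun z => G z i j) z * ξ z)
          * scaled (pd k κ) (e p) (yf p - z)) := by
    intro z
    simp only [christoffel, Finset.mul_sum, Finset.sum_mul]
    refine Finset.sum_congr rfl fun a _ => by ring
  simp only [e1]
  rw [integral_const_mul, integral_finsetSum _ fun a _ => ((h1 a).fun_add (h2 a)).sub' (h3 a)]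
  rw [Finset.sum_congr rfl fun a _ => show _ = _ from
    (integral_sub ((h1 a).fun_add (h2 a)) (h3 a)).trans
      (congrArg₂ _ (integral_add (h1 a) (h2 a)) rfl)]
  simp only [Finset.mul_sum]
  rw [← Finset.sum_sub_distrib]
  refine Finset.sum_congr rfl fun a _ => by ring

/-- In a fixed chart, up to bounded terms, testing the distributional Ricci tensor against
`ξ ρ_ε(y - ·)` amounts to computing the principal part with the second derivatives of the mollified
metric. -/
theorem bddAlong_distRicci_sub_principal (hκ : IsKernel κ) (he : Tendsto e l (𝓝[>] 0))
    (hy : Tendsto yf l (𝓝 y₁)) (hG : ∀ i j, LipschitzWith c fun z => G z i j)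
    (hd : (G y₁).det ≠ 0) (hξ : ContDiff ℝ ∞ ξ) (i j : Fin n) :
    BddAlong l fun p => distRicciCoord univ G i j (fun z => ξ z * scaled κ (e p) (yf p - z))
      - principal (G (yf p))⁻¹ (fun a b r s =>
          pd a (pd b (moll κ (e p) fun z => ξ z * G z r s)) (yf p)) i j := by
  have hC := bddAlong_christoffel_term hκ he hy hG hd hξ
  have hinv : ∀ a b, BddAlong (𝓝 y₁) fun z => (G z)⁻¹ a b := fun a b =>
    (LipAt.inv_apply (fun i j => (hG i j).lipAt) hd a b).bddAlong
  have hΓ : ∀ m a b, BddAlong (𝓝 y₁) (christoffel G m a b) := fun m a b =>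
    bddAlong_christoffel (Gf := fun _ => G) (yf := id) hinv
      (fun k a b => bddAlong_pd_of_lipschitz (hG a b) k) m a b
  have hQ : BddAlong (𝓝 y₁) (ricciQuad G i j) :=
    bddAlong_ricciQuad (Gf := fun _ => G) (yf := id) hinv
      (fun k a b => bddAlong_pd_of_lipschitz (hG a b) k) i j
  have hξb : BddAlong (𝓝 y₁) ξ := bddAlong_of_tendsto hξ.continuous.continuousAt
  have hξ' : ∀ m, BddAlong (𝓝 y₁) (pd m ξ) := fun m =>
    bddAlong_of_tendsto (contDiff_pd hξ m).continuous.continuousAt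
  have hΓm := measurable_christoffel hG
  have hξm : Measurable ξ := hξ.continuous.measurable
  -- The terms in which no derivative falls on the kernel have a bounded density w. In the others
  -- the minus sign of the distributional derivative cancels against the one from κ_ε(y - z).
  set w : Model n → ℝ := fun z => -(∑ m, christoffel G m i j z * pd m ξ z)
    + (∑ m, christoffel G m i m z * pd j ξ z) + ricciQuad G i j z * ξ z with hw_def
  have hw : BddAlong (𝓝 y₁) w :=
    ((BddAlong.sum fun m _ => (hΓ m i j).mul (hξ' m)).neg.add
      (BddAlong.sum fun m _ => (hΓ m i m).mul (hξ' j))).add (hQ.mul hξb)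
  have hwm : Measurable w :=
    ((Finset.measurable_fun_sum _ fun m _ => (hΓm m i j).mul (measurable_pd ξ m)).neg.add
      (Finset.measurable_fun_sum _ fun m _ => (hΓm m i m).mul (measurable_pd ξ j))).add
      ((measurable_ricciQuad hG i j).mul hξm)
  have hint : ∀ k m a b, ∀ᶠ p in l, Integrable fun z =>
      christoffel G m a b z * ξ z * scaled (pd k κ) (e p) (yf p - z) := fun k m a b =>
    (hκ.partialDeriv k).eventually_integrable he hy ((hΓ m a b).mul hξb)
      ((hΓm m a b).mul hξm).aestronglyMeasurable
  have h0 := hκ.bddAlong_integral he hy hw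
  have h0i := hκ.eventually_integrable he hy hw hwm.aestronglyMeasurable
  refine (((BddAlong.sum (s := Finset.univ) fun m _ => hC m m i j).sub
    (BddAlong.sum (s := Finset.univ) fun m _ => hC j m i m)).add h0).congr ?_
  filter_upwards [h0i, eventually_all.2 fun m => hint m m i j,
    eventually_all.2 fun m => hint j m i m] with p hi1 hi2 hi3
  have e1 : distRicciCoord univ G i j (fun z => ξ z * scaled κ (e p) (yf p - z)) =
      (∑ m, (e p)⁻¹ * (∫ z, christoffel G m i j z * ξ z * scaled (pd m κ) (e p) (yf p - z)))
      - (∑ m, (e p)⁻¹ * (∫ z, christoffel G m i m z * ξ z * scaled (pd j κ) (e p) (yf p - z)))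
      + ∫ z, w z * scaled κ (e p) (yf p - z) := by
    simp only [← integral_const_mul]
    rw [← integral_finsetSum _ fun m _ => (hi2 m).const_mul _,
      ← integral_finsetSum _ fun m _ => (hi3 m).const_mul _,
      ← integral_sub (integrable_finsetSum _ fun m _ => (hi2 m).const_mul _)
        (integrable_finsetSum _ fun m _ => (hi3 m).const_mul _),
      ← integral_add ((integrable_finsetSum _ fun m _ => (hi2 m).const_mul _).sub'
        (integrable_finsetSum _ fun m _ => (hi3 m).const_mul _)) hi1]
    rw [distRicciCoord, setIntegral_univ]
    congr 1; ext z
    simp only [hκ.pd_mul_scaled hξ, hw_def, mul_sub, Finset.sum_sub_distrib, add_mul, neg_mul,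
      Finset.sum_mul]
    have s1 : ∑ m, christoffel G m i j z * (pd m ξ z * scaled κ (e p) (yf p - z))
        = ∑ m, christoffel G m i j z * pd m ξ z * scaled κ (e p) (yf p - z) :=
      Finset.sum_congr rfl fun m _ => by ring
    have s2 : ∑ m, christoffel G m i m z * (pd j ξ z * scaled κ (e p) (yf p - z))
        = ∑ m, christoffel G m i m z * pd j ξ z * scaled κ (e p) (yf p - z) :=
      Finset.sum_congr rfl fun m _ => by ring
    have s3 : ∑ m, christoffel G m i j z * (ξ z * ((e p)⁻¹ * scaled (pd m κ) (e p) (yf p - z)))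
        = ∑ m, (e p)⁻¹ * (christoffel G m i j z * ξ z * scaled (pd m κ) (e p) (yf p - z)) :=
      Finset.sum_congr rfl fun m _ => by ring
    have s4 : ∑ m, christoffel G m i m z * (ξ z * ((e p)⁻¹ * scaled (pd j κ) (e p) (yf p - z)))
        = ∑ m, (e p)⁻¹ * (christoffel G m i m z * ξ z * scaled (pd j κ) (e p) (yf p - z)) :=
      Finset.sum_congr rfl fun m _ => by ring
    rw [s1, s2, s3, s4]; ring
  rw [e1]
  simp only [principal, Finset.sum_sub_distrib]
  ring

end DistributionalRicci

/-! ### The Ricci tensor under a change of coordinates -/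

section ChangeOfCoordinates

variable {n : ℕ}

/-- The bilinear form on `ℝⁿ` with matrix `G`. -/
def bilin (G : Matrix (Fin n) (Fin n) ℝ) : Model n →L[ℝ] Model n →L[ℝ] ℝ :=
  ∑ a, ∑ b, G a b • (EuclideanSpace.proj a : Model n →L[ℝ] ℝ).smulRight
    (EuclideanSpace.proj b : Model n →L[ℝ] ℝ)

theorem bilin_apply (G : Matrix (Fin n) (Fin n) ℝ) (u v : Model n) :
    bilin G u v = ∑ a, ∑ b, G a b * u a * v b := by
  simp [bilin, mul_assoc]

/-- The Christoffel symbols as a bilinear map. -/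
def chr (G : Model n → Matrix (Fin n) (Fin n) ℝ) (y : Model n) :
    Model n →L[ℝ] Model n →L[ℝ] Model n :=
  ∑ m, ∑ i, ∑ j, christoffel G m i j y • (EuclideanSpace.proj i : Model n →L[ℝ] ℝ).smulRight
    ((EuclideanSpace.proj j : Model n →L[ℝ] ℝ).smulRight
      (EuclideanSpace.single m (1 : ℝ) : Model n))

theorem chr_apply (G : Model n → Matrix (Fin n) (Fin n) ℝ) (y u v : Model n) (k : Fin n) :
    chr G y u v k = ∑ i, ∑ j, christoffel G k i j y * u i * v j := by
  simp [chr, Pi.single_apply, mul_assoc]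

variable {G : Model n → Matrix (Fin n) (Fin n) ℝ} {y : Model n}

theorem differentiableAt_sum_smul {κ W : Type*} [NormedAddCommGroup W] [NormedSpace ℝ W]
    {s : Finset κ} {c : κ → Model n → ℝ} (L : κ → W)
    (h : ∀ a ∈ s, DifferentiableAt ℝ (c a) y) :
    DifferentiableAt ℝ (fun z => ∑ a ∈ s, c a z • L a) y :=
  DifferentiableAt.fun_sum fun a ha => (h a ha).smul_const _

theorem differentiableAt_bilin (hG : ∀ i j, ContDiffAt ℝ ∞ (fun z => G z i j) y) :
    DifferentiableAt ℝ (fun z => bilin (G z)) y := by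
  simp only [bilin]
  exact DifferentiableAt.fun_sum (F := Model n →L[ℝ] Model n →L[ℝ] ℝ) fun a _ =>
    differentiableAt_sum_smul (W := Model n →L[ℝ] Model n →L[ℝ] ℝ) _ fun b _ =>
      differentiableAt_of_smooth (hG a b)

theorem fderiv_bilin_apply (hG : ∀ i j, ContDiffAt ℝ ∞ (fun z => G z i j) y) (w u v : Model n) :
    fderiv ℝ (fun z => bilin (G z)) y w u v =
      ∑ a, ∑ b, (∑ c, w c * pd c (fun z => G z a b) y) * u a * v b := by
  have h : HasFDerivAt (fun z => bilin (G z) u v) _ y :=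
    ((differentiableAt_bilin hG).hasFDerivAt.clm_apply (hasFDerivAt_const u y)).clm_apply
      (hasFDerivAt_const v y)
  have h1 := congrArg (fun L => L w) h.fderiv
  simp only [bilin_apply] at h1
  have hd : ∀ a b, DifferentiableAt ℝ (fun z => G z a b * u a * v b) y := fun a b =>
    ((differentiableAt_of_smooth (hG a b)).mul_const _).mul_const _
  rw [fderiv_fun_sum fun a _ => DifferentiableAt.fun_sum fun b _ => hd a b] at h1
  simp only [_root_.sum_apply] at h1
  simp only [_root_.add_apply, ContinuousLinearMap.comp_apply,
    _root_.zero_apply, map_zero, zero_add, ContinuousLinearMap.flip_apply] at h1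
  rw [← h1]
  refine Finset.sum_congr rfl fun a _ => ?_
  rw [fderiv_fun_sum fun b _ => hd a b, _root_.sum_apply]
  refine Finset.sum_congr rfl fun b _ => ?_
  have hg := differentiableAt_of_smooth (hG a b)
  rw [fderiv_mul_const (hg.mul_const _), fderiv_mul_const hg, ← fderiv_apply_eq_sum_pd]
  simp; ring

theorem differentiableAt_chr (hG : ∀ i j, ContDiffAt ℝ ∞ (fun z => G z i j) y)
    (hd : (G y).det ≠ 0) : DifferentiableAt ℝ (chr G) y := by
  have : chr G = fun y => ∑ m, ∑ i, ∑ j, christoffel G m i j y •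
    (EuclideanSpace.proj i : Model n →L[ℝ] ℝ).smulRight
    ((EuclideanSpace.proj j : Model n →L[ℝ] ℝ).smulRight
      (EuclideanSpace.single m (1 : ℝ) : Model n)) := rfl
  rw [this]
  exact DifferentiableAt.fun_sum (F := Model n →L[ℝ] Model n →L[ℝ] Model n) fun a _ =>
    DifferentiableAt.fun_sum (F := Model n →L[ℝ] Model n →L[ℝ] Model n) fun b _ =>
    differentiableAt_sum_smul (W := Model n →L[ℝ] Model n →L[ℝ] Model n) _ fun c _ =>
    differentiableAt_of_smooth (contDiffAt_christoffel hG hd a b c)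

theorem fderiv_chr_apply (hG : ∀ i j, ContDiffAt ℝ ∞ (fun z => G z i j) y)
    (hd : (G y).det ≠ 0) (w u v : Model n) (k : Fin n) :
    fderiv ℝ (chr G) y w u v k =
      ∑ a, ∑ b, (∑ c, w c * pd c (christoffel G k a b) y) * u a * v b := by
  have h0 : HasFDerivAt (fun z => chr G z u v) _ y :=
    ((differentiableAt_chr hG hd).hasFDerivAt.clm_apply (hasFDerivAt_const u y)).clm_apply
      (hasFDerivAt_const v y)
  have h : HasFDerivAt (fun z => chr G z u v k) _ y :=
    (EuclideanSpace.proj k : Model n →L[ℝ] ℝ).hasFDerivAt.comp y h0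
  have h1 := congrArg (fun L => L w) h.fderiv
  simp only [chr_apply] at h1
  have hΓ : ∀ a b, DifferentiableAt ℝ (christoffel G k a b) y := fun a b =>
    differentiableAt_of_smooth (contDiffAt_christoffel hG hd k a b)
  have hd : ∀ a b, DifferentiableAt ℝ (fun z => christoffel G k a b z * u a * v b) y := fun a b =>
    ((hΓ a b).mul_const _).mul_const _
  rw [fderiv_fun_sum fun a _ => DifferentiableAt.fun_sum fun b _ => hd a b] at h1
  simp only [_root_.sum_apply] at h1
  simp only [_root_.add_apply, ContinuousLinearMap.comp_apply,
    _root_.zero_apply, map_zero, zero_add, ContinuousLinearMap.flip_apply] at h1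
  refine h1.symm.trans ?_
  refine Finset.sum_congr rfl fun a _ => ?_
  rw [fderiv_fun_sum fun b _ => hd a b, _root_.sum_apply]
  refine Finset.sum_congr rfl fun b _ => ?_
  rw [fderiv_mul_const ((hΓ a b).mul_const _), fderiv_mul_const (hΓ a b), ← fderiv_apply_eq_sum_pd]
  simp; ring

/-- Lowering the index of the Christoffel symbols gives the Koszul expression. -/
theorem bilin_chr (hG : ∀ i j, ContDiffAt ℝ ∞ (fun z => G z i j) y) (hd : (G y).det ≠ 0)
    (u v w : Model n) : bilin (G y) w (chr G y u v) = (1 / 2 : ℝ) *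
      (fderiv ℝ (fun z => bilin (G z)) y u v w + fderiv ℝ (fun z => bilin (G z)) y v u w
      - fderiv ℝ (fun z => bilin (G z)) y w u v) := by
  have e2 : ∀ a b, ∑ m, G y a m * (G y)⁻¹ m b = (1 : Matrix (Fin n) (Fin n) ℝ) a b := by
    intro a b
    rw [← Matrix.mul_apply, Matrix.mul_nonsing_inv _ (isUnit_iff_ne_zero.2 hd)]
  have e3 : ∀ a i j, ∑ m, G y a m * christoffel G m i j y = (1 / 2 : ℝ) * koszul G i j a y := by
    intro a i j
    simp only [christoffel_eq, mul_left_comm _ (1 / 2 : ℝ), ← Finset.mul_sum]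
    congr 1
    simp only [Finset.mul_sum, ← mul_assoc]
    rw [Finset.sum_comm]
    simp [← Finset.sum_mul, e2, Matrix.one_apply]
  have lhs : bilin (G y) w (chr G y u v)
      = ∑ a, ∑ i, ∑ j, (1 / 2 : ℝ) * koszul G i j a y * w a * u i * v j := by
    rw [bilin_apply]
    refine Finset.sum_congr rfl fun a _ => ?_
    simp only [chr_apply, ← e3, Finset.mul_sum, Finset.sum_mul]
    rw [Finset.sum_comm]
    refine Finset.sum_congr rfl fun i _ => ?_
    rw [Finset.sum_comm]
    refine Finset.sum_congr rfl fun j _ => Finset.sum_congr rfl fun m _ => by ring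
  have r1 : fderiv ℝ (fun z => bilin (G z)) y u v w =
      ∑ a, ∑ i, ∑ j, pd i (fun z => G z j a) y * w a * u i * v j := by
    rw [fderiv_bilin_apply hG]
    simp only [Finset.sum_mul]
    rw [Finset.sum_comm]
    refine Finset.sum_congr rfl fun a _ => ?_
    rw [Finset.sum_comm]
    refine Finset.sum_congr rfl fun i _ => Finset.sum_congr rfl fun j _ => by ring
  have r2 : fderiv ℝ (fun z => bilin (G z)) y v u w =
      ∑ a, ∑ i, ∑ j, pd j (fun z => G z i a) y * w a * u i * v j := by
    rw [fderiv_bilin_apply hG]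
    simp only [Finset.sum_mul]
    rw [Finset.sum_comm]
    refine Finset.sum_congr rfl fun a _ => Finset.sum_congr rfl fun i _ =>
      Finset.sum_congr rfl fun j _ => by ring
  have r3 : fderiv ℝ (fun z => bilin (G z)) y w u v =
      ∑ a, ∑ i, ∑ j, pd a (fun z => G z i j) y * w a * u i * v j := by
    rw [fderiv_bilin_apply hG]
    simp only [Finset.sum_mul]
    rw [Finset.sum_congr rfl fun i _ => Finset.sum_comm, Finset.sum_comm]
    refine Finset.sum_congr rfl fun a _ => Finset.sum_congr rfl fun i _ =>
      Finset.sum_congr rfl fun j _ => by ring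
  rw [lhs, r1, r2, r3]
  simp only [← Finset.sum_add_distrib, ← Finset.sum_sub_distrib, Finset.mul_sum]
  refine Finset.sum_congr rfl fun a _ => Finset.sum_congr rfl fun i _ =>
      Finset.sum_congr rfl fun j _ => by rw [koszul]; ring

/-- Symmetry of G is required on a neighbourhood, since the Christoffel symbols involve its
derivatives. -/
theorem chr_symm (hsymm : ∀ᶠ z in 𝓝 y, ∀ i j, G z i j = G z j i) (u v : Model n) :
    chr G y u v = chr G y v u := by
  have hK : ∀ i j l, koszul G i j l y = koszul G j i l y := by
    intro i j l
    have : (fun z => G z i j) =ᶠ[𝓝 y] fun z => G z j i := hsymm.mono fun z hz => hz i j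
    simp only [koszul, pd_congr this]; ring
  ext k
  rw [chr_apply, chr_apply, Finset.sum_comm]
  refine Finset.sum_congr rfl fun i _ => Finset.sum_congr rfl fun j _ => ?_
  rw [christoffel_eq, christoffel_eq]
  simp only [hK j i]; ring

theorem bilin_nondegenerate {G : Matrix (Fin n) (Fin n) ℝ} (hd : G.det ≠ 0) {v : Model n}
    (h : ∀ w, bilin G w v = 0) : v = 0 := by
  have h1 : G.mulVec (fun i => v i) = 0 := by
    ext a
    have := h (EuclideanSpace.single a 1)
    rw [bilin_apply] at this
    simpa [Pi.single_apply, Matrix.mulVec, dotProduct] using this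
  have h2 := Matrix.eq_zero_of_mulVec_eq_zero hd h1
  ext i
  exact congrFun h2 i

/-- The endomorphism `w ↦ R(w, u) u` of the curvature. -/
def curvEnd (G : Model n → Matrix (Fin n) (Fin n) ℝ) (y u : Model n) : Model n →ₗ[ℝ] Model n where
  toFun w := fderiv ℝ (chr G) y w u u - fderiv ℝ (chr G) y u u w
    + chr G y w (chr G y u u) - chr G y u (chr G y u w)
  map_add' w w' := by simp; abel
  map_smul' c w := by simp [smul_sub, smul_add]

theorem curvEnd_apply (G : Model n → Matrix (Fin n) (Fin n) ℝ) (y u w : Model n) :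
    curvEnd G y u w = fderiv ℝ (chr G) y w u u - fderiv ℝ (chr G) y u u w
    + chr G y w (chr G y u u) - chr G y u (chr G y u w) := rfl

/-- Ricci is the contraction of curvature, and as a trace it is invariant under conjugation. The
argument slots in `curvEnd` follow the index order of `ricciCoord` exactly, so no symmetry of the
Christoffel symbols enters. -/
theorem sum_ricciCoord_eq_trace (hG : ∀ i j, ContDiffAt ℝ ∞ (fun z => G z i j) y)
    (hd : (G y).det ≠ 0) (u : Model n) :
    ∑ i, ∑ j, ricciCoord G i j y * u i * u j = LinearMap.trace ℝ _ (curvEnd G y u) := by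
  rw [LinearMap.trace_eq_sum_inner _ (EuclideanSpace.basisFun (Fin n) ℝ)]
  have h1 : ∀ m, inner ℝ (EuclideanSpace.basisFun (Fin n) ℝ m)
      (curvEnd G y u (EuclideanSpace.basisFun (Fin n) ℝ m)) =
      curvEnd G y u (EuclideanSpace.single m 1) m := by
    intro m
    simp [EuclideanSpace.inner_single_left]
  have h2 : ∀ m, curvEnd G y u (EuclideanSpace.single m 1) m =
      ∑ i, ∑ j, (pd m (christoffel G m i j) y - pd j (christoffel G m i m) y
        + ∑ k, (christoffel G m m k y * christoffel G k i j y
          - christoffel G m j k y * christoffel G k i m y)) * u i * u j := by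
    intro m
    rw [curvEnd_apply]
    simp only [PiLp.sub_apply, PiLp.add_apply]
    rw [fderiv_chr_apply hG hd, fderiv_chr_apply hG hd, chr_apply, chr_apply]
    simp only [chr_apply]
    have t1 : ∑ a, ∑ b, (∑ c, (EuclideanSpace.single m (1 : ℝ) : Model n) c
        * pd c (christoffel G m a b) y) * u a * u b
        = ∑ i, ∑ j, pd m (christoffel G m i j) y * u i * u j := by
      simp
    have t2 : ∑ a, ∑ b, (∑ c, u c * pd c (christoffel G m a b) y) * u a *
        (EuclideanSpace.single m (1 : ℝ) : Model n) b
        = ∑ i, ∑ j, pd j (christoffel G m i m) y * u i * u j := by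
      simp only [PiLp.single_apply, mul_ite, mul_one, mul_zero, Finset.sum_ite_eq',
        Finset.mem_univ, if_true, Finset.sum_mul]
      exact Finset.sum_congr rfl fun i _ => Finset.sum_congr rfl fun j _ => by ring
    have t3 : ∑ a, ∑ b, christoffel G m a b y * (EuclideanSpace.single m (1 : ℝ) : Model n) a *
        (∑ i, ∑ j, christoffel G b i j y * u i * u j)
        = ∑ i, ∑ j, (∑ k, christoffel G m m k y * christoffel G k i j y) * u i * u j := by
      rw [Finset.sum_eq_single m (by intro b _ hb; simp [hb]) (by simp)]
      simp only [PiLp.single_apply, if_true, mul_one, Finset.mul_sum, Finset.sum_mul]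
      rw [Finset.sum_comm]
      refine Finset.sum_congr rfl fun i _ => ?_
      rw [Finset.sum_comm]
      exact Finset.sum_congr rfl fun j _ => Finset.sum_congr rfl fun k _ => by ring
    have t4 : ∑ a, ∑ b, christoffel G m a b y * u a *
        (∑ i, ∑ j, christoffel G b i j y * u i * (EuclideanSpace.single m (1 : ℝ) : Model n) j)
        = ∑ i, ∑ j, (∑ k, christoffel G m j k y * christoffel G k i m y) * u i * u j := by
      simp only [PiLp.single_apply, mul_ite, mul_one, mul_zero, Finset.sum_ite_eq',
        Finset.mem_univ, if_true, Finset.sum_mul, Finset.mul_sum]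
      rw [Finset.sum_congr rfl fun a _ => Finset.sum_comm, Finset.sum_comm]
      exact Finset.sum_congr rfl fun i _ => Finset.sum_congr rfl fun j _ =>
        Finset.sum_congr rfl fun k _ => by ring
    rw [t1, t2, t3, t4]
    simp only [← Finset.sum_sub_distrib, ← Finset.sum_add_distrib]
    refine Finset.sum_congr rfl fun i _ => Finset.sum_congr rfl fun j _ => ?_
    rw [Finset.sum_sub_distrib]; ring
  simp only [h1, h2]
  symm
  rw [Finset.sum_comm]
  refine Finset.sum_congr rfl fun i _ => ?_
  rw [Finset.sum_comm]
  refine Finset.sum_congr rfl fun j _ => ?_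
  rw [← Finset.sum_mul, ← Finset.sum_mul]
  simp only [ricciCoord, ricciQuad, Finset.sum_add_distrib, Finset.sum_sub_distrib]

variable {τ : Model n → Model n} {Gt : Model n → Matrix (Fin n) (Fin n) ℝ}

theorem bilin_pullback {z : Model n} (hτ : DifferentiableAt ℝ τ z)
    (h : ∀ i j, Gt z i j = ∑ a, ∑ b, G (τ z) a b * pd i (fun x => τ x a) z
      * pd j (fun x => τ x b) z) (u v : Model n) :
    bilin (Gt z) u v = bilin (G (τ z)) (fderiv ℝ τ z u) (fderiv ℝ τ z v) := by
  have hc : ∀ (u : Model n) a, fderiv ℝ τ z u a = ∑ i, u i * pd i (fun x => τ x a) z := by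
    intro u a
    rw [← fderiv_coord hτ, fderiv_apply_eq_sum_pd]
  simp only [bilin_apply, h, hc, Finset.sum_mul, Finset.mul_sum]
  rw [Finset.sum_congr rfl fun i _ => Finset.sum_comm, Finset.sum_comm]
  refine Finset.sum_congr rfl fun a _ => ?_
  rw [Finset.sum_congr rfl fun i _ => Finset.sum_comm, Finset.sum_comm]
  refine Finset.sum_congr rfl fun b _ => ?_
  rw [Finset.sum_comm]
  refine Finset.sum_congr rfl fun i _ => Finset.sum_congr rfl fun j _ => by ring

/-- Transformation law of the Christoffel symbols. -/
theorem fderiv_chr_eq {z : Model n} (hτ : ContDiffAt ℝ ∞ τ z)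
    (hsurj : Function.Surjective (fderiv ℝ τ z))
    (hG : ∀ i j, ContDiffAt ℝ ∞ (fun x => G x i j) (τ z)) (hd : (G (τ z)).det ≠ 0)
    (hsymm : ∀ i j, G (τ z) i j = G (τ z) j i)
    (hGt : ∀ i j, ContDiffAt ℝ ∞ (fun x => Gt x i j) z) (hdt : (Gt z).det ≠ 0)
    (h : ∀ᶠ x in 𝓝 z, ∀ u v,
      bilin (Gt x) u v = bilin (G (τ x)) (fderiv ℝ τ x u) (fderiv ℝ τ x v)) (u v : Model n) :
    fderiv ℝ τ z (chr Gt z u v) = chr G (τ z) (fderiv ℝ τ z u) (fderiv ℝ τ z v)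
      + fderiv ℝ (fderiv ℝ τ) z u v := by
  have hA : HasFDerivAt (fderiv ℝ τ) (fderiv ℝ (fderiv ℝ τ) z) z :=
    (differentiableAt_of_smooth (hτ.fderiv_right (m := ∞) (by simp))).hasFDerivAt
  have hτ' := (differentiableAt_of_smooth hτ).hasFDerivAt
  have hB : HasFDerivAt (fun x => bilin (G (τ x))) _ z :=
    HasFDerivAt.comp (G := Model n →L[ℝ] Model n →L[ℝ] ℝ) (g := fun x => bilin (G x)) z
      (differentiableAt_bilin hG).hasFDerivAt hτ'
  have hS : ∀ a b, fderiv ℝ (fderiv ℝ τ) z a b = fderiv ℝ (fderiv ℝ τ) z b a :=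
    fun a b => (hτ.isSymmSndFDerivAt (by simpa using ENat.LEInfty.out)).eq a b
  have hBs : ∀ a b, bilin (G (τ z)) a b = bilin (G (τ z)) b a := by
    intro a b
    rw [bilin_apply, bilin_apply, Finset.sum_comm]
    refine Finset.sum_congr rfl fun i _ => Finset.sum_congr rfl fun j _ => ?_
    rw [hsymm]; ring
  -- The product rule applied to the pulled-back form; the second derivatives of τ are the
  -- inhomogeneous terms of the transformation law.
  have hD : ∀ w u v, fderiv ℝ (fun x => bilin (Gt x)) z w u v =
      fderiv ℝ (fun x => bilin (G x)) (τ z) (fderiv ℝ τ z w) (fderiv ℝ τ z u) (fderiv ℝ τ z v)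
      + bilin (G (τ z)) (fderiv ℝ (fderiv ℝ τ) z w u) (fderiv ℝ τ z v)
      + bilin (G (τ z)) (fderiv ℝ τ z u) (fderiv ℝ (fderiv ℝ τ) z w v) := by
    intro w u v
    have h1 : HasFDerivAt (fun x => bilin (Gt x) u v) _ z :=
      ((differentiableAt_bilin hGt).hasFDerivAt.clm_apply (hasFDerivAt_const u z)).clm_apply
        (hasFDerivAt_const v z)
    have h2 : HasFDerivAt (fun x => bilin (G (τ x)) (fderiv ℝ τ x u) (fderiv ℝ τ x v)) _ z :=
      (hB.clm_apply (hA.clm_apply (hasFDerivAt_const u z))).clm_apply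
        (hA.clm_apply (hasFDerivAt_const v z))
    have h3 := h1.unique (h2.congr_of_eventuallyEq (h.mono fun x hx => hx u v))
    have h4 := congrArg (fun L => L w) h3
    simp at h4
    rw [h4]; ring
  have hzero : fderiv ℝ τ z (chr Gt z u v) - chr G (τ z) (fderiv ℝ τ z u) (fderiv ℝ τ z v)
      - fderiv ℝ (fderiv ℝ τ) z u v = 0 := by
    -- Pair with an arbitrary vector, which is of the form dτ(w) by surjectivity. The Koszul formula
    -- turns both Christoffel terms into derivatives of the metric, and symmetry of the metric and
    -- of d²τ cancels everything.
    refine bilin_nondegenerate hd fun w' => ?_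
    obtain ⟨w, rfl⟩ := hsurj w'
    rw [map_sub, map_sub, bilin_chr hG hd, ← h.self_of_nhds, bilin_chr hGt hdt, hD, hD, hD,
      hBs _ (fderiv ℝ (fderiv ℝ τ) z u v), hBs (fderiv ℝ τ z v), hS w u, hS w v, hS v u]
    ring
  rw [sub_sub, sub_eq_zero] at hzero
  exact hzero

/-- The Ricci tensor of a smooth metric is a tensor. -/
theorem sum_ricciCoord_pullback (hτ : ∀ᶠ z in 𝓝 y, ContDiffAt ℝ ∞ τ z)
    (hinj : ∀ᶠ z in 𝓝 y, Function.Bijective (fderiv ℝ τ z))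
    (hG : ∀ᶠ x in 𝓝 (τ y), (∀ i j, ContDiffAt ℝ ∞ (fun x => G x i j) x) ∧ (G x).det ≠ 0 ∧
      ∀ i j, G x i j = G x j i)
    (hGt : ∀ᶠ z in 𝓝 y, (∀ i j, ContDiffAt ℝ ∞ (fun x => Gt x i j) z) ∧ (Gt z).det ≠ 0)
    (h : ∀ᶠ z in 𝓝 y, ∀ i j, Gt z i j = ∑ a, ∑ b, G (τ z) a b * pd i (fun x => τ x a) z
      * pd j (fun x => τ x b) z) (u : Model n) :
    ∑ i, ∑ j, ricciCoord Gt i j y * u i * u j =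
      ∑ a, ∑ b, ricciCoord G a b (τ y) * fderiv ℝ τ y u a * fderiv ℝ τ y u b := by
  have hτy := hτ.self_of_nhds
  have hGy := hG.self_of_nhds
  have hGty := hGt.self_of_nhds
  rw [sum_ricciCoord_eq_trace hGty.1 hGty.2, sum_ricciCoord_eq_trace hGy.1 hGy.2.1]
  have hp : ∀ᶠ z in 𝓝 y, ∀ u v,
      bilin (Gt z) u v = bilin (G (τ z)) (fderiv ℝ τ z u) (fderiv ℝ τ z v) := by
    filter_upwards [h, hτ] with z hz hz'
    exact bilin_pullback (differentiableAt_of_smooth hz') hz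
  have hΓ : ∀ᶠ z in 𝓝 y, ∀ u v, fderiv ℝ τ z (chr Gt z u v) =
      chr G (τ z) (fderiv ℝ τ z u) (fderiv ℝ τ z v) + fderiv ℝ (fderiv ℝ τ) z u v := by
    filter_upwards [hτ, hinj, hτy.continuousAt.eventually hG, hGt, hp.eventually_nhds]
      with z h1 h2 h3 h4 h5
    exact fderiv_chr_eq h1 h2.2 h3.1 h3.2.1 h3.2.2 h4.1 h4.2 h5
  have hA1 : ContDiffAt ℝ ∞ (fderiv ℝ τ) y := hτy.fderiv_right (m := ∞) (by simp)
  have hA2 : ContDiffAt ℝ ∞ (fderiv ℝ (fderiv ℝ τ)) y := hA1.fderiv_right (m := ∞) (by simp)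
  have hA := (differentiableAt_of_smooth hA1).hasFDerivAt
  have hA' := (differentiableAt_of_smooth hA2).hasFDerivAt
  have hτ' := (differentiableAt_of_smooth hτy).hasFDerivAt
  have hC : HasFDerivAt (fun x => chr G (τ x)) _ y :=
    HasFDerivAt.comp (G := Model n →L[ℝ] Model n →L[ℝ] Model n) (g := chr G) y
      (differentiableAt_chr hGy.1 hGy.2.1).hasFDerivAt hτ'
  have hCt := (differentiableAt_chr hGty.1 hGty.2).hasFDerivAt
  have hS' : ∀ᶠ z in 𝓝 y, ∀ a b, fderiv ℝ (fderiv ℝ τ) z a b = fderiv ℝ (fderiv ℝ τ) z b a := by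
    filter_upwards [hτ] with z hz a b
    exact (hz.isSymmSndFDerivAt (by simpa using ENat.LEInfty.out)).eq a b
  have hS := hS'.self_of_nhds
  have hT1 : ∀ a b, fderiv ℝ (fderiv ℝ (fderiv ℝ τ)) y a b
      = fderiv ℝ (fderiv ℝ (fderiv ℝ τ)) y b a :=
    fun a b => (hA1.isSymmSndFDerivAt (by simpa using ENat.LEInfty.out)).eq a b
  -- Symmetry in the last two slots comes from differentiating the symmetry of d²τ, hence from its
  -- validity near y and not just at y.
  have hT2 : ∀ w a b, fderiv ℝ (fderiv ℝ (fderiv ℝ τ)) y w a b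
      = fderiv ℝ (fderiv ℝ (fderiv ℝ τ)) y w b a := by
    intro w a b
    have h1 : ∀ a b, HasFDerivAt (fun z => fderiv ℝ (fderiv ℝ τ) z a b) _ y := fun a b =>
      (hA'.clm_apply (hasFDerivAt_const a y)).clm_apply (hasFDerivAt_const b y)
    have h3 := (h1 a b).unique ((h1 b a).congr_of_eventuallyEq (hS'.mono fun x hx => hx a b))
    simpa using congrArg (fun L => L w) h3
  have hsym : ∀ a b, chr G (τ y) a b = chr G (τ y) b a :=
    chr_symm (hG.mono fun x hx => hx.2.2)
  -- Differentiate the transformation law of the Christoffel symbols along w.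
  have hD : ∀ w u v, fderiv ℝ τ y (fderiv ℝ (chr Gt) y w u v) =
      fderiv ℝ (chr G) (τ y) (fderiv ℝ τ y w) (fderiv ℝ τ y u) (fderiv ℝ τ y v)
      + chr G (τ y) (fderiv ℝ (fderiv ℝ τ) y w u) (fderiv ℝ τ y v)
      + chr G (τ y) (fderiv ℝ τ y u) (fderiv ℝ (fderiv ℝ τ) y w v)
      + fderiv ℝ (fderiv ℝ (fderiv ℝ τ)) y w u v
      - fderiv ℝ (fderiv ℝ τ) y w (chr Gt y u v) := by
    intro w u v
    have h1 : HasFDerivAt (fun x => fderiv ℝ τ x (chr Gt x u v)) _ y :=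
      hA.clm_apply ((hCt.clm_apply (hasFDerivAt_const u y)).clm_apply (hasFDerivAt_const v y))
    have h2 : HasFDerivAt (fun x => chr G (τ x) (fderiv ℝ τ x u) (fderiv ℝ τ x v)
        + fderiv ℝ (fderiv ℝ τ) x u v) _ y :=
      ((hC.clm_apply (hA.clm_apply (hasFDerivAt_const u y))).clm_apply
        (hA.clm_apply (hasFDerivAt_const v y))).add
        ((hA'.clm_apply (hasFDerivAt_const u y)).clm_apply (hasFDerivAt_const v y))
    have h3 := h1.unique (h2.congr_of_eventuallyEq (hΓ.mono fun x hx => hx u v))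
    have h4 := congrArg (fun L => L w) h3
    simp at h4
    rw [eq_sub_iff_add_eq, h4]; abel
  have hΓy := hΓ.self_of_nhds
  -- After antisymmetrisation the third derivatives of τ cancel. The terms with second derivatives
  -- cancel too, once the transformation law is inserted again and the Christoffel symbols are taken
  -- symmetric.
  have hR : ∀ w, fderiv ℝ τ y (curvEnd Gt y u w) =
      curvEnd G (τ y) (fderiv ℝ τ y u) (fderiv ℝ τ y w) := by
    intro w
    rw [curvEnd_apply, curvEnd_apply, map_sub, map_add, map_sub, hD, hD, hΓy, hΓy, hΓy, hΓy,
      map_add, map_add, hS w u, hT1 w u, hT2 u w u,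
      hsym (fderiv ℝ (fderiv ℝ τ) y u w), hsym (fderiv ℝ (fderiv ℝ τ) y u u)]
    abel
  -- The differential dτ conjugates one curvature endomorphism into the other, so their traces
  -- agree.
  let A : Model n ≃ₗ[ℝ] Model n :=
    LinearEquiv.ofBijective (fderiv ℝ τ y : Model n →ₗ[ℝ] Model n) hinj.self_of_nhds
  have hconj : curvEnd G (τ y) (fderiv ℝ τ y u) = A.conj (curvEnd Gt y u) := by
    ext1 w'
    obtain ⟨w, rfl⟩ := A.surjective w'
    rw [LinearEquiv.conj_apply_apply, A.symm_apply_apply]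
    exact (hR w).symm
  rw [hconj, LinearMap.trace_conj']

end ChangeOfCoordinates

/-! ### Tensor fields in charts -/

section Charts

variable {n : ℕ} {M : Type*} [TopologicalSpace M] {e e' : OpenPartialHomeomorph M (Model n)}

/-- The transition map between two charts. -/
def transition (e e' : OpenPartialHomeomorph M (Model n)) (y : Model n) : Model n :=
  e' (e.symm y)

theorem transition_self {y : Model n} (hy : y ∈ e.target) : transition e e =ᶠ[𝓝 y] id := by
  filter_upwards [e.open_target.mem_nhds hy] with z hz using e.right_inv hz

theorem eventually_mem_target_source {y : Model n} (hy : y ∈ e.target)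
    (hy' : e.symm y ∈ e'.source) : ∀ᶠ z in 𝓝 y, z ∈ e.target ∧ e.symm z ∈ e'.source :=
  Filter.Eventually.and (e.open_target.mem_nhds hy)
    ((e.symm.continuousAt hy).eventually (e'.open_source.mem_nhds hy'))

variable [ChartedSpace (Model n) M]

theorem contMDiffAt_chart (he : e ∈ IsManifold.maximalAtlas (𝓡 n) ∞ M) {x : M}
    (hx : x ∈ e.source) : ContMDiffAt (𝓡 n) (𝓡 n) ∞ e x :=
  (contMDiffOn_of_mem_maximalAtlas he).contMDiffAt (e.open_source.mem_nhds hx)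

theorem contMDiffAt_chart_symm (he : e ∈ IsManifold.maximalAtlas (𝓡 n) ∞ M) {y : Model n}
    (hy : y ∈ e.target) : ContMDiffAt (𝓡 n) (𝓡 n) ∞ e.symm y :=
  (contMDiffOn_symm_of_mem_maximalAtlas he).contMDiffAt (e.open_target.mem_nhds hy)

theorem hasMFDerivAt_chart (he : e ∈ IsManifold.maximalAtlas (𝓡 n) ∞ M) {x : M}
    (hx : x ∈ e.source) : HasMFDerivAt (𝓡 n) (𝓡 n) e x (mfderiv (𝓡 n) (𝓡 n) e x) :=
  ((contMDiffAt_chart he hx).mdifferentiableAt (by simp)).hasMFDerivAt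

theorem hasMFDerivAt_chart_symm (he : e ∈ IsManifold.maximalAtlas (𝓡 n) ∞ M) {y : Model n}
    (hy : y ∈ e.target) :
    HasMFDerivAt (𝓡 n) (𝓡 n) e.symm y (mfderiv (𝓡 n) (𝓡 n) e.symm y) :=
  ((contMDiffAt_chart_symm he hy).mdifferentiableAt (by simp)).hasMFDerivAt

theorem contDiffAt_transition (he : e ∈ IsManifold.maximalAtlas (𝓡 n) ∞ M)
    (he' : e' ∈ IsManifold.maximalAtlas (𝓡 n) ∞ M) {y : Model n} (hy : y ∈ e.target)
    (hy' : e.symm y ∈ e'.source) : ContDiffAt ℝ ∞ (transition e e') y :=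
  contMDiffAt_iff_contDiffAt.1 ((contMDiffAt_chart he' hy').comp y (contMDiffAt_chart_symm he hy))

theorem fderiv_transition (he : e ∈ IsManifold.maximalAtlas (𝓡 n) ∞ M)
    (he' : e' ∈ IsManifold.maximalAtlas (𝓡 n) ∞ M) {y : Model n} (hy : y ∈ e.target)
    (hy' : e.symm y ∈ e'.source) (v : Model n) :
    fderiv ℝ (transition e e') y v =
      mfderiv (𝓡 n) (𝓡 n) e' (e.symm y) (mfderiv (𝓡 n) (𝓡 n) e.symm y v) := by
  have h := (hasMFDerivAt_chart he' hy').comp y (hasMFDerivAt_chart_symm he hy)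
  have h2 := mfderiv_eq_fderiv (𝕜 := ℝ) (f := transition e e') (x := y)
  rw [← h2]
  exact congrArg (fun L : Model n →L[ℝ] Model n => L v) h.mfderiv

theorem dcoord_coordVec (he : e ∈ IsManifold.maximalAtlas (𝓡 n) ∞ M)
    (he' : e' ∈ IsManifold.maximalAtlas (𝓡 n) ∞ M) {y : Model n} (hy : y ∈ e.target)
    (hy' : e.symm y ∈ e'.source) (a i : Fin n) :
    dcoord e' (e.symm y) a (coordVec e y i) = pd i (fun z => transition e e' z a) y := by
  simp only [pd]
  rw [fderiv_coord (differentiableAt_of_smooth (contDiffAt_transition he he' hy hy')),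
    fderiv_transition he he' hy hy']
  rfl

theorem dcoord_coordVec_self (he : e ∈ IsManifold.maximalAtlas (𝓡 n) ∞ M) {y : Model n}
    (hy : y ∈ e.target) (v : Model n) :
    mfderiv (𝓡 n) (𝓡 n) e (e.symm y) (mfderiv (𝓡 n) (𝓡 n) e.symm y v) = v := by
  rw [← fderiv_transition he he hy (e.map_target hy), (transition_self hy).fderiv_eq,
    fderiv_id]
  rfl

theorem mfderiv_symm_mfderiv (he : e ∈ IsManifold.maximalAtlas (𝓡 n) ∞ M) {y : Model n}
    (hy : y ∈ e.target) (v : TangentSpace (𝓡 n) (e.symm y)) :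
    mfderiv (𝓡 n) (𝓡 n) e.symm y (mfderiv (𝓡 n) (𝓡 n) e (e.symm y) v) = v := by
  have hx := e.map_target hy
  have h1 := hasMFDerivAt_chart he hx
  have h2 := hasMFDerivAt_chart_symm he hy
  have h3 : HasMFDerivAt (𝓡 n) (𝓡 n) e.symm (e (e.symm y))
      (mfderiv (𝓡 n) (𝓡 n) e.symm y : Model n →L[ℝ] Model n) := by
    rw [e.right_inv hy]; exact h2
  have h4 := h3.comp (e.symm y) h1
  have h5 : HasMFDerivAt (𝓡 n) (𝓡 n) (e.symm ∘ e) (e.symm y)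
      (ContinuousLinearMap.id ℝ (Model n) : Model n →L[ℝ] Model n) := by
    refine (hasMFDerivAt_id (I := 𝓡 n) (e.symm y)).congr_of_eventuallyEq ?_
    filter_upwards [e.open_source.mem_nhds hx] with z hz using e.left_inv hz
  exact congrArg (fun L : Model n →L[ℝ] Model n => L v) (hasMFDerivAt_unique h4 h5)

theorem vec_eq_sum (he : e ∈ IsManifold.maximalAtlas (𝓡 n) ∞ M) {y : Model n}
    (hy : y ∈ e.target) (v : TangentSpace (𝓡 n) (e.symm y)) :
    v = ∑ i, dcoord e (e.symm y) i v • coordVec e y i := by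
  conv_lhs => rw [← mfderiv_symm_mfderiv he hy v]
  exact clm_apply_eq_sum (mfderiv (𝓡 n) (𝓡 n) e.symm y : Model n →L[ℝ] Model n) _

theorem covTwo_apply_symm (he : e ∈ IsManifold.maximalAtlas (𝓡 n) ∞ M) (T : CovTwo n M)
    {y : Model n} (hy : y ∈ e.target) (v w : TangentSpace (𝓡 n) (e.symm y)) :
    T (e.symm y) v w = ∑ i, ∑ j, comp e T y i j * dcoord e (e.symm y) i v
      * dcoord e (e.symm y) j w := by
  conv_lhs => rw [vec_eq_sum he hy v, vec_eq_sum he hy w]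
  simp only [map_sum, map_smul, _root_.sum_apply, _root_.smul_apply, smul_eq_mul, comp,
    Matrix.of_apply, Finset.mul_sum]
  rw [Finset.sum_comm]
  exact Finset.sum_congr rfl fun i _ => Finset.sum_congr rfl fun j _ => by ring

/-- A tensor field in terms of its components. -/
theorem covTwo_apply (he : e ∈ IsManifold.maximalAtlas (𝓡 n) ∞ M) (T : CovTwo n M)
    {x : M} (hx : x ∈ e.source) (v w : TangentSpace (𝓡 n) x) :
    T x v w = ∑ i, ∑ j, comp e T (e x) i j * dcoord e x i v * dcoord e x j w := by
  obtain ⟨y, hy, rfl⟩ : ∃ y ∈ e.target, e.symm y = x := ⟨e x, e.map_source hx, e.left_inv hx⟩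
  rw [covTwo_apply_symm he T hy, e.right_inv hy]

theorem comp_transform (he : e ∈ IsManifold.maximalAtlas (𝓡 n) ∞ M)
    (he' : e' ∈ IsManifold.maximalAtlas (𝓡 n) ∞ M) (T : CovTwo n M) {y : Model n}
    (hy : y ∈ e.target) (hy' : e.symm y ∈ e'.source) (i j : Fin n) :
    comp e T y i j = ∑ a, ∑ b, comp e' T (transition e e' y) a b
      * pd i (fun z => transition e e' z a) y * pd j (fun z => transition e e' z b) y := by
  have := covTwo_apply he' T hy' (coordVec e y i) (coordVec e y j)
  simp only [dcoord_coordVec he he' hy hy'] at this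
  exact this

theorem dcoord_transform (he : e ∈ IsManifold.maximalAtlas (𝓡 n) ∞ M)
    (he' : e' ∈ IsManifold.maximalAtlas (𝓡 n) ∞ M) {x : M}
    (hx : x ∈ e.source) (hx' : x ∈ e'.source) (a : Fin n) (v : TangentSpace (𝓡 n) x) :
    dcoord e' x a v = ∑ i, pd i (fun z => transition e e' z a) (e x) * dcoord e x i v := by
  obtain ⟨y, hy, rfl⟩ : ∃ y ∈ e.target, e.symm y = x := ⟨e x, e.map_source hx, e.left_inv hx⟩
  conv_lhs => rw [vec_eq_sum he hy v]
  rw [map_sum, e.right_inv hy]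
  refine Finset.sum_congr rfl fun i _ => ?_
  rw [map_smul, dcoord_coordVec he he' hy hx', smul_eq_mul, mul_comm]

theorem fderiv_transition_bijective (he : e ∈ IsManifold.maximalAtlas (𝓡 n) ∞ M)
    (he' : e' ∈ IsManifold.maximalAtlas (𝓡 n) ∞ M) {y : Model n} (hy : y ∈ e.target)
    (hy' : e.symm y ∈ e'.source) : Function.Bijective (fderiv ℝ (transition e e') y) := by
  have hinj : Function.Injective (fderiv ℝ (transition e e') y) := by
    intro u v huv
    rw [fderiv_transition he he' hy hy', fderiv_transition he he' hy hy'] at huv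
    have key : ∀ {x : M} (_ : x ∈ e'.source) (a b : TangentSpace (𝓡 n) x),
        mfderiv (𝓡 n) (𝓡 n) e' x a = mfderiv (𝓡 n) (𝓡 n) e' x b → a = b := by
      intro x hx a b hab
      obtain ⟨z, hz, rfl⟩ : ∃ z ∈ e'.target, e'.symm z = x :=
        ⟨e' x, e'.map_source hx, e'.left_inv hx⟩
      rw [← mfderiv_symm_mfderiv he' hz a, hab, mfderiv_symm_mfderiv he' hz b]
    have h1 := key hy' _ _ huv
    rw [← dcoord_coordVec_self he hy u, h1, dcoord_coordVec_self he hy v]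
  exact ⟨hinj, (LinearMap.injective_iff_surjective
    (f := (fderiv ℝ (transition e e') y : Model n →ₗ[ℝ] Model n))).1 hinj⟩

/-- A kernel vector of the component matrix would be orthogonal to every vector, in particular to a
timelike one. The Lorentzian condition would make its square positive, while orthogonality to itself
makes it zero. -/
theorem comp_det_ne_zero (he : e ∈ IsManifold.maximalAtlas (𝓡 n) ∞ M) {g : CovTwo n M}
    (hg : IsLorentzian g) {y : Model n} (hy : y ∈ e.target) : (comp e g y).det ≠ 0 := by
  intro h0
  obtain ⟨c, hc0, hc⟩ := Matrix.exists_mulVec_eq_zero_iff.2 h0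
  set x := e.symm y with hx
  set u : TangentSpace (𝓡 n) (e.symm y) :=
    mfderiv (𝓡 n) (𝓡 n) e.symm y (WithLp.toLp 2 c : Model n) with hu
  have hd : ∀ j, dcoord e (e.symm y) j u = c j := by
    intro j
    have := dcoord_coordVec_self he hy (WithLp.toLp 2 c : Model n)
    exact congrArg (fun z : Model n => z j) this
  have hz : ∀ w, g (e.symm y) w u = 0 := by
    intro w
    rw [covTwo_apply_symm he g hy]
    refine Finset.sum_eq_zero fun i _ => ?_
    have := congrFun hc i
    simp only [Matrix.mulVec, dotProduct, Pi.zero_apply] at this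
    simp only [hd, mul_right_comm _ _ (c _), ← Finset.sum_mul, this, zero_mul]
  obtain ⟨hs, v, hv, hpos⟩ := hg (e.symm y)
  have hu0 : u ≠ 0 := by
    intro h
    apply hc0
    ext j
    rw [← hd j, h, map_zero]; rfl
  have := hpos u (hz v) hu0
  rw [hz u] at this
  exact lt_irrefl _ this

theorem comp_symm {g : CovTwo n M} (hg : IsLorentzian g) (e : OpenPartialHomeomorph M (Model n))
    (y : Model n) (i j : Fin n) : comp e g y i j = comp e g y j i :=
  (hg (e.symm y)).1 _ _

theorem contDiffAt_comp {g : CovTwo n M} (hg : IsSmoothCov g)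
    (he : e ∈ IsManifold.maximalAtlas (𝓡 n) ∞ M) {y : Model n} (hy : y ∈ e.target) (i j : Fin n) :
    ContDiffAt ℝ ∞ (fun z => comp e g z i j) y :=
  (hg e he i j).contDiffAt (e.open_target.mem_nhds hy)

/-- The Ricci tensor of a smooth Lorentzian metric can be computed in any chart. -/
theorem ricci_eq_sum [IsManifold (𝓡 n) ∞ M] {g : CovTwo n M} (hg : IsSmoothCov g)
    (hl : IsLorentzian g) (he' : e' ∈ IsManifold.maximalAtlas (𝓡 n) ∞ M)
    {x : M} (hx' : x ∈ e'.source)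
    (v : TangentSpace (𝓡 n) x) :
    ricci g x v = ∑ i, ∑ j, ricciCoord (comp e' g) i j (e' x) * dcoord e' x i v
      * dcoord e' x j v := by
  set e := chartAt (Model n) x with he_def
  have he : e ∈ IsManifold.maximalAtlas (𝓡 n) ∞ M := IsManifold.chart_mem_maximalAtlas x
  have hx : x ∈ e.source := mem_chart_source _ x
  have hy : e x ∈ e.target := e.map_source hx
  have hy' : e.symm (e x) ∈ e'.source := by rwa [e.left_inv hx]
  have hτ : transition e e' (e x) = e' x := by rw [transition, e.left_inv hx]
  have hyt : transition e e' (e x) ∈ e'.target := by rw [hτ]; exact e'.map_source hx'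
  have hev := eventually_mem_target_source hy hy'
  obtain ⟨u, hu⟩ : ∃ u : Model n, ∀ i, u i = dcoord e x i v :=
    ⟨mfderiv (𝓡 n) (𝓡 n) e x v, fun _ => rfl⟩
  have h := sum_ricciCoord_pullback (τ := transition e e') (G := comp e' g) (Gt := comp e g)
    (y := e x) (hev.mono fun z hz => contDiffAt_transition he he' hz.1 hz.2)
    (hev.mono fun z hz => fderiv_transition_bijective he he' hz.1 hz.2)
    (by
      filter_upwards [e'.open_target.mem_nhds hyt] with z hz
      exact ⟨contDiffAt_comp hg he' hz, comp_det_ne_zero he' hl hz, comp_symm hl e' z⟩)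
    (hev.mono fun z hz => ⟨contDiffAt_comp hg he hz.1, comp_det_ne_zero he hl hz.1⟩)
    (hev.mono fun z hz => comp_transform he he' g hz.1 hz.2)
    u
  have hc : ∀ a, fderiv ℝ (transition e e') (e x) u a = dcoord e' x a v := by
    intro a
    rw [← fderiv_coord (differentiableAt_of_smooth (contDiffAt_transition he he' hy hy')),
      fderiv_apply_eq_sum_pd, dcoord_transform he he' hx hx']
    exact Finset.sum_congr rfl fun i _ => by rw [hu, mul_comm]
  simp only [hc, hτ, hu] at h
  rw [← h]
  rfl

end Charts

/-! ### Naturality of the principal part -/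

section Naturality

variable {n : ℕ}

/-- The principal part as a linear functional of the second derivatives. -/
def principalₗ (H : Matrix (Fin n) (Fin n) ℝ) (i j : Fin n) :
    (Fin n → Fin n → Fin n → Fin n → ℝ) →ₗ[ℝ] ℝ where
  toFun S := principal H S i j
  map_add' S S' := by
    simp only [principal, Pi.add_apply, Finset.mul_sum, ← Finset.sum_sub_distrib,
      ← Finset.sum_add_distrib]
    exact Finset.sum_congr rfl fun m _ => Finset.sum_congr rfl fun k _ => by ring
  map_smul' c S := by
    simp only [principal, Pi.smul_apply, smul_eq_mul, RingHom.id_apply, Finset.mul_sum,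
      ← Finset.sum_sub_distrib]
    exact Finset.sum_congr rfl fun m _ => Finset.sum_congr rfl fun k _ => by ring

theorem principal_sum {κ : Type*} (s : Finset κ) (H : Matrix (Fin n) (Fin n) ℝ) (c : κ → ℝ)
    (S : κ → Fin n → Fin n → Fin n → Fin n → ℝ) (i j : Fin n) :
    principal H (fun p q r t => ∑ a ∈ s, c a * S a p q r t) i j
      = ∑ a ∈ s, c a * principal H (S a) i j := by
  have h := map_sum (principalₗ H i j) (fun a => c a • S a) s
  simp only [map_smul] at h
  refine Eq.trans ?_ h
  change _ = principal H _ i j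
  congr 1
  ext p q r t
  simp

/-- On decomposable tensors the principal part reduces to scalar contractions with H times products
of covectors. The last two terms would cancel for symmetric H, but H is arbitrary here. -/
theorem principal_prod (H : Matrix (Fin n) (Fin n) ℝ) (α β γ δ : Fin n → ℝ) (i j : Fin n) :
    principal H (fun p q r s => α p * β q * γ r * δ s) i j = (1 / 2 : ℝ) *
      ((∑ m, ∑ l, H m l * α m * δ l) * (β i * γ j + β j * γ i)
        - (∑ m, ∑ l, H m l * α m * β l) * (γ i * δ j)
        - (∑ m, ∑ l, H m l * γ m * δ l) * (α j * β i)
        - (∑ m, ∑ l, H m l * β m * δ l) * (α j * γ i)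
        + (∑ m, ∑ l, H m l * δ m * β l) * (α j * γ i)) := by
  simp only [principal, Finset.mul_sum, Finset.sum_mul, ← Finset.sum_sub_distrib,
    ← Finset.sum_add_distrib]
  exact Finset.sum_congr rfl fun m _ => Finset.sum_congr rfl fun k _ => by ring

/-- The pull-back of a tensor of type `(0,4)`. -/
def pull4 (A : Matrix (Fin n) (Fin n) ℝ) (S : Fin n → Fin n → Fin n → Fin n → ℝ) :
    Fin n → Fin n → Fin n → Fin n → ℝ := fun p q r s =>
  ∑ t : Fin n × Fin n × Fin n × Fin n, S t.1 t.2.1 t.2.2.1 t.2.2.2 *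
    (A t.1 p * A t.2.1 q * A t.2.2.1 r * A t.2.2.2 s)

/-- In matrix form, Gt = AᵀGA implies A Gt⁻¹ Aᵀ = G⁻¹: contraction of pulled-back covectors with the
inverse metric is invariant. -/
theorem sum_inv_pullback {A G Gt : Matrix (Fin n) (Fin n) ℝ} (hA : A.det ≠ 0)
    (h : ∀ i j, Gt i j = ∑ a, ∑ b, G a b * A a i * A b j) (b c : Fin n) :
    ∑ m, ∑ l, Gt⁻¹ m l * A b m * A c l = G⁻¹ b c := by
  have h1 : Gt = A.transpose * G * A := by
    ext i j
    rw [h, Matrix.mul_apply, Finset.sum_comm]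
    refine Finset.sum_congr rfl fun b _ => ?_
    rw [Matrix.mul_apply, Finset.sum_mul]
    exact Finset.sum_congr rfl fun a _ => by rw [Matrix.transpose_apply]; ring
  have hu : IsUnit A.det := isUnit_iff_ne_zero.2 hA
  have hut : IsUnit A.transpose.det := by rwa [Matrix.det_transpose]
  have h2 : A * Gt⁻¹ * A.transpose = G⁻¹ := by
    rw [h1, Matrix.mul_inv_rev, Matrix.mul_inv_rev, ← mul_assoc, Matrix.mul_nonsing_inv _ hu,
      one_mul, mul_assoc, Matrix.nonsing_inv_mul _ hut, mul_one]
  rw [← h2, Matrix.mul_apply, Finset.sum_comm]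
  refine Finset.sum_congr rfl fun l _ => ?_
  rw [Matrix.mul_apply, Finset.sum_mul]
  exact Finset.sum_congr rfl fun m _ => by rw [Matrix.transpose_apply]; ring

/-- Writes an arbitrary S as a combination of decomposable tensors, so that linearity reduces
statements about `principal` to `principal_prod`. -/
theorem pull4_one (S : Fin n → Fin n → Fin n → Fin n → ℝ) : pull4 1 S = S := by
  ext p q r s
  unfold pull4
  rw [Finset.sum_eq_single (p, q, r, s)]
  · simp
  · rintro ⟨a, b, c, d⟩ _ ht
    by_cases h1 : a = p
    · by_cases h2 : b = q
      · by_cases h3 : c = r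
        · have h4 : d ≠ s := by rintro rfl; exact ht (by rw [h1, h2, h3])
          simp [Matrix.one_apply_ne h4]
        · simp [Matrix.one_apply_ne h3]
      · simp [Matrix.one_apply_ne h2]
    · simp [Matrix.one_apply_ne h1]
  · intro h; exact absurd (Finset.mem_univ _) h

theorem principal_pull4_eq_sum (H A : Matrix (Fin n) (Fin n) ℝ)
    (S : Fin n → Fin n → Fin n → Fin n → ℝ) (i j : Fin n) :
    principal H (pull4 A S) i j = ∑ t : Fin n × Fin n × Fin n × Fin n,
      S t.1 t.2.1 t.2.2.1 t.2.2.2 * principal H (fun p q r s =>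
        A t.1 p * A t.2.1 q * A t.2.2.1 r * A t.2.2.2 s) i j := by
  unfold pull4
  exact principal_sum (κ := Fin n × Fin n × Fin n × Fin n) Finset.univ H
    (fun t => S t.1 t.2.1 t.2.2.1 t.2.2.2)
    (fun t p q r s => A t.1 p * A t.2.1 q * A t.2.2.1 r * A t.2.2.2 s) i j

/-- By linearity in S it suffices to treat products of four covectors, where only the invariance of
contractions with the inverse metric is needed. S need have no index symmetries. -/
theorem principal_pull4 {A G Gt : Matrix (Fin n) (Fin n) ℝ} (hA : A.det ≠ 0)
    (h : ∀ i j, Gt i j = ∑ a, ∑ b, G a b * A a i * A b j)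
    (S : Fin n → Fin n → Fin n → Fin n → ℝ) (i j : Fin n) :
    principal Gt⁻¹ (pull4 A S) i j = ∑ a, ∑ b, principal G⁻¹ S a b * A a i * A b j := by
  have hR : ∀ a b, principal G⁻¹ S a b = _ := fun a b =>
    (congrArg (fun S' => principal G⁻¹ S' a b) (pull4_one S).symm).trans
      (principal_pull4_eq_sum G⁻¹ 1 S a b)
  simp only [principal_pull4_eq_sum, hR, Finset.sum_mul]
  rw [Finset.sum_congr rfl fun a _ => Finset.sum_comm, Finset.sum_comm]
  refine Finset.sum_congr rfl fun t _ => ?_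
  have key : ∀ x y : Fin n, ∑ a, ∑ b, ((1 : Matrix (Fin n) (Fin n) ℝ) x a *
      (1 : Matrix (Fin n) (Fin n) ℝ) y b) * A a i * A b j = A x i * A y j := by
    intro x y; simp [Matrix.one_apply]
  have key' : ∀ x y : Fin n, ∑ a, ∑ b, ((1 : Matrix (Fin n) (Fin n) ℝ) x b *
      (1 : Matrix (Fin n) (Fin n) ℝ) y a) * A a i * A b j = A x j * A y i := by
    intro x y; simp [Matrix.one_apply]; ring
  have kH : ∀ x y : Fin n, ∑ m, ∑ l, G⁻¹ m l * (1 : Matrix (Fin n) (Fin n) ℝ) x m *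
      (1 : Matrix (Fin n) (Fin n) ℝ) y l = G⁻¹ x y := by
    intro x y; simp [Matrix.one_apply]
  simp only [principal_prod, sum_inv_pullback hA h, kH, ← key, ← key']
  simp only [Finset.mul_sum, ← Finset.sum_sub_distrib, ← Finset.sum_add_distrib]
  exact Finset.sum_congr rfl fun a _ => Finset.sum_congr rfl fun b _ => by ring

end Naturality

/-! ### Second derivatives of pulled back families -/

section Pullback

variable {n : ℕ} {ι : Type*} {l : Filter ι} {yf : ι → Model n} {y₀ : Model n}
  {τ : Model n → Model n} {H : ι → Model n → ℝ}

theorem contDiffAt_coord {y : Model n} (hτ : ContDiffAt ℝ ∞ τ y) (a : Fin n) :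
    ContDiffAt ℝ ∞ (fun z => τ z a) y :=
  (EuclideanSpace.proj a : Model n →L[ℝ] ℝ).contDiff.contDiffAt.comp y hτ

theorem pd_mul_comp {c h : Model n → ℝ} {y : Model n} (hc : ContDiffAt ℝ ∞ c y)
    (hτ : ContDiffAt ℝ ∞ τ y) (hh : ContDiffAt ℝ ∞ h (τ y)) (k : Fin n) :
    pd k (fun z => c z * h (τ z)) y =
      pd k c y * h (τ y) + ∑ a, c y * pd k (fun z => τ z a) y * pd a h (τ y) := by
  rw [pd_mul (differentiableAt_of_smooth hc)
    (differentiableAt_of_smooth (f := fun z => h (τ z)) (hh.comp y hτ)),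
    pd_comp (differentiableAt_of_smooth hh) (differentiableAt_of_smooth hτ), Finset.mul_sum]
  exact congrArg _ (Finset.sum_congr rfl fun a _ => by ring)

variable {c : Model n → ℝ}

theorem bddAlong_of_smooth (hy : Tendsto yf l (𝓝 y₀)) (hc : ContDiffAt ℝ ∞ c y₀) :
    BddAlong l fun p => c (yf p) :=
  bddAlong_of_tendsto (hc.continuousAt.tendsto.comp hy)

theorem bddAlong_pd_mul_comp (hy : Tendsto yf l (𝓝 y₀))
    (hc : ∀ᶠ z in 𝓝 y₀, ContDiffAt ℝ ∞ c z) (hτ : ∀ᶠ z in 𝓝 y₀, ContDiffAt ℝ ∞ τ z)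
    (hH : ∀ᶠ p in l, ContDiff ℝ ∞ (H p)) (hH0 : BddAlong l fun p => H p (τ (yf p)))
    (hH1 : ∀ a, BddAlong l fun p => pd a (H p) (τ (yf p))) (k : Fin n) :
    BddAlong l fun p => pd k (fun z => c z * H p (τ z)) (yf p) := by
  have h1 : BddAlong l fun p => pd k c (yf p) * H p (τ (yf p)) +
      ∑ a, c (yf p) * pd k (fun z => τ z a) (yf p) * pd a (H p) (τ (yf p)) :=
    ((bddAlong_of_smooth hy (contDiffAt_pd hc.self_of_nhds k)).mul hH0).add
      (BddAlong.sum fun a _ => ((bddAlong_of_smooth hy hc.self_of_nhds).mul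
        (bddAlong_of_smooth hy (contDiffAt_pd (contDiffAt_coord hτ.self_of_nhds a) k))).mul (hH1 a))
  refine h1.congr ?_
  filter_upwards [hy.eventually hc, hy.eventually hτ, hH] with p h1 h2 h3
  rw [pd_mul_comp h1 h2 h3.contDiffAt]

/-- Only the terms in which both derivatives fall on H can be unbounded. All others contain at most
one derivative of H, multiplied by fixed smooth functions. -/
theorem bddAlong_pd_pd_mul_comp (hy : Tendsto yf l (𝓝 y₀))
    (hc : ∀ᶠ z in 𝓝 y₀, ContDiffAt ℝ ∞ c z) (hτ : ∀ᶠ z in 𝓝 y₀, ContDiffAt ℝ ∞ τ z)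
    (hH : ∀ᶠ p in l, ContDiff ℝ ∞ (H p)) (hH0 : BddAlong l fun p => H p (τ (yf p)))
    (hH1 : ∀ a, BddAlong l fun p => pd a (H p) (τ (yf p))) (p q : Fin n) :
    BddAlong l fun k => pd p (pd q fun z => c z * H k (τ z)) (yf k)
      - ∑ a, ∑ b, c (yf k) * pd q (fun z => τ z a) (yf k) * pd p (fun z => τ z b) (yf k) *
        pd b (pd a (H k)) (τ (yf k)) := by
  have hcq : ∀ᶠ z in 𝓝 y₀, ContDiffAt ℝ ∞ (pd q c) z := hc.mono fun z hz => contDiffAt_pd hz q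
  have hca : ∀ a, ∀ᶠ z in 𝓝 y₀, ContDiffAt ℝ ∞ (fun z => c z * pd q (fun z => τ z a) z) z := by
    intro a
    filter_upwards [hc, hτ] with z h1 h2 using h1.mul (contDiffAt_pd (contDiffAt_coord h2 a) q)
  have h1 := bddAlong_pd_mul_comp hy hcq hτ hH hH0 hH1 p
  have h2 : ∀ a, BddAlong l fun k =>
      pd p (fun z => c z * pd q (fun z => τ z a) z) (yf k) * pd a (H k) (τ (yf k)) := fun a =>
    (bddAlong_of_smooth hy (contDiffAt_pd (hca a).self_of_nhds p)).mul (hH1 a)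
  refine (h1.add (BddAlong.sum (s := Finset.univ) fun a _ => h2 a)).congr ?_
  filter_upwards [hy.eventually hc.eventually_nhds, hy.eventually hτ.eventually_nhds,
    hy.eventually (eventually_all.2 hca), hy.eventually hcq, hH] with k g1 g2 g3 g4 g5
  have e1 : (pd q fun z => c z * H k (τ z)) =ᶠ[𝓝 (yf k)] fun z =>
      pd q c z * H k (τ z) + ∑ a, c z * pd q (fun z => τ z a) z * pd a (H k) (τ z) := by
    filter_upwards [g1, g2] with z hz hz'
    exact pd_mul_comp hz hz' g5.contDiffAt q
  have g2' := g2.self_of_nhds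
  have g6 : ∀ a, ContDiffAt ℝ ∞ (fun z => pd a (H k) (τ z)) (yf k) := fun a =>
    (contDiff_pd g5 a).contDiffAt.comp _ g2'
  have d1 : ∀ a, DifferentiableAt ℝ
      (fun z => c z * pd q (fun z => τ z a) z * pd a (H k) (τ z)) (yf k) := fun a =>
    differentiableAt_of_smooth ((g3 a).mul (g6 a))
  have d2 : DifferentiableAt ℝ (fun z => pd q c z * H k (τ z)) (yf k) :=
    differentiableAt_of_smooth (g4.mul (g5.contDiffAt.comp _ g2'))
  rw [pd_congr e1, pd_add d2 (DifferentiableAt.fun_sum fun a _ => d1 a), pd_sum fun a _ => d1 a,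
    Finset.sum_congr rfl fun a _ => pd_mul_comp (g3 a) g2' (contDiff_pd g5 a).contDiffAt p,
    Finset.sum_add_distrib]
  ring

end Pullback

/-! ### The regularised metric in charts -/

section RegularisedMetric

variable {n : ℕ}

theorem christoffel_congr {G G' : Model n → Matrix (Fin n) (Fin n) ℝ} {z : Model n}
    (h : G =ᶠ[𝓝 z] G') (m i j : Fin n) : christoffel G m i j z = christoffel G' m i j z := by
  have h' : ∀ a b, (fun z => G z a b) =ᶠ[𝓝 z] fun z => G' z a b := fun a b =>
    h.mono fun x hx => congrFun (congrFun hx a) b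
  simp only [christoffel, h.eq_of_nhds, pd_congr (h' _ _)]

theorem ricciQuad_congr {G G' : Model n → Matrix (Fin n) (Fin n) ℝ} {z : Model n}
    (h : G =ᶠ[𝓝 z] G') (i j : Fin n) : ricciQuad G i j z = ricciQuad G' i j z := by
  simp only [ricciQuad, christoffel_congr h]

/-- The distributional Ricci tensor only depends on the metric near the support of the test
function. -/
theorem distRicciCoord_congr {G G' : Model n → Matrix (Fin n) (Fin n) ℝ} {U V : Set (Model n)}
    (hV : IsOpen V) (hVU : V ⊆ U) (h : ∀ z ∈ V, G z = G' z) {φ : Model n → ℝ}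
    (hφ : tsupport φ ⊆ V) (i j : Fin n) :
    distRicciCoord U G i j φ = distRicciCoord univ G' i j φ := by
  have h0 : ∀ (G : Model n → Matrix (Fin n) (Fin n) ℝ) z, z ∉ V →
      -(∑ m, christoffel G m i j z * pd m φ z) + (∑ m, christoffel G m i m z * pd j φ z)
        + ricciQuad G i j z * φ z = 0 := by
    intro G z hz
    have hz' : z ∉ tsupport φ := fun h => hz (hφ h)
    simp [pd_eq_zero_of_notMem_tsupport hz', image_eq_zero_of_notMem_tsupport hz']
  rw [distRicciCoord, distRicciCoord, setIntegral_univ,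
    setIntegral_eq_integral_of_forall_compl_eq_zero fun z hz => h0 G z fun h => hz (hVU h)]
  congr 1
  ext z
  by_cases hz : z ∈ V
  · have hG : G =ᶠ[𝓝 z] G' := eventually_of_mem (hV.mem_nhds hz) h
    simp only [christoffel_congr hG, ricciQuad_congr hG]
  · rw [h0 G z hz, h0 G' z hz]

theorem moll_congr {κ f f' : Model n → ℝ} (hκ : IsKernel κ) {ε : ℝ} (hε : 0 < ε) {y : Model n}
    (h : ∀ z ∈ Metric.ball y ε, f z = f' z) : moll κ ε f y = moll κ ε f' y := by
  unfold moll
  congr 1; ext z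
  by_cases hz : z ∈ Metric.ball y ε
  · rw [h z hz]
  · simp [hκ.scaled_sub_eq_zero hε hz]

variable {M : Type*} [TopologicalSpace M] [ChartedSpace (Model n) M]

theorem lipAt_comp {g : CovTwo n M} (hg : IsLocLipCov g) {e : OpenPartialHomeomorph M (Model n)}
    (he : e ∈ IsManifold.maximalAtlas (𝓡 n) ∞ M) {y : Model n} (hy : y ∈ e.target)
    (i j : Fin n) : LipAt (fun z => comp e g z i j) y := by
  obtain ⟨c, s, hs, h⟩ := hg e he i j hy
  rw [e.open_target.nhdsWithin_eq hy] at hs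
  exact ⟨c, s, hs, h⟩

variable (R : Mollification n M)

theorem Mollification.isKernel : IsKernel R.ρ := ⟨R.ρ_smooth, R.ρ_support⟩

theorem Mollification.isCompact_tsupport (α : ℕ) : IsCompact (tsupport (R.ξ α)) :=
  (R.isCompact_closure α).of_isClosed_subset (isClosed_tsupport _)
    ((R.subordinate α).trans subset_closure)

/-- The function `ξ_α` in the chart `ψ_α`, extended by zero. -/
def Mollification.cut (α : ℕ) : Model n → ℝ :=
  (R.chart α).target.indicator fun z => R.ξ α ((R.chart α).symm z)

/-- The components of `ξ_α T` in the chart `ψ_α`, extended by zero. -/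
def Mollification.loc (T : CovTwo n M) (α : ℕ) (i j : Fin n) (z : Model n) : ℝ :=
  R.cut α z * comp (R.chart α) T z i j

/-- The image of the support of `ξ_α` in the chart `ψ_α`. -/
def Mollification.supp (α : ℕ) : Set (Model n) := R.chart α '' tsupport (R.ξ α)

/-- Relative compactness of the chart domain makes the support of ξ_α compact; hence its image is
closed in all of ℝⁿ, and extension by zero across the boundary of the chart image does no harm. -/
theorem Mollification.isClosed_supp (α : ℕ) : IsClosed (R.supp α) :=
  ((R.isCompact_tsupport α).image_of_continuousOn
    ((R.chart α).continuousOn.mono (R.subordinate α))).isClosed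

theorem Mollification.supp_subset (α : ℕ) : R.supp α ⊆ (R.chart α).target := by
  rintro _ ⟨x, hx, rfl⟩
  exact (R.chart α).map_source (R.subordinate α hx)

theorem Mollification.cut_of_mem {α : ℕ} {z : Model n} (hz : z ∈ (R.chart α).target) :
    R.cut α z = R.ξ α ((R.chart α).symm z) := indicator_of_mem hz _

theorem Mollification.cut_eq_zero {α : ℕ} {z : Model n} (hz : z ∉ R.supp α) : R.cut α z = 0 := by
  by_cases h : z ∈ (R.chart α).target
  · rw [R.cut_of_mem h]
    by_contra h0
    exact hz ⟨_, subset_tsupport _ h0, (R.chart α).right_inv h⟩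
  · exact indicator_of_notMem h _

theorem Mollification.cut_nonneg (α : ℕ) (z : Model n) : 0 ≤ R.cut α z :=
  indicator_nonneg (fun _ _ => R.ξ.nonneg α _) z

theorem Mollification.cut_eventuallyEq_zero {α : ℕ} {z : Model n} (hz : z ∉ R.supp α) :
    R.cut α =ᶠ[𝓝 z] 0 := by
  filter_upwards [(R.isClosed_supp α).isOpen_compl.mem_nhds hz] with w hw using R.cut_eq_zero hw

theorem Mollification.contDiff_cut (α : ℕ) : ContDiff ℝ ∞ (R.cut α) := by
  refine contDiff_iff_contDiffAt.2 fun z => ?_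
  by_cases hz : z ∈ R.supp α
  · have hzt := R.supp_subset α hz
    have h1 : ContMDiffAt (𝓡 n) 𝓘(ℝ, ℝ) ∞ (fun z => R.ξ α ((R.chart α).symm z)) z :=
      ((R.ξ α).contMDiff.contMDiffAt).comp z (contMDiffAt_chart_symm (R.chart_mem α) hzt)
    refine (contMDiffAt_iff_contDiffAt.1 h1).congr_of_eventuallyEq ?_
    filter_upwards [(R.chart α).open_target.mem_nhds hzt] with w hw using R.cut_of_mem hw
  · exact contDiffAt_const.congr_of_eventuallyEq (R.cut_eventuallyEq_zero hz)

variable {R} {g : CovTwo n M}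

theorem Mollification.lipAt_loc (hg : IsLocLipCov g) (α : ℕ) (i j : Fin n) (z : Model n) :
    LipAt (R.loc g α i j) z := by
  by_cases hz : z ∈ R.supp α
  · exact (R.contDiff_cut α).contDiffAt.lipAt.mul
      (lipAt_comp hg (R.chart_mem α) (R.supp_subset α hz) i j)
  · refine LipAt.congr (contDiffAt_const (c := (0 : ℝ)).lipAt) ?_
    filter_upwards [R.cut_eventuallyEq_zero hz] with w hw
    simp [Mollification.loc, hw]

theorem Mollification.continuous_loc (hg : IsLocLipCov g) (α : ℕ) (i j : Fin n) :
    Continuous (R.loc g α i j) :=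
  continuous_iff_continuousAt.2 fun z => (Mollification.lipAt_loc hg α i j z).continuousAt

theorem Mollification.convComp_eq (ε : ℝ) (T : CovTwo n M) (α : ℕ) (i j : Fin n) :
    R.convComp ε T α i j = moll R.ρ ε (R.loc T α i j) := by
  ext y
  unfold Mollification.convComp moll
  have h0 : ∀ z, z ∉ (R.chart α).target → R.loc T α i j z * scaled R.ρ ε (y - z) = 0 := by
    intro z hz
    have : R.cut α z = 0 := indicator_of_notMem hz _
    simp [Mollification.loc, this]
  rw [← setIntegral_eq_integral_of_forall_compl_eq_zero h0]
  refine setIntegral_congr_fun (R.chart α).open_target.measurableSet fun z hz => ?_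
  simp only [Mollification.loc, R.cut_of_mem hz]
  rfl

variable {ι : Type*} {l : Filter ι} {εf : ι → ℝ} {yf : ι → Model n}

/-- The distributional Ricci tensor of `g`, tested against `ξ_α ρ_ε(y - ·)` in the chart `ψ_α`. -/
def Mollification.testRicci (R : Mollification n M) (g : CovTwo n M) (α : ℕ) (ε : ℝ)
    (y : Model n) (i j : Fin n) : ℝ :=
  distRicciCoord (R.chart α).target (comp (R.chart α) g) i j
    fun z => R.cut α z * scaled R.ρ ε (y - z)

theorem Mollification.tsupport_test_subset (R : Mollification n M) (α : ℕ) {ε : ℝ} (hε : 0 < ε)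
    (y : Model n) :
    tsupport (fun z => R.cut α z * scaled R.ρ ε (y - z)) ⊆ Metric.closedBall y ε ∩ R.supp α := by
  refine closure_minimal (fun z hz => ?_) (Metric.isClosed_closedBall.inter (R.isClosed_supp α))
  refine ⟨?_, by_contra fun h => hz (by simp [R.cut_eq_zero h])⟩
  by_contra h
  have : z ∉ Metric.ball y ε := fun h' => h (Metric.ball_subset_closedBall h')
  exact hz (by simp [R.isKernel.scaled_sub_eq_zero hε this])

/-- Reduces to components that are Lipschitz on all of ℝⁿ. For small ε both the test function and
the mollification see only a small ball around y₁, so the metric may be changed outside it. -/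
theorem Mollification.bddAlong_testRicci_sub_principal (hg : IsLocLipCov g) (hl : IsLorentzian g)
    {α : ℕ} {y₁ : Model n} (hy₁ : y₁ ∈ (R.chart α).target) (he : Tendsto εf l (𝓝[>] 0))
    (hy : Tendsto yf l (𝓝 y₁)) (i j : Fin n) :
    BddAlong l fun p => R.testRicci g α (εf p) (yf p) i j
      - principal (comp (R.chart α) g (yf p))⁻¹ (fun a b r s =>
          pd a (pd b (R.convComp (εf p) g α r s)) (yf p)) i j := by
  choose c s hs hL using fun a b => lipAt_comp hg (R.chart_mem α) hy₁ a b
  have hint : (⋂ a, ⋂ b, s a b) ∩ (R.chart α).target ∈ 𝓝 y₁ :=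
    inter_mem (iInter_mem.2 fun a => iInter_mem.2 fun b => hs a b)
      ((R.chart α).open_target.mem_nhds hy₁)
  obtain ⟨r, hr, hrs⟩ := Metric.mem_nhds_iff.1 hint
  have hLr : ∀ a b, LipschitzOnWith (c a b) (fun z => comp (R.chart α) g z a b)
      (Metric.ball y₁ r) := fun a b => (hL a b).mono fun z hz =>
    mem_iInter.1 (mem_iInter.1 (hrs hz).1 a) b
  -- Each component is extended from the ball separately. Away from the ball the resulting matrix
  -- need be neither symmetric nor invertible.
  choose f hf hfe using fun a b => (hLr a b).extend_real
  set c' : NNReal := ∑ a, ∑ b, c a b with hc'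
  have hf' : ∀ a b, LipschitzWith c' (f a b) := fun a b => (hf a b).weaken
    ((Finset.single_le_sum (f := fun b => c a b) (fun _ _ => zero_le) (Finset.mem_univ b)).trans
      (Finset.single_le_sum (f := fun a => ∑ b, c a b) (fun _ _ => zero_le)
        (Finset.mem_univ a)))
  set G : Model n → Matrix (Fin n) (Fin n) ℝ := fun z => Matrix.of fun a b => f a b z with hGdef
  have hG : ∀ z ∈ Metric.ball y₁ r, comp (R.chart α) g z = G z := by
    intro z hz
    ext a b
    exact hfe a b hz
  have hd : (G y₁).det ≠ 0 := by
    rw [← hG y₁ (Metric.mem_ball_self hr)]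
    exact comp_det_ne_zero (R.chart_mem α) hl hy₁
  refine (bddAlong_distRicci_sub_principal (G := G) R.isKernel he hy hf' hd
    (R.contDiff_cut α) i j).congr ?_
  have hr2 : ∀ᶠ p in l, yf p ∈ Metric.ball y₁ (r / 2) :=
    hy (Metric.ball_mem_nhds _ (half_pos hr))
  have hr3 : ∀ᶠ p in l, εf p ∈ Ioo 0 (r / 2) := he (Ioo_mem_nhdsGT (half_pos hr))
  filter_upwards [hr2, hr3] with p hp2 hp3
  have hball : ∀ y ∈ Metric.ball y₁ (r / 2), Metric.closedBall y (εf p) ⊆ Metric.ball y₁ r := by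
    intro y hy z hz
    rw [Metric.mem_ball] at *
    rw [Metric.mem_closedBall] at hz
    linarith [dist_triangle z y y₁, hp3.2]
  have e1 : R.testRicci g α (εf p) (yf p) i j
      = distRicciCoord univ G i j (fun z => R.cut α z * scaled R.ρ (εf p) (yf p - z)) :=
    distRicciCoord_congr Metric.isOpen_ball (fun z hz => (hrs hz).2) hG
      ((R.tsupport_test_subset α hp3.1 _).trans (inter_subset_left.trans (hball _ hp2))) i j
  -- Equality is needed near the centre, not only at it, because it is differentiated twice. Centres
  -- within r/2 and ε < r/2 keep every mollification ball inside the ball of radius r.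
  have e2 : ∀ a b, R.convComp (εf p) g α a b =ᶠ[𝓝 (yf p)]
      moll R.ρ (εf p) fun z => R.cut α z * G z a b := by
    intro a b
    filter_upwards [Metric.isOpen_ball.mem_nhds hp2] with y hy
    rw [R.convComp_eq]
    refine moll_congr R.isKernel hp3.1 fun z hz => ?_
    rw [Mollification.loc, hG z (hball y hy (Metric.ball_subset_closedBall hz))]
  have e3 : ∀ a b c d, pd a (pd b (R.convComp (εf p) g α c d)) (yf p)
      = pd a (pd b (moll R.ρ (εf p) fun z => R.cut α z * G z c d)) (yf p) := fun a b c d =>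
    pd_congr (eventuallyEq_pd (e2 c d) b) a
  rw [e1, hG _ (Metric.ball_subset_ball (by linarith) hp2)]
  simp only [e3]

end RegularisedMetric

/-! ### Comparison of the Ricci tensor of the regularised metric with the mollified Ricci tensor -/

section FiniteSums

variable {n : ℕ} {ι κ : Type*} {l : Filter ι} {yf : ι → Model n} {y₀ : Model n} {T : Finset κ}
  {τ : κ → Model n → Model n} {c : κ → Model n → ℝ} {H : κ → ι → Model n → ℝ}
  {φ : ι → Model n → ℝ}

/-- The sums ∑ c_t · (H_t ∘ τ_t) model a component of the regularised metric: c_t is a product of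
Jacobian entries, τ_t a transition map, and H_t a mollified component. Only H_t depends on ε. -/
theorem eventually_contDiffAt_sum (hy : Tendsto yf l (𝓝 y₀))
    (hc : ∀ t ∈ T, ∀ᶠ z in 𝓝 y₀, ContDiffAt ℝ ∞ (c t) z)
    (hτ : ∀ t ∈ T, ∀ᶠ z in 𝓝 y₀, ContDiffAt ℝ ∞ (τ t) z)
    (hH : ∀ t ∈ T, ∀ᶠ p in l, ContDiff ℝ ∞ (H t p)) :
    ∀ᶠ p in l, ∀ᶠ z in 𝓝 (yf p), ∀ t ∈ T, ContDiffAt ℝ ∞ (fun z => c t z * H t p (τ t z)) z := by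
  have h1 : ∀ᶠ p in l, ∀ᶠ z in 𝓝 (yf p), ∀ t ∈ T, ContDiffAt ℝ ∞ (c t) z :=
    hy.eventually ((Filter.eventually_all_finset T).2 hc).eventually_nhds
  have h2 : ∀ᶠ p in l, ∀ᶠ z in 𝓝 (yf p), ∀ t ∈ T, ContDiffAt ℝ ∞ (τ t) z :=
    hy.eventually ((Filter.eventually_all_finset T).2 hτ).eventually_nhds
  filter_upwards [h1, h2, (Filter.eventually_all_finset T).2 hH] with p g1 g2 g3
  filter_upwards [g1, g2] with z k1 k2 t ht
  exact (k1 t ht).mul ((g3 t ht).contDiffAt.comp z (k2 t ht))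

theorem eventually_contDiffAt_of_sum (hy : Tendsto yf l (𝓝 y₀))
    (hc : ∀ t ∈ T, ∀ᶠ z in 𝓝 y₀, ContDiffAt ℝ ∞ (c t) z)
    (hτ : ∀ t ∈ T, ∀ᶠ z in 𝓝 y₀, ContDiffAt ℝ ∞ (τ t) z)
    (hH : ∀ t ∈ T, ∀ᶠ p in l, ContDiff ℝ ∞ (H t p))
    (hφ : ∀ᶠ p in l, φ p =ᶠ[𝓝 (yf p)] fun z => ∑ t ∈ T, c t z * H t p (τ t z)) :
    ∀ᶠ p in l, ContDiffAt ℝ ∞ (φ p) (yf p) := by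
  filter_upwards [hφ, eventually_contDiffAt_sum hy hc hτ hH] with p h1 h2
  exact (ContDiffAt.sum fun t ht => h2.self_of_nhds t ht).congr_of_eventuallyEq h1

theorem bddAlong_pd_of_sum (hy : Tendsto yf l (𝓝 y₀))
    (hc : ∀ t ∈ T, ∀ᶠ z in 𝓝 y₀, ContDiffAt ℝ ∞ (c t) z)
    (hτ : ∀ t ∈ T, ∀ᶠ z in 𝓝 y₀, ContDiffAt ℝ ∞ (τ t) z)
    (hH : ∀ t ∈ T, ∀ᶠ p in l, ContDiff ℝ ∞ (H t p))
    (hH0 : ∀ t ∈ T, BddAlong l fun p => H t p (τ t (yf p)))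
    (hH1 : ∀ t ∈ T, ∀ a, BddAlong l fun p => pd a (H t p) (τ t (yf p)))
    (hφ : ∀ᶠ p in l, φ p =ᶠ[𝓝 (yf p)] fun z => ∑ t ∈ T, c t z * H t p (τ t z)) (k : Fin n) :
    BddAlong l fun p => pd k (φ p) (yf p) := by
  refine (BddAlong.sum (s := T) fun t ht => bddAlong_pd_mul_comp hy (hc t ht) (hτ t ht) (hH t ht)
    (hH0 t ht) (hH1 t ht) k).congr ?_
  filter_upwards [hφ, eventually_contDiffAt_sum hy hc hτ hH] with p h1 h2
  rw [pd_congr h1, pd_sum fun t ht => differentiableAt_of_smooth (h2.self_of_nhds t ht)]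

theorem bddAlong_pd_pd_of_sum (hy : Tendsto yf l (𝓝 y₀))
    (hc : ∀ t ∈ T, ∀ᶠ z in 𝓝 y₀, ContDiffAt ℝ ∞ (c t) z)
    (hτ : ∀ t ∈ T, ∀ᶠ z in 𝓝 y₀, ContDiffAt ℝ ∞ (τ t) z)
    (hH : ∀ t ∈ T, ∀ᶠ p in l, ContDiff ℝ ∞ (H t p))
    (hH0 : ∀ t ∈ T, BddAlong l fun p => H t p (τ t (yf p)))
    (hH1 : ∀ t ∈ T, ∀ a, BddAlong l fun p => pd a (H t p) (τ t (yf p)))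
    (hφ : ∀ᶠ p in l, φ p =ᶠ[𝓝 (yf p)] fun z => ∑ t ∈ T, c t z * H t p (τ t z)) (p q : Fin n) :
    BddAlong l fun k => pd p (pd q (φ k)) (yf k) - ∑ t ∈ T, ∑ a, ∑ b,
      c t (yf k) * pd q (fun z => τ t z a) (yf k) * pd p (fun z => τ t z b) (yf k) *
        pd b (pd a (H t k)) (τ t (yf k)) := by
  refine (bddAlong_sum_sub (s := T) fun t ht => bddAlong_pd_pd_mul_comp hy (hc t ht) (hτ t ht)
    (hH t ht) (hH0 t ht) (hH1 t ht) p q).congr ?_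
  filter_upwards [hφ, eventually_contDiffAt_sum hy hc hτ hH] with k h1 h2
  have h3 : pd q (φ k) =ᶠ[𝓝 (yf k)] fun z => ∑ t ∈ T, pd q (fun z => c t z * H t k (τ t z)) z := by
    refine (eventuallyEq_pd h1 q).trans ?_
    filter_upwards [h2] with z hz
    exact pd_sum fun t ht => differentiableAt_of_smooth (hz t ht)
  rw [pd_congr h3, pd_sum fun t ht =>
    differentiableAt_of_smooth (contDiffAt_pd (h2.self_of_nhds t ht) q)]

/-- The Jacobian matrix. -/
def jac (τ : Model n → Model n) (y : Model n) : Matrix (Fin n) (Fin n) ℝ :=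
  Matrix.of fun a i => pd i (fun z => τ z a) y

theorem jac_apply (τ : Model n → Model n) (y : Model n) (a i : Fin n) :
    jac τ y a i = pd i (fun z => τ z a) y := rfl

theorem jac_det_ne_zero {τ : Model n → Model n} {y : Model n} (hτ : DifferentiableAt ℝ τ y)
    (h : Function.Injective (fderiv ℝ τ y)) : (jac τ y).det ≠ 0 := by
  intro h0
  obtain ⟨c, hc0, hc⟩ := Matrix.exists_mulVec_eq_zero_iff.2 h0
  apply hc0
  have h1 : fderiv ℝ τ y (WithLp.toLp 2 c) = 0 := by
    ext a
    rw [← fderiv_coord hτ, fderiv_apply_eq_sum_pd]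
    have := congrFun hc a
    simp only [Matrix.mulVec, dotProduct, jac_apply] at this
    simpa [mul_comm] using this
  have h2 := h (h1.trans (map_zero _).symm)
  simpa using congrArg WithLp.ofLp h2

theorem sum_eq_pull4 (A : Matrix (Fin n) (Fin n) ℝ) (S : Fin n → Fin n → Fin n → Fin n → ℝ)
    (p q r s : Fin n) : ∑ t : Fin n × Fin n, ∑ a, ∑ b,
      A t.1 r * A t.2 s * A a q * A b p * S b a t.1 t.2 = pull4 A S p q r s := by
  unfold pull4
  simp only [Fintype.sum_prod_type]
  rw [Finset.sum_congr rfl fun c _ => Finset.sum_congr rfl fun d _ => Finset.sum_comm,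
    Finset.sum_congr rfl fun c _ => Finset.sum_comm, Finset.sum_comm]
  refine Finset.sum_congr rfl fun b _ => ?_
  rw [Finset.sum_congr rfl fun c _ => Finset.sum_comm, Finset.sum_comm]
  exact Finset.sum_congr rfl fun a _ => Finset.sum_congr rfl fun c _ =>
    Finset.sum_congr rfl fun d _ => by ring

end FiniteSums

/-! ### The regularised metric near a point as a finite sum over charts. -/

section LocalRepresentation

variable {n : ℕ} {M : Type*} [TopologicalSpace M] [ChartedSpace (Model n) M]
  {R : Mollification n M} {g : CovTwo n M} {ε : ℕ → ℝ}

/-- Turns an identity valid for large k and nearby points into one that, at fixed k, holds on a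
neighbourhood of each such point and can therefore be differentiated. -/
theorem eventually_prod_eventually_nhds {X : Type*} [TopologicalSpace X] {x₀ : X}
    {P : ℕ × X → Prop} (h : ∀ᶠ p in atTop ×ˢ 𝓝 x₀, P p) :
    ∀ᶠ p in (atTop : Filter ℕ) ×ˢ 𝓝 x₀, ∀ᶠ z in 𝓝 p.2, P (p.1, z) := by
  obtain ⟨pa, ha, pb, hb, hab⟩ := eventually_prod_iff.1 h
  exact eventually_prod_iff.2 ⟨pa, ha, _, hb.eventually_nhds, fun hx _ hy =>
    hy.mono fun z hz => hab hx hz⟩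

theorem tendsto_eps (hε : ∀ k, 0 < ε k) (hε0 : Tendsto ε atTop (𝓝 0)) {X : Type*}
    (l : Filter X) : Tendsto (fun p : ℕ × X => ε p.1) (atTop ×ˢ l) (𝓝[>] 0) :=
  (tendsto_nhdsWithin_iff.2 ⟨hε0, Eventually.of_forall hε⟩).comp tendsto_fst

/-- Near a given point the regularisation is the sum over those charts whose partition function
does not vanish near the point, and the cut-off functions drop out. -/
theorem conv_eventually (hε : ∀ k, 0 < ε k) (hε0 : Tendsto ε atTop (𝓝 0)) (T : CovTwo n M)
    (x₀ : M) : ∀ᶠ p in (atTop : Filter ℕ) ×ˢ 𝓝 x₀,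
      R.conv (ε p.1) T p.2 = ∑ α ∈ R.ξ.fintsupport x₀, ∑ i, ∑ j,
        R.convComp (ε p.1) T α i j (R.chart α p.2) •
          (dcoord (R.chart α) p.2 i).smulRight (dcoord (R.chart α) p.2 j) := by
  obtain ⟨N, hN, hfin⟩ := R.locallyFinite x₀
  have h1 : ∀ᶠ p in (atTop : Filter ℕ) ×ˢ 𝓝 x₀, p.2 ∈ N := tendsto_snd.eventually hN
  have h2 : ∀ᶠ p in (atTop : Filter ℕ) ×ˢ 𝓝 x₀, ∀ α ∈ R.ξ.fintsupport x₀, R.χ α p.2 = 1 := by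
    refine (Filter.eventually_all_finset _).2 fun α hα => ?_
    have : ∀ᶠ x in 𝓝 x₀, R.χ α x = 1 :=
      (R.χ_eq_one α).filter_mono (nhds_le_nhdsSet ((R.ξ.mem_fintsupport_iff x₀ α).1 hα))
    exact tendsto_snd.eventually this
  -- For the remaining charts, either χ_α vanishes near x₀, or x₀ lies in the chart domain but off
  -- the closed support of ξ_α. In the latter case the mollifier meets only zeros once ε is small.
  have h3 : ∀ᶠ p in (atTop : Filter ℕ) ×ˢ 𝓝 x₀, ∀ α ∈ hfin.toFinset,
      α ∉ R.ξ.fintsupport x₀ → R.χ α p.2 = 0 ∨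
        ∀ i j, R.convComp (ε p.1) T α i j (R.chart α p.2) = 0 := by
    refine (Filter.eventually_all_finset _).2 fun α _ => ?_
    by_cases hα : α ∈ R.ξ.fintsupport x₀
    · exact Eventually.of_forall fun p h => absurd hα h
    by_cases hχ : x₀ ∈ tsupport (R.χ α)
    · have hx₀ := R.χ_support α hχ
      have hnot : R.chart α x₀ ∉ R.supp α := by
        rintro ⟨x, hx, hxx⟩
        rw [(R.chart α).injOn (R.subordinate α hx) hx₀ hxx] at hx
        exact hα ((R.ξ.mem_fintsupport_iff x₀ α).2 hx)
      have hy : Tendsto (fun p : ℕ × M => R.chart α p.2) (atTop ×ˢ 𝓝 x₀) (𝓝 (R.chart α x₀)) :=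
        ((R.chart α).continuousAt hx₀).tendsto.comp tendsto_snd
      filter_upwards [eventually_ball_subset (tendsto_eps hε hε0 _) hy
        (R.cut_eventuallyEq_zero hnot)] with p hp _
      refine Or.inr fun i j => ?_
      rw [R.convComp_eq]
      have : moll R.ρ (ε p.1) (R.loc T α i j) (R.chart α p.2)
          = moll R.ρ (ε p.1) (fun _ => 0) (R.chart α p.2) :=
        moll_congr R.isKernel hp.1 fun z hz => by
          have hz0 : R.cut α z = 0 := hp.2.2 (Metric.ball_subset_closedBall hz)
          simp [Mollification.loc, hz0]
      rw [this]; simp [moll]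
    · have : ∀ᶠ x in 𝓝 x₀, R.χ α x = 0 := notMem_tsupport_iff_eventuallyEq.1 hχ
      filter_upwards [tendsto_snd.eventually this] with p hp _ using Or.inl hp
  filter_upwards [h1, h2, h3] with p g1 g2 g3
  unfold Mollification.conv
  rw [finsum_eq_sum_of_support_subset (s := R.ξ.fintsupport x₀)]
  · exact Finset.sum_congr rfl fun α hα => by rw [g2 α hα, one_smul]
  · intro α hα
    by_contra hn
    apply hα
    by_cases hs : p.2 ∈ (R.chart α).source
    · have hmem : α ∈ hfin.toFinset := hfin.mem_toFinset.2 ⟨p.2, hs, g1⟩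
      rcases g3 α hmem hn with h | h
      · refine ContinuousLinearMap.ext fun v => ContinuousLinearMap.ext fun w => ?_
        simp only [_root_.smul_apply, h, zero_smul]
        rfl
      · refine ContinuousLinearMap.ext fun v => ContinuousLinearMap.ext fun w => ?_
        simp only [_root_.smul_apply, _root_.sum_apply, h, zero_smul, Finset.sum_const_zero,
          smul_zero]
        rfl
    · have : R.χ α p.2 = 0 :=
        image_eq_zero_of_notMem_tsupport fun h => hs (R.χ_support α h)
      refine ContinuousLinearMap.ext fun v => ContinuousLinearMap.ext fun w => ?_
      simp only [_root_.smul_apply, this, zero_smul]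
      rfl

variable {e : OpenPartialHomeomorph M (Model n)}

theorem mem_source_of_mem_fintsupport {x₀ : M} {α : ℕ} (hα : α ∈ R.ξ.fintsupport x₀) :
    x₀ ∈ (R.chart α).source := R.subordinate α ((R.ξ.mem_fintsupport_iff x₀ α).1 hα)

theorem eventually_mem_sources {x₀ : M} (hx₀ : x₀ ∈ e.source) : ∀ᶠ y in 𝓝 (e x₀), y ∈ e.target ∧
    ∀ α ∈ R.ξ.fintsupport x₀, e.symm y ∈ (R.chart α).source := by
  have h1 := e.open_target.mem_nhds (e.map_source hx₀)
  have h2 : Tendsto e.symm (𝓝 (e x₀)) (𝓝 x₀) := e.tendsto_symm hx₀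
  refine Filter.Eventually.and h1 ((Filter.eventually_all_finset _).2 fun α hα => ?_)
  exact h2.eventually ((R.chart α).open_source.mem_nhds (mem_source_of_mem_fintsupport hα))

theorem comp_conv_eventually (he : e ∈ IsManifold.maximalAtlas (𝓡 n) ∞ M)
    (hε : ∀ k, 0 < ε k) (hε0 : Tendsto ε atTop (𝓝 0)) (T : CovTwo n M)
    {x₀ : M} (hx₀ : x₀ ∈ e.source) : ∀ᶠ p in (atTop : Filter ℕ) ×ˢ 𝓝 (e x₀), ∀ i j,
      comp e (R.conv (ε p.1) T) p.2 i j = ∑ α ∈ R.ξ.fintsupport x₀, ∑ a, ∑ b,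
        R.convComp (ε p.1) T α a b (transition e (R.chart α) p.2)
          * jac (transition e (R.chart α)) p.2 a i * jac (transition e (R.chart α)) p.2 b j := by
  have h1 : Tendsto (fun p : ℕ × Model n => (p.1, e.symm p.2)) (atTop ×ˢ 𝓝 (e x₀))
      (atTop ×ˢ 𝓝 x₀) := tendsto_fst.prodMk ((e.tendsto_symm hx₀).comp tendsto_snd)
  filter_upwards [h1.eventually (conv_eventually hε hε0 T x₀),
    tendsto_snd.eventually (eventually_mem_sources (R := R) hx₀)] with p g1 g2 i j
  have g3 : comp e (R.conv (ε p.1) T) p.2 i j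
      = R.conv (ε p.1) T (e.symm p.2) (coordVec e p.2 i) (coordVec e p.2 j) := rfl
  rw [g3, g1]
  simp only [_root_.sum_apply, _root_.smul_apply, ContinuousLinearMap.smulRight_apply, smul_eq_mul]
  refine Finset.sum_congr rfl fun α hα => Finset.sum_congr rfl fun a _ =>
    Finset.sum_congr rfl fun b _ => ?_
  rw [dcoord_coordVec he (R.chart_mem α) g2.1 (g2.2 α hα),
    dcoord_coordVec he (R.chart_mem α) g2.1 (g2.2 α hα), jac_apply, jac_apply, transition]
  ring

/-- The unmollified counterpart: because the ξ_α sum to 1, g has the same local expansion with the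
same index set and Jacobians, and can be compared with the regularisation term by term. -/
theorem comp_eventually (he : e ∈ IsManifold.maximalAtlas (𝓡 n) ∞ M) (T : CovTwo n M)
    {x₀ : M} (hx₀ : x₀ ∈ e.source) : ∀ᶠ y in 𝓝 (e x₀), ∀ i j,
      comp e T y i j = ∑ α ∈ R.ξ.fintsupport x₀, ∑ a, ∑ b,
        R.loc T α a b (transition e (R.chart α) y)
          * jac (transition e (R.chart α)) y a i * jac (transition e (R.chart α)) y b j := by
  filter_upwards [eventually_mem_sources (R := R) hx₀, (e.tendsto_symm hx₀).eventually
    (R.ξ.eventually_finsupport_subset x₀)] with y g1 g2 i j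
  have h1 : ∑ α ∈ R.ξ.fintsupport x₀, R.ξ α (e.symm y) = 1 := by
    rw [← R.ξ.sum_finsupport (e.symm y) (mem_univ _)]
    refine (Finset.sum_subset g2 fun α _ hα => ?_).symm
    by_contra h
    exact hα ((R.ξ.mem_finsupport _).2 h)
  rw [← one_mul (comp e T y i j), ← h1, Finset.sum_mul]
  refine Finset.sum_congr rfl fun α hα => ?_
  have hs := g1.2 α hα
  have hcut : R.cut α (transition e (R.chart α) y) = R.ξ α (e.symm y) := by
    rw [transition, R.cut_of_mem ((R.chart α).map_source hs), (R.chart α).left_inv hs]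
  rw [comp_transform he (R.chart_mem α) T g1.1 hs]
  simp only [Finset.mul_sum, Mollification.loc, hcut, jac_apply]
  exact Finset.sum_congr rfl fun a _ => Finset.sum_congr rfl fun b _ => by ring

end LocalRepresentation

/-! ### The commutator estimate for the Ricci tensor of the regularised metric. -/

section Comparison

variable {n : ℕ} {M : Type*} [TopologicalSpace M] [ChartedSpace (Model n) M]
  {R : Mollification n M} {g : CovTwo n M} {ε : ℕ → ℝ} {e : OpenPartialHomeomorph M (Model n)}
  {x₀ : M}

/-- The second derivatives of the mollified components in the chart `ψ_α`. -/
def Mollification.hess (R : Mollification n M) (g : CovTwo n M) (α : ℕ) (ε : ℝ) (y : Model n)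
    (a b c d : Fin n) : ℝ :=
  pd a (pd b (R.convComp ε g α c d)) y

theorem tendsto_transition {α : ℕ} (hx₀ : x₀ ∈ e.source) (hα : α ∈ R.ξ.fintsupport x₀) :
    Tendsto (fun p : ℕ × Model n => transition e (R.chart α) p.2) (atTop ×ˢ 𝓝 (e x₀))
      (𝓝 (R.chart α x₀)) :=
  (((R.chart α).continuousAt (mem_source_of_mem_fintsupport hα)).tendsto.comp
    (e.tendsto_symm hx₀)).comp tendsto_snd

theorem eventually_contDiffAt_transition (he : e ∈ IsManifold.maximalAtlas (𝓡 n) ∞ M)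
    {α : ℕ} (hx₀ : x₀ ∈ e.source) (hα : α ∈ R.ξ.fintsupport x₀) :
    ∀ᶠ z in 𝓝 (e x₀), ContDiffAt ℝ ∞ (transition e (R.chart α)) z :=
  (eventually_mem_sources (R := R) hx₀).mono fun _ hz =>
    contDiffAt_transition he (R.chart_mem α) hz.1 (hz.2 α hα)

theorem eventually_contDiffAt_jac (he : e ∈ IsManifold.maximalAtlas (𝓡 n) ∞ M)
    {α : ℕ} (hx₀ : x₀ ∈ e.source) (hα : α ∈ R.ξ.fintsupport x₀) (a i : Fin n) :
    ∀ᶠ z in 𝓝 (e x₀), ContDiffAt ℝ ∞ (fun z => jac (transition e (R.chart α)) z a i) z :=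
  (eventually_contDiffAt_transition he hx₀ hα).mono fun _ hz =>
    contDiffAt_pd (contDiffAt_coord hz a) i

theorem bddAlong_jac (he : e ∈ IsManifold.maximalAtlas (𝓡 n) ∞ M)
    {α : ℕ} (hx₀ : x₀ ∈ e.source) (hα : α ∈ R.ξ.fintsupport x₀) (a i : Fin n) :
    BddAlong ((atTop : Filter ℕ) ×ˢ 𝓝 (e x₀)) fun p =>
      jac (transition e (R.chart α)) p.2 a i :=
  bddAlong_of_smooth tendsto_snd (eventually_contDiffAt_jac he hx₀ hα a i).self_of_nhds

theorem comp_conv_eventuallyEq (he : e ∈ IsManifold.maximalAtlas (𝓡 n) ∞ M)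
    (hε : ∀ k, 0 < ε k) (hε0 : Tendsto ε atTop (𝓝 0)) (T : CovTwo n M)
    (hx₀ : x₀ ∈ e.source) (i j : Fin n) : ∀ᶠ p in (atTop : Filter ℕ) ×ˢ 𝓝 (e x₀),
      (fun z => comp e (R.conv (ε p.1) T) z i j) =ᶠ[𝓝 p.2] fun z =>
        ∑ t ∈ R.ξ.fintsupport x₀ ×ˢ (Finset.univ : Finset (Fin n × Fin n)),
          (jac (transition e (R.chart t.1)) z t.2.1 i *
            jac (transition e (R.chart t.1)) z t.2.2 j) *
          R.convComp (ε p.1) T t.1 t.2.1 t.2.2 (transition e (R.chart t.1) z) := by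
  filter_upwards [eventually_prod_eventually_nhds (comp_conv_eventually he hε hε0 T hx₀)] with p hp
  filter_upwards [hp] with z hz
  rw [hz i j, Finset.sum_product]
  refine Finset.sum_congr rfl fun α _ => ?_
  rw [Fintype.sum_prod_type]
  exact Finset.sum_congr rfl fun a _ => Finset.sum_congr rfl fun b _ => by ring

theorem comp_conv_sub_isBigO (he : e ∈ IsManifold.maximalAtlas (𝓡 n) ∞ M) (hg : IsLocLipCov g)
    (hε : ∀ k, 0 < ε k) (hε0 : Tendsto ε atTop (𝓝 0)) (hx₀ : x₀ ∈ e.source) (i j : Fin n) :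
    (fun p : ℕ × Model n => comp e (R.conv (ε p.1) g) p.2 i j - comp e g p.2 i j)
      =O[atTop ×ˢ 𝓝 (e x₀)] fun p => ε p.1 := by
  have key : (fun p : ℕ × Model n => ∑ α ∈ R.ξ.fintsupport x₀, ∑ a, ∑ b,
      (R.convComp (ε p.1) g α a b (transition e (R.chart α) p.2)
        - R.loc g α a b (transition e (R.chart α) p.2)) *
        (jac (transition e (R.chart α)) p.2 a i * jac (transition e (R.chart α)) p.2 b j))
      =O[atTop ×ˢ 𝓝 (e x₀)] fun p => ε p.1 := by
    refine Asymptotics.IsBigO.fun_sum fun α hα => Asymptotics.IsBigO.fun_sum fun a _ =>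
      Asymptotics.IsBigO.fun_sum fun b _ => ?_
    obtain ⟨c, s, hs, hL⟩ := Mollification.lipAt_loc (R := R) hg α a b (R.chart α x₀)
    have h1 := R.isKernel.moll_sub_isBigO_of_integral R.ρ_integral
      (tendsto_eps hε hε0 (𝓝 (e x₀))) (tendsto_transition hx₀ hα)
      (Mollification.continuous_loc hg α a b) hs hL
    have h2 := (bddAlong_jac he hx₀ hα a i).mul (bddAlong_jac he hx₀ hα b j)
    simpa [Mollification.convComp_eq] using h1.mul h2
  refine key.congr' ?_ EventuallyEq.rfl
  filter_upwards [comp_conv_eventually he hε hε0 g hx₀,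
    tendsto_snd.eventually (comp_eventually (R := R) he g hx₀)] with p h1 h2
  rw [h1 i j, h2 i j]
  simp only [← Finset.sum_sub_distrib]
  exact Finset.sum_congr rfl fun α _ => Finset.sum_congr rfl fun a _ =>
    Finset.sum_congr rfl fun b _ => by ring

theorem tendsto_comp (he : e ∈ IsManifold.maximalAtlas (𝓡 n) ∞ M) (hg : IsLocLipCov g)
    (hx₀ : x₀ ∈ e.source) (i j : Fin n) :
    Tendsto (fun p : ℕ × Model n => comp e g p.2 i j) (atTop ×ˢ 𝓝 (e x₀))
      (𝓝 (comp e g (e x₀) i j)) :=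
  (lipAt_comp hg he (e.map_source hx₀) i j).continuousAt.tendsto.comp tendsto_snd

theorem tendsto_comp_conv (he : e ∈ IsManifold.maximalAtlas (𝓡 n) ∞ M) (hg : IsLocLipCov g)
    (hε : ∀ k, 0 < ε k) (hε0 : Tendsto ε atTop (𝓝 0)) (hx₀ : x₀ ∈ e.source) (i j : Fin n) :
    Tendsto (fun p : ℕ × Model n => comp e (R.conv (ε p.1) g) p.2 i j) (atTop ×ˢ 𝓝 (e x₀))
      (𝓝 (comp e g (e x₀) i j)) := by
  have h1 := (comp_conv_sub_isBigO (R := R) he hg hε hε0 hx₀ i j).trans_tendsto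
    (hε0.comp tendsto_fst)
  simpa using h1.add (tendsto_comp he hg hx₀ i j)

variable (R) in
/-- The Ricci tensor of the regularised metric differs from the mollified distributional Ricci
tensor by a locally bounded term. -/
theorem bddAlong_ricciCoord_conv_sub (he : e ∈ IsManifold.maximalAtlas (𝓡 n) ∞ M)
    (hg : IsLocLipCov g) (hl : IsLorentzian g) (hε : ∀ k, 0 < ε k)
    (hε0 : Tendsto ε atTop (𝓝 0)) (hx₀ : x₀ ∈ e.source) (i j : Fin n) :
    BddAlong (atTop ×ˢ 𝓝 (e x₀)) fun p : ℕ × Model n =>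
      ricciCoord (comp e (R.conv (ε p.1) g)) i j p.2
      - ∑ α ∈ R.ξ.fintsupport x₀, ∑ a, ∑ b,
        R.testRicci g α (ε p.1) (transition e (R.chart α) p.2) a b *
          jac (transition e (R.chart α)) p.2 a i * jac (transition e (R.chart α)) p.2 b j := by
  set l : Filter (ℕ × Model n) := atTop ×ˢ 𝓝 (e x₀) with hl_def
  have heps : Tendsto (fun p : ℕ × Model n => ε p.1) l (𝓝[>] 0) := tendsto_eps hε hε0 _
  have hpos : ∀ᶠ p in l, 0 < ε p.1 := Eventually.of_forall fun p => hε _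
  have hsnd : Tendsto (fun p : ℕ × Model n => p.2) l (𝓝 (e x₀)) := tendsto_snd
  set T := R.ξ.fintsupport x₀ ×ˢ (Finset.univ : Finset (Fin n × Fin n)) with hT
  have hmem : ∀ t ∈ T, t.1 ∈ R.ξ.fintsupport x₀ := fun t ht => (Finset.mem_product.1 ht).1
  choose c s hs hL using fun α a b => Mollification.lipAt_loc (R := R) hg α a b (R.chart α x₀)
  have hc : ∀ i j, ∀ t ∈ T, ∀ᶠ z in 𝓝 (e x₀), ContDiffAt ℝ ∞ (fun z =>
      jac (transition e (R.chart t.1)) z t.2.1 i *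
        jac (transition e (R.chart t.1)) z t.2.2 j) z := fun i j t ht =>
    ((eventually_contDiffAt_jac he hx₀ (hmem t ht) t.2.1 i).and
      (eventually_contDiffAt_jac he hx₀ (hmem t ht) t.2.2 j)).mono fun z hz => hz.1.mul hz.2
  have hτ : ∀ t ∈ T, ∀ᶠ z in 𝓝 (e x₀), ContDiffAt ℝ ∞ (transition e (R.chart t.1)) z :=
    fun t ht => eventually_contDiffAt_transition he hx₀ (hmem t ht)
  have hH : ∀ t ∈ T, ∀ᶠ p in l, ContDiff ℝ ∞ (R.convComp (ε p.1) g t.1 t.2.1 t.2.2) :=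
    fun t _ => Eventually.of_forall fun p => by
      rw [R.convComp_eq]
      exact R.isKernel.contDiff_moll (hε _) (Mollification.continuous_loc hg _ _ _)
  have hH0 : ∀ t ∈ T, BddAlong l fun p => R.convComp (ε p.1) g t.1 t.2.1 t.2.2
      (transition e (R.chart t.1) p.2) := fun t ht => by
    have h1 := R.isKernel.moll_sub_isBigO_of_integral R.ρ_integral heps
      (tendsto_transition hx₀ (hmem t ht)) (Mollification.continuous_loc hg t.1 t.2.1 t.2.2)
      (hs _ _ _) (hL _ _ _)
    have h2 := (Mollification.lipAt_loc (R := R) hg t.1 t.2.1 t.2.2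
      (R.chart t.1 x₀)).continuousAt.tendsto.comp (tendsto_transition hx₀ (hmem t ht))
    have h3 := (h1.trans_tendsto (hε0.comp tendsto_fst)).add h2
    simp only [Mollification.convComp_eq]
    exact bddAlong_of_tendsto (h3.congr fun p => by simp)
  have hH1 : ∀ t ∈ T, ∀ a, BddAlong l fun p => pd a (R.convComp (ε p.1) g t.1 t.2.1 t.2.2)
      (transition e (R.chart t.1) p.2) := fun t ht a => by
    simp only [Mollification.convComp_eq]
    exact R.isKernel.bddAlong_pd_moll heps (tendsto_transition hx₀ (hmem t ht))
      (Mollification.continuous_loc hg _ _ _) (hs _ _ _) (hL _ _ _) a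
  have hH2 : ∀ t ∈ T, ∀ a b, (fun p : ℕ × Model n => R.hess g t.1 (ε p.1)
      (transition e (R.chart t.1) p.2) a b t.2.1 t.2.2) =O[l] fun p => (ε p.1)⁻¹ :=
    fun t ht a b => by
      simp only [Mollification.hess, Mollification.convComp_eq]
      exact R.isKernel.pd_pd_moll_isBigO heps (tendsto_transition hx₀ (hmem t ht))
        (Mollification.continuous_loc hg _ _ _) (hs _ _ _) (hL _ _ _) a b
  have hφ := fun i j => comp_conv_eventuallyEq (R := R) he hε hε0 g hx₀ i j
  have hd0 := comp_det_ne_zero he hl (e.map_source hx₀)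
  have hGt := fun i j => tendsto_comp_conv (R := R) he hg hε hε0 hx₀ i j
  have hdet := eventually_det_ne_zero hGt hd0
  have hdet' := eventually_det_ne_zero (fun i j => tendsto_comp he hg hx₀ i j) hd0
  have hinv := fun i j => bddAlong_of_tendsto (tendsto_inv_apply hGt hd0 i j)
  have hinv' := fun i j => bddAlong_of_tendsto
    (tendsto_inv_apply (fun i j => tendsto_comp he hg hx₀ i j) hd0 i j)
  have hsmooth : ∀ᶠ p in l, ∀ i j, ContDiffAt ℝ ∞
      (fun z => comp e (R.conv (ε p.1) g) z i j) p.2 :=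
    eventually_all.2 fun i => eventually_all.2 fun j =>
      eventually_contDiffAt_of_sum (H := fun (t : ℕ × Fin n × Fin n) (p : ℕ × Model n) =>
        R.convComp (ε p.1) g t.1 t.2.1 t.2.2) hsnd (hc i j) hτ hH (hφ i j)
  have hpd : ∀ k i j, BddAlong l fun p =>
      pd k (fun z => comp e (R.conv (ε p.1) g) z i j) p.2 := fun k i j =>
    bddAlong_pd_of_sum (H := fun (t : ℕ × Fin n × Fin n) (p : ℕ × Model n) =>
        R.convComp (ε p.1) g t.1 t.2.1 t.2.2) hsnd (hc i j) hτ hH hH0 hH1 (hφ i j) k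
  -- P collects the second derivatives in the charts ψ_α, pulled back to e as if they formed
  -- tensors. The trivial factor 1 matches the shape of `principal_sum`.
  set P : ℕ × Model n → Fin n → Fin n → Fin n → Fin n → ℝ := fun p a b r s =>
    ∑ α ∈ R.ξ.fintsupport x₀, 1 * pull4 (jac (transition e (R.chart α)) p.2)
      (R.hess g α (ε p.1) (transition e (R.chart α) p.2)) a b r s with hP
  have hPsum : ∀ p a b r s, P p a b r s = ∑ t ∈ T, ∑ a', ∑ b',
      (jac (transition e (R.chart t.1)) p.2 t.2.1 r *
        jac (transition e (R.chart t.1)) p.2 t.2.2 s) *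
        jac (transition e (R.chart t.1)) p.2 a' b * jac (transition e (R.chart t.1)) p.2 b' a *
        R.hess g t.1 (ε p.1) (transition e (R.chart t.1) p.2) b' a' t.2.1 t.2.2 := by
    intro p a b r s
    rw [Finset.sum_product]
    exact Finset.sum_congr rfl fun α _ => by rw [one_mul, ← sum_eq_pull4]
  have hsecond : ∀ a b r s, BddAlong l fun p =>
      secondPd (comp e (R.conv (ε p.1) g)) p.2 a b r s - P p a b r s := by
    intro a b r s
    simp only [hPsum]
    exact bddAlong_pd_pd_of_sum (H := fun (t : ℕ × Fin n × Fin n) (p : ℕ × Model n) =>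
        R.convComp (ε p.1) g t.1 t.2.1 t.2.2) hsnd (hc r s) hτ hH hH0 hH1 (hφ r s) a b
  have hPO : ∀ a b r s, (fun p => P p a b r s) =O[l] fun p => (ε p.1)⁻¹ := by
    intro a b r s
    simp only [hPsum]
    refine Asymptotics.IsBigO.fun_sum fun t ht => Asymptotics.IsBigO.fun_sum fun a' _ =>
      Asymptotics.IsBigO.fun_sum fun b' _ => ?_
    have hJ := fun a i => bddAlong_jac he hx₀ (hmem t ht) a i
    have := Asymptotics.IsBigO.mul (((hJ t.2.1 r).mul (hJ t.2.2 s)).mul (hJ a' b) |>.mul (hJ b' a))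
      (hH2 t ht b' a')
    simpa using this
  -- The metrics differ by O(ε) and both inverses are bounded, so the resolvent identity gives O(ε)
  -- for the inverses.
  have hinvO : ∀ a b, (fun p : ℕ × Model n => (comp e (R.conv (ε p.1) g) p.2)⁻¹ a b
      - (comp e g p.2)⁻¹ a b) =O[l] fun p => ε p.1 := by
    intro a b
    have h1 : (fun p : ℕ × Model n => ∑ d, (∑ c, (comp e (R.conv (ε p.1) g) p.2)⁻¹ a c *
        (comp e g p.2 c d - comp e (R.conv (ε p.1) g) p.2 c d)) * (comp e g p.2)⁻¹ d b)
        =O[l] fun p => ε p.1 := by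
      refine Asymptotics.IsBigO.fun_sum fun d _ => ?_
      have h2 : (fun p : ℕ × Model n => ∑ c, (comp e (R.conv (ε p.1) g) p.2)⁻¹ a c *
        (comp e g p.2 c d - comp e (R.conv (ε p.1) g) p.2 c d)) =O[l] fun p => ε p.1 := by
        refine Asymptotics.IsBigO.fun_sum fun c _ => ?_
        have h3 := (comp_conv_sub_isBigO (R := R) he hg hε hε0 hx₀ c d).neg_left
        simpa using Asymptotics.IsBigO.mul (hinv a c) h3
      simpa using h2.mul (hinv' d b)
    refine h1.congr' ?_ EventuallyEq.rfl
    filter_upwards [hdet, hdet'] with p hp hp'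
    exact (inv_sub_inv_apply hp hp' a b).symm
  -- Three successive replacements, each with bounded error: Ricci by its principal part, the true
  -- second derivatives by P, and the inverse of the regularised metric by that of g. The last error
  -- is O(ε)·O(1/ε).
  have s1 := bddAlong_ricciCoord_sub_principal (yf := fun p : ℕ × Model n => p.2)
    hsmooth hdet hinv hpd i j
  have s2 := bddAlong_principal_sub_right hinv hsecond i j
  have s3 := bddAlong_principal_sub_left (S := P) (fun a b c d i j =>
    BddAlong.mul_of_isBigO hpos (hinvO i j) (hPO a b c d)) i j
  refine bddAlong_sub_trans s1 (bddAlong_sub_trans s2 (bddAlong_sub_trans s3 ?_))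
  have s4 : BddAlong l fun p => (∑ α ∈ R.ξ.fintsupport x₀, ∑ a, ∑ b,
        principal (comp (R.chart α) g (transition e (R.chart α) p.2))⁻¹
          (R.hess g α (ε p.1) (transition e (R.chart α) p.2)) a b *
          jac (transition e (R.chart α)) p.2 a i * jac (transition e (R.chart α)) p.2 b j)
      - ∑ α ∈ R.ξ.fintsupport x₀, ∑ a, ∑ b,
        R.testRicci g α (ε p.1) (transition e (R.chart α) p.2) a b *
          jac (transition e (R.chart α)) p.2 a i * jac (transition e (R.chart α)) p.2 b j := by
    refine bddAlong_sum_sub fun α hα => bddAlong_sum_sub fun a _ => bddAlong_sum_sub fun b _ => ?_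
    have h1 : BddAlong l fun p => R.testRicci g α (ε p.1) (transition e (R.chart α) p.2) a b
        - principal (comp (R.chart α) g (transition e (R.chart α) p.2))⁻¹
          (R.hess g α (ε p.1) (transition e (R.chart α) p.2)) a b :=
      Mollification.bddAlong_testRicci_sub_principal hg hl
        ((R.chart α).map_source (mem_source_of_mem_fintsupport hα)) heps
        (tendsto_transition hx₀ hα) a b
    refine (((bddAlong_sub_symm h1).mul (bddAlong_jac he hx₀ hα a i)).mul
      (bddAlong_jac he hx₀ hα b j)).congr (Eventually.of_forall fun p => ?_)
    ring
  refine s4.congr ?_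
  filter_upwards [hsnd.eventually (eventually_mem_sources (R := R) hx₀)] with p hp
  congr 1
  -- With the inverse of g itself as coefficient, naturality applies chart by chart: the coefficient
  -- is exactly the pull-back from ψ_α, which was not so for the regularised metric.
  rw [hP, principal_sum]
  refine Finset.sum_congr rfl fun α hα => ?_
  have hA : (jac (transition e (R.chart α)) p.2).det ≠ 0 :=
    jac_det_ne_zero (differentiableAt_of_smooth
      (contDiffAt_transition he (R.chart_mem α) hp.1 (hp.2 α hα)))
      (fderiv_transition_bijective he (R.chart_mem α) hp.1 (hp.2 α hα)).1
  rw [one_mul]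
  exact (principal_pull4 hA (comp_transform he (R.chart_mem α) g hp.1 (hp.2 α hα)) _ i j).symm

end Comparison

/-! ### Timelike vectors and timelike extensions of constant vector fields -/

section Lorentz

variable {n : ℕ} {M : Type*} [TopologicalSpace M] [ChartedSpace (Model n) M] {g : CovTwo n M}

/-- Orthogonal timelike X and T would span a negative definite plane, which must meet the positive
definite hyperplane v^⊥. The vector w = g(v,T)X - g(v,X)T lies in both; if w = 0, then g(v,T) = 0
and T itself lies in v^⊥. -/
theorem IsLorentzian.apply_ne_zero (hg : IsLorentzian g) {x : M} {X T : TangentSpace (𝓡 n) x}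
    (hX : g x X X < 0) (hT : g x T T < 0) : g x X T ≠ 0 := by
  intro h0
  obtain ⟨hs, v, hv, hpos⟩ := hg x
  have h0' : g x T X = 0 := (hs T X).trans h0
  set a := g x v T
  set b := g x v X
  set w := a • X - b • T with hw
  have hvw : g x v w = 0 := by
    rw [hw, map_sub, map_smul, map_smul, smul_eq_mul, smul_eq_mul]
    change a * b - b * a = 0
    ring
  by_cases hw0 : w = 0
  · have h1 : g x X w = a * g x X X := by
      rw [hw, map_sub, map_smul, map_smul, h0, smul_eq_mul, smul_zero, sub_zero]
    rw [hw0, map_zero] at h1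
    have ha : a = 0 := by
      rcases mul_eq_zero.1 h1.symm with h | h
      · exact h
      · exact absurd h hX.ne
    have hT0 : T ≠ 0 := by
      rintro rfl
      rw [map_zero] at hT
      exact lt_irrefl _ hT
    exact (hpos T ha hT0).not_gt hT
  · have h1 := hpos w hvw hw0
    have h2 : g x w w = a ^ 2 * g x X X + b ^ 2 * g x T T := by
      rw [hw]
      simp only [map_sub, map_smul, _root_.sub_apply, _root_.smul_apply, smul_eq_mul, h0, h0']
      ring
    nlinarith [mul_nonneg (sq_nonneg a) (neg_nonneg.2 hX.le),
      mul_nonneg (sq_nonneg b) (neg_nonneg.2 hT.le)]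

/-- Convexity of a half cone: when g(X,T) < 0 every term of the expanded square is nonpositive, and
one of the two pure squares is strictly negative. -/
theorem apply_convexComb_neg {x : M} (hs : ∀ v w, g x v w = g x w v)
    {X T : TangentSpace (𝓡 n) x} (hX : g x X X < 0)
    (hT : g x T T < 0) (hXT : g x X T < 0) {b : ℝ} (hb0 : 0 ≤ b) (hb1 : b ≤ 1) :
    g x (b • X + (1 - b) • T) (b • X + (1 - b) • T) < 0 := by
  have h1 : g x (b • X + (1 - b) • T) (b • X + (1 - b) • T)
      = b ^ 2 * g x X X + 2 * b * (1 - b) * g x X T + (1 - b) ^ 2 * g x T T := by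
    simp only [map_add, map_smul, _root_.add_apply, _root_.smul_apply, smul_eq_mul, hs T X]
    ring
  rw [h1]
  have h2 : 2 * b * (1 - b) * g x X T ≤ 0 :=
    mul_nonpos_of_nonneg_of_nonpos (by nlinarith) hXT.le
  rcases eq_or_lt_of_le hb0 with rfl | hb
  · simpa using hT
  · have h3 : b ^ 2 * g x X X < 0 := mul_neg_of_pos_of_neg (by positivity) hX
    have h4 : (1 - b) ^ 2 * g x T T ≤ 0 := mul_nonpos_of_nonneg_of_nonpos (sq_nonneg _) hT.le
    linarith

variable {e : OpenPartialHomeomorph M (Model n)}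

theorem isInvertible_mfderiv_chart (he : e ∈ IsManifold.maximalAtlas (𝓡 n) ∞ M) {x : M}
    (hx : x ∈ e.source) : (mfderiv (𝓡 n) (𝓡 n) e x).IsInvertible := by
  have h : e.MDifferentiable (𝓡 n) (𝓡 n) :=
    ⟨(contMDiffOn_of_mem_maximalAtlas he).mdifferentiableOn (by simp),
      (contMDiffOn_symm_of_mem_maximalAtlas he).mdifferentiableOn (by simp)⟩
  exact ⟨h.mfderiv hx, rfl⟩

/-- The vector field with constant components `V` in the chart `e`. -/
def constField (e : OpenPartialHomeomorph M (Model n)) (V : Model n) : VecField n M :=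
  VectorField.mpullback (𝓡 n) (𝓡 n) e (fun _ => V)

theorem dcoord_constField (he : e ∈ IsManifold.maximalAtlas (𝓡 n) ∞ M) (V : Model n) {x : M}
    (hx : x ∈ e.source) (i : Fin n) : dcoord e x i (constField e V x) = V i := by
  have h := (isInvertible_mfderiv_chart he hx).self_apply_inverse V
  exact congrArg (fun w : Model n => w i) h

theorem contMDiffOn_constField [IsManifold (𝓡 n) ∞ M]
    (he : e ∈ IsManifold.maximalAtlas (𝓡 n) ∞ M) (V : Model n) :
    ContMDiffOn (𝓡 n) (𝓡 n).tangent ∞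
      (fun x => (⟨x, constField e V x⟩ : TangentBundle (𝓡 n) M)) e.source := by
  have : IsManifold (𝓡 n) 1 M := IsManifold.of_le (n := ∞) ENat.LEInfty.out
  intro x hx
  refine ContMDiffAt.contMDiffWithinAt ?_
  refine ContMDiffAt.mpullback_vectorField_preimage (n := ∞) ?_ (contMDiffAt_chart he hx)
    (isInvertible_mfderiv_chart he hx) (by simp)
  exact (contMDiffAt_vectorSpace_iff_contDiffAt (V := fun _ => V)).2 contDiffAt_const

theorem continuousOn_vecComp [IsManifold (𝓡 n) ∞ M]
    (he : e ∈ IsManifold.maximalAtlas (𝓡 n) ∞ M) {T : VecField n M} (hT : IsSmoothVec T)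
    (i : Fin n) : ContinuousOn (vecComp e T i) e.target := by
  have : IsManifold (𝓡 n) 1 M := IsManifold.of_le (n := ∞) ENat.LEInfty.out
  have h1 := (contMDiffOn_of_mem_maximalAtlas he).continuousOn_tangentMapWithin (n := ∞)
    (by simp) e.open_source.uniqueMDiffOn
  have h2 : ContinuousOn (fun y => (⟨e.symm y, T (e.symm y)⟩ : TangentBundle (𝓡 n) M)) e.target :=
    hT.continuous.comp_continuousOn e.continuousOn_symm
  have h3 := h1.comp h2 fun y hy => e.map_target hy
  have h4 := (contMDiff_snd_tangentBundle_modelSpace (n := 0) (Model n) (𝓡 n)).continuous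
  have h5 := (EuclideanSpace.proj i : Model n →L[ℝ] ℝ).continuous.comp_continuousOn
    (h4.comp_continuousOn h3)
  refine h5.congr fun y hy => ?_
  have h6 : mfderivWithin (𝓡 n) (𝓡 n) e e.source (e.symm y) = mfderiv (𝓡 n) (𝓡 n) e (e.symm y) :=
    mfderivWithin_of_isOpen e.open_source (e.map_target hy)
  exact congrArg (fun L : TangentSpace (𝓡 n) (e.symm y) →L[ℝ] Model n => L (T (e.symm y)) i)
    h6.symm

/-- A vector with constant components which is timelike on a ball extends, up to sign, from a
smaller ball to a global timelike vector field. -/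
theorem exists_timelike_extension [IsManifold (𝓡 n) ∞ M] [T2Space M] [SecondCountableTopology M]
    (hlip : IsLocLipCov g) (hg : IsLorentzian g) {T : VecField n M} (hT : IsSmoothVec T)
    (hTt : IsTimelike g T) (he : e ∈ IsManifold.maximalAtlas (𝓡 n) ∞ M) {y₁ : Model n} {r : ℝ}
    (hr : Metric.closedBall y₁ r ⊆ e.target) {r' : ℝ} (hr' : r' < r) {V : Model n}
    (hV : ∀ z ∈ Metric.ball y₁ r, ∑ i, ∑ j, comp e g z i j * V i * V j < 0) :
    ∃ W : VecField n M, IsSmoothVec W ∧ IsTimelike g W ∧ ∃ s : ℝ, s ^ 2 = 1 ∧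
      ∀ z ∈ Metric.closedBall y₁ r', ∀ i, vecComp e W i z = s * V i := by
  have : LocallyCompactSpace M := ChartedSpace.locallyCompactSpace (Model n) M
  have hsub : Metric.ball y₁ r ⊆ e.target := Metric.ball_subset_closedBall.trans hr
  have hXX : ∀ (U : Model n) z, z ∈ e.target → ∀ S : VecField n M,
      g (e.symm z) (constField e U (e.symm z)) (S (e.symm z))
        = ∑ i, ∑ j, comp e g z i j * U i * vecComp e S j z := by
    intro U z hz S
    rw [covTwo_apply_symm he g hz]
    simp only [dcoord_constField he U (e.map_target hz), vecComp]
  have hcont : ContinuousOn (fun z => ∑ i, ∑ j, comp e g z i j * V i * vecComp e T j z)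
      (Metric.ball y₁ r) := by
    refine continuousOn_finsetSum _ fun i _ => continuousOn_finsetSum _ fun j _ => ?_
    refine ContinuousOn.mul (ContinuousOn.mul ?_ continuousOn_const)
      ((continuousOn_vecComp he hT j).mono hsub)
    exact fun z hz => (lipAt_comp hlip he (hsub hz) i j).continuousAt.continuousWithinAt
  have hVV : ∀ (s : ℝ), s ^ 2 = 1 → ∀ z ∈ Metric.ball y₁ r,
      g (e.symm z) (constField e (s • V) (e.symm z)) (constField e (s • V) (e.symm z)) < 0 := by
    intro s hs z hz
    rw [hXX _ z (hsub hz) (constField e (s • V))]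
    have : ∀ j, vecComp e (constField e (s • V)) j z = s * V j := fun j =>
      dcoord_constField he _ (e.map_target (hsub hz)) j
    simp only [this]
    refine lt_of_eq_of_lt ?_ (hV z hz)
    refine Finset.sum_congr rfl fun i _ => Finset.sum_congr rfl fun j _ => ?_
    calc comp e g z i j * (s • V) i * (s * V j) = s ^ 2 * (comp e g z i j * V i * V j) := by
          simp only [PiLp.smul_apply, smul_eq_mul]; ring
      _ = _ := by rw [hs, one_mul]
  have hne : ∀ z ∈ Metric.ball y₁ r, ∑ i, ∑ j, comp e g z i j * V i * vecComp e T j z ≠ 0 := by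
    intro z hz
    rw [← hXX V z (hsub hz) T]
    have := hVV 1 (by norm_num) z hz
    rw [one_smul] at this
    exact hg.apply_ne_zero this (hTt _)
  -- g(V,T) is continuous without zeros on a connected ball, so it has constant sign, and s = ±1
  -- puts sV in the half cone of T. The sign is harmless later because the Ricci inequality is
  -- quadratic in the field.
  obtain ⟨s, hs, hsneg⟩ : ∃ s : ℝ, s ^ 2 = 1 ∧ ∀ z ∈ Metric.ball y₁ r,
      s * ∑ i, ∑ j, comp e g z i j * V i * vecComp e T j z < 0 := by
    have hpre : IsPreconnected (Metric.ball y₁ r) := (convex_ball y₁ r).isPreconnected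
    by_cases hpos : ∃ z ∈ Metric.ball y₁ r,
        0 < ∑ i, ∑ j, comp e g z i j * V i * vecComp e T j z
    · obtain ⟨z, hz, hz0⟩ := hpos
      refine ⟨-1, by norm_num, fun w hw => ?_⟩
      rcases lt_or_gt_of_ne (hne w hw) with h | h
      · obtain ⟨u, hu, hu0⟩ := hpre.intermediate_value hw hz hcont ⟨h.le, hz0.le⟩
        exact absurd hu0 (hne u hu)
      · linarith
    · refine ⟨1, by norm_num, fun w hw => ?_⟩
      rw [one_mul]
      exact lt_of_le_of_ne (not_lt.1 fun h => hpos ⟨w, hw, h⟩) (hne w hw)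
  have hopen : IsOpen (e.source ∩ e ⁻¹' Metric.ball y₁ r) :=
    e.isOpen_inter_preimage Metric.isOpen_ball
  have hcl : ∀ ρ, ρ ≤ r → IsClosed (e.symm '' Metric.closedBall y₁ ρ) := fun ρ hρ =>
    ((isCompact_closedBall y₁ ρ).image_of_continuousOn (e.continuousOn_symm.mono
      ((Metric.closedBall_subset_closedBall hρ).trans hr))).isClosed
  obtain ⟨b, hb0, hb1, hb01⟩ := exists_contMDiffMap_zero_one_of_isClosed (n := (⊤ : ℕ∞)) (𝓡 n)
    hopen.isClosed_compl (hcl r' hr'.le) (by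
      rw [Set.disjoint_left]
      rintro _ hx ⟨z, hz, rfl⟩
      have hz' := Metric.closedBall_subset_ball hr' hz
      exact hx ⟨e.map_target (hsub hz'), by rwa [mem_preimage, e.right_inv (hsub hz')]⟩)
  -- The support lies in the image of the closed ball, which is compact inside the chart domain.
  -- This makes b times the locally defined constant field smooth on all of M.
  have hbt : tsupport b ⊆ e.source := by
    have h1 : tsupport b ⊆ e.symm '' Metric.closedBall y₁ r := by
      refine closure_minimal (fun x hx => ?_) (hcl r le_rfl)
      by_contra hx'
      refine hx (hb0 fun hx2 => hx' ?_)
      exact ⟨e x, Metric.ball_subset_closedBall hx2.2, e.left_inv hx2.1⟩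
    refine h1.trans ?_
    rintro _ ⟨z, hz, rfl⟩
    exact e.map_target (hr hz)
  set W : VecField n M := (fun x => b x) • constField e (s • V) + (fun x => 1 - b x) • T with hW
  have hWx : ∀ x, W x = b x • constField e (s • V) x + (1 - b x) • T x := fun x => rfl
  refine ⟨W, ?_, ?_, s, hs, ?_⟩
  · have h1 := ContMDiffOn.smul_section_of_tsupport (ψ := fun x => b x) (n := ∞)
      (b.contMDiff.contMDiffOn) e.open_source hbt (contMDiffOn_constField he (s • V))
    have h2 : ContMDiff (𝓡 n) 𝓘(ℝ, ℝ) ∞ fun x => 1 - b x := contMDiff_const.sub b.contMDiff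
    exact h1.add_section (h2.smul_section hT)
  · intro x
    rw [hWx]
    by_cases hx : x ∈ e.source ∩ e ⁻¹' Metric.ball y₁ r
    · have hx2 := hx.2
      have hxx := e.left_inv hx.1
      have h1 := hVV s hs (e x) hx.2
      have h2 := hsneg (e x) hx.2
      have h3 := hXX (s • V) (e x) (hsub hx.2) T
      rw [hxx] at h1 h3
      refine apply_convexComb_neg (hg x).1 h1 (hTt x) ?_ (hb01 x).1 (hb01 x).2
      rw [h3]
      refine lt_of_eq_of_lt ?_ h2
      simp only [Finset.mul_sum, PiLp.smul_apply, smul_eq_mul]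
      exact Finset.sum_congr rfl fun i _ => Finset.sum_congr rfl fun j _ => by ring
    · have : b x = 0 := hb0 hx
      rw [this, zero_smul, sub_zero, one_smul, zero_add]
      exact hTt x
  · intro z hz i
    have hzt : z ∈ e.target := hsub (Metric.closedBall_subset_ball hr' hz)
    have hbz : b (e.symm z) = 1 := hb1 ⟨z, hz, rfl⟩
    rw [vecComp, hWx, hbz, sub_self, zero_smul, one_smul, add_zero,
      dcoord_constField he _ (e.map_target hzt)]
    rfl

end Lorentz

/-! ### Coordinates of vectors of bounded Riemannian length -/

section Riemannian

open scoped Bundle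

variable {n : ℕ} {M : Type*} [TopologicalSpace M] [ChartedSpace (Model n) M]
  [IsManifold (𝓡 n) ∞ M]

/-- Local trivialisations of a continuous Riemannian bundle have locally bounded norm, and that of
the tangent bundle at x₁ is the differential of the preferred chart. -/
theorem eventually_abs_dcoord_chartAt_le
    (h : Bundle.ContMDiffRiemannianMetric (𝓡 n) ∞ (Model n) (fun x : M => TangentSpace (𝓡 n) x))
    (x₁ : M) : ∃ c : ℝ, 0 < c ∧ ∀ᶠ x in 𝓝 x₁, ∀ (v : TangentSpace (𝓡 n) x) (i : Fin n),
      |dcoord (chartAt (Model n) x₁) x i v| ≤ c * √(h.inner x v v) := by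
  have : IsManifold (𝓡 n) 1 M := IsManifold.of_le (n := ∞) ENat.LEInfty.out
  let : Bundle.RiemannianBundle (fun x : M => TangentSpace (𝓡 n) x) := ⟨h.toRiemannianMetric⟩
  have : IsContinuousRiemannianBundle (Model n) (fun x : M => TangentSpace (𝓡 n) x) :=
    ⟨⟨h.inner, h.contMDiff.continuous, fun _ _ _ => rfl⟩⟩
  obtain ⟨c, hc, H⟩ := eventually_norm_trivializationAt_lt (Model n)
    (fun x : M => TangentSpace (𝓡 n) x) x₁
  refine ⟨c, hc, ?_⟩
  filter_upwards [H, (chartAt (Model n) x₁).open_source.mem_nhds (mem_chart_source _ x₁)]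
    with x hx hxs v i
  set A : TangentSpace (𝓡 n) x →L[ℝ] Model n :=
    (trivializationAt (Model n) (fun x : M => TangentSpace (𝓡 n) x) x₁).continuousLinearMapAt ℝ x
    with hA
  have h1 := (A.le_opNorm v).trans (mul_le_mul_of_nonneg_right hx.le (norm_nonneg v))
  have h2 : ‖v‖ = √(h.inner x v v) := norm_eq_sqrt_real_inner v
  have h3 : A v = mfderiv (𝓡 n) (𝓡 n) (chartAt (Model n) x₁) x v :=
    congrArg (fun L : TangentSpace (𝓡 n) x →L[ℝ] Model n => L v)
      (TangentBundle.continuousLinearMapAt_trivializationAt (I := 𝓡 n) (𝕜 := ℝ) hxs)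
  have h4 : dcoord (chartAt (Model n) x₁) x i v = A v i :=
    congrArg (fun w : Model n => w i) h3.symm
  rw [h4, ← h2]
  exact (PiLp.norm_apply_le (A v) i).trans h1

theorem eventually_abs_dcoord_le
    (h : Bundle.ContMDiffRiemannianMetric (𝓡 n) ∞ (Model n) (fun x : M => TangentSpace (𝓡 n) x))
    {e : OpenPartialHomeomorph M (Model n)} (he : e ∈ IsManifold.maximalAtlas (𝓡 n) ∞ M)
    {x₁ : M} (hx₁ : x₁ ∈ e.source) :
    ∃ c : ℝ, 0 < c ∧ ∀ᶠ x in 𝓝 x₁, ∀ (v : TangentSpace (𝓡 n) x) (i : Fin n),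
      |dcoord e x i v| ≤ c * √(h.inner x v v) := by
  obtain ⟨c, hc, H⟩ := eventually_abs_dcoord_chartAt_le h x₁
  set f := chartAt (Model n) x₁ with hf
  have hfm : f ∈ IsManifold.maximalAtlas (𝓡 n) ∞ M := IsManifold.chart_mem_maximalAtlas x₁
  have hfx : x₁ ∈ f.source := mem_chart_source _ x₁
  have hτ : ContDiffAt ℝ ∞ (transition f e) (f x₁) :=
    contDiffAt_transition hfm he (f.map_source hfx) (by rwa [f.left_inv hfx])
  have hb : ∀ a i, ∃ b, ∀ᶠ x in 𝓝 x₁, |pd i (fun z => transition f e z a) (f x)| ≤ b :=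
    fun a i => bddAlong_iff.1 (bddAlong_of_smooth (f.continuousAt hfx).tendsto
      (contDiffAt_pd (contDiffAt_coord hτ a) i))
  choose b hb using hb
  -- Summing over both indices gives one constant for every component; the added 1 makes it strictly
  -- positive.
  refine ⟨∑ a, ∑ i, |b a i| * c + 1, by positivity, ?_⟩
  have hball : ∀ᶠ x in 𝓝 x₁, ∀ a i, |pd i (fun z => transition f e z a) (f x)| ≤ b a i :=
    eventually_all.2 fun a => eventually_all.2 fun i => hb a i
  filter_upwards [H, hball, f.open_source.mem_nhds hfx, e.open_source.mem_nhds hx₁]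
    with x h1 h2 h3 h4 v a
  rw [dcoord_transform hfm he h3 h4]
  set N := √(h.inner x v v) with hN
  have hN0 : 0 ≤ N := Real.sqrt_nonneg _
  calc |∑ i, pd i (fun z => transition f e z a) (f x) * dcoord f x i v|
      ≤ ∑ i, |b a i| * c * N := by
        refine (Finset.abs_sum_le_sum_abs _ _).trans (Finset.sum_le_sum fun i _ => ?_)
        rw [abs_mul, mul_assoc]
        exact mul_le_mul ((h2 a i).trans (le_abs_self _)) (h1 v i) (abs_nonneg _) (abs_nonneg _)
    _ = (∑ i, |b a i| * c) * N := by rw [Finset.sum_mul]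
    _ ≤ (∑ a, ∑ i, |b a i| * c + 1) * N := by
        refine mul_le_mul_of_nonneg_right ?_ hN0
        have := Finset.single_le_sum (f := fun a => ∑ i, |b a i| * c)
          (fun a _ => by positivity) (Finset.mem_univ a)
        linarith

end Riemannian

/-! ### Positivity of the mollified Ricci tensor on timelike vectors -/

section Positivity

variable {n : ℕ} {M : Type*} [TopologicalSpace M] [ChartedSpace (Model n) M]
  {g : CovTwo n M} {R : Mollification n M} {e : OpenPartialHomeomorph M (Model n)}

theorem distRicciCoord_const_mul (U : Set (Model n)) (G : Model n → Matrix (Fin n) (Fin n) ℝ)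
    (i j : Fin n) (c : ℝ) {φ : Model n → ℝ} (hφ : ContDiff ℝ ∞ φ) :
    distRicciCoord U G i j (fun y => c * φ y) = c * distRicciCoord U G i j φ := by
  simp only [distRicciCoord, ← integral_const_mul,
    pd_const_mul c (differentiableAt_of_smooth hφ.contDiffAt)]
  congr 1
  ext y
  simp only [mul_add, mul_neg, Finset.mul_sum]
  congr 1
  · congr 1
    · congr 1
      exact Finset.sum_congr rfl fun m _ => by ring
    · exact Finset.sum_congr rfl fun m _ => by ring
  · ring

/-- Near a given point, a vector of bounded size whose square is at most `η < 0` at one point is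
timelike at all points. -/
theorem exists_ball_timelike (hlip : IsLocLipCov g)
    (he : e ∈ IsManifold.maximalAtlas (𝓡 n) ∞ M) {y₁ : Model n} (hy₁ : y₁ ∈ e.target) (L : ℝ)
    {η : ℝ} (hη : η < 0) : ∃ r > 0, Metric.closedBall y₁ r ⊆ e.target ∧
      ∀ V : Model n, (∀ i, |V i| ≤ L) → ∀ y ∈ Metric.ball y₁ r,
        ∑ i, ∑ j, comp e g y i j * V i * V j ≤ η →
          ∀ z ∈ Metric.ball y₁ r, ∑ i, ∑ j, comp e g z i j * V i * V j < 0 := by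
  set K : ℝ := ∑ _i : Fin n, ∑ _j : Fin n, L ^ 2 with hK
  have hK0 : 0 ≤ K := Finset.sum_nonneg fun _ _ => Finset.sum_nonneg fun _ _ => sq_nonneg L
  -- Moving between two points of the ball changes the quadratic form by at most 2δK, and 2δ(K + 1)
  -- = -η makes this strictly less than -η. The radius therefore depends on L and η but not on V.
  set δ : ℝ := -η / (2 * (K + 1)) with hδ
  have hδ0 : 0 < δ := div_pos (neg_pos.2 hη) (by positivity)
  have h1 : ∀ᶠ z in 𝓝 y₁, ∀ i j, |comp e g z i j - comp e g y₁ i j| < δ :=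
    eventually_all.2 fun i => eventually_all.2 fun j =>
      (lipAt_comp hlip he hy₁ i j).continuousAt.tendsto (Metric.ball_mem_nhds _ hδ0)
  obtain ⟨r, hr, hrs⟩ := Metric.nhds_basis_closedBall.mem_iff.1
    (Filter.Eventually.and h1 (e.open_target.mem_nhds hy₁))
  refine ⟨r, hr, fun z hz => (hrs hz).2, fun V hV y hy hyη z hz => ?_⟩
  have hyz : ∀ i j, |comp e g z i j - comp e g y i j| ≤ 2 * δ := by
    intro i j
    have a1 := (hrs (Metric.ball_subset_closedBall hz)).1 i j
    have a2 := (hrs (Metric.ball_subset_closedBall hy)).1 i j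
    rw [abs_lt] at a1 a2
    rw [abs_le]
    constructor <;> linarith
  have h2 : (∑ i, ∑ j, comp e g z i j * V i * V j) - ∑ i, ∑ j, comp e g y i j * V i * V j
      ≤ ∑ _i : Fin n, ∑ _j : Fin n, 2 * δ * L ^ 2 := by
    simp only [← Finset.sum_sub_distrib]
    refine Finset.sum_le_sum fun i _ => Finset.sum_le_sum fun j _ => ?_
    have hL0 : 0 ≤ L := (abs_nonneg _).trans (hV i)
    calc comp e g z i j * V i * V j - comp e g y i j * V i * V j
        = (comp e g z i j - comp e g y i j) * (V i * V j) := by ring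
      _ ≤ |comp e g z i j - comp e g y i j| * (|V i| * |V j|) := by
          rw [← abs_mul, ← abs_mul]; exact le_abs_self _
      _ ≤ 2 * δ * (L * L) := mul_le_mul (hyz i j)
          (mul_le_mul (hV i) (hV j) (abs_nonneg _) hL0) (by positivity) (by positivity)
      _ = 2 * δ * L ^ 2 := by ring
  have h3 : ∑ _i : Fin n, ∑ _j : Fin n, 2 * δ * L ^ 2 = 2 * δ * K := by
    simp only [hK, Finset.mul_sum]
  have h4 : 2 * δ * (K + 1) = -η := by
    rw [hδ]; field_simp
  nlinarith

theorem Mollification.contDiff_test (R : Mollification n M) (α : ℕ) (ε : ℝ) (y : Model n) :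
    ContDiff ℝ ∞ fun z => R.cut α z * scaled R.ρ ε (y - z) :=
  (R.contDiff_cut α).mul ((R.isKernel.contDiff_scaled ε).comp (contDiff_const.sub contDiff_id))

theorem Mollification.test_nonneg (R : Mollification n M) (α : ℕ) {ε : ℝ} (hε : 0 < ε)
    (y z : Model n) : 0 ≤ R.cut α z * scaled R.ρ ε (y - z) :=
  mul_nonneg (R.cut_nonneg α z) (mul_nonneg (inv_nonneg.2 (pow_nonneg hε.le n)) (R.ρ_nonneg _))

/-- A lower bound for the distributional Ricci tensor, tested against the mollifier. -/
theorem le_testRicci_of_distRicciGE (hlip : IsLocLipCov g) {α : ℕ} {C ε s : ℝ} (hε : 0 < ε)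
    {W : VecField n M} (hW : DistRicciGE g C W) {V : Model n} (hs : s ^ 2 = 1) {y : Model n}
    (hsub : Metric.closedBall y ε ⊆ (R.chart α).target)
    (hWV : ∀ z ∈ Metric.closedBall y ε, ∀ i, vecComp (R.chart α) W i z = s * V i) :
    C * ∑ i, ∑ j, R.convComp ε g α i j y * V i * V j
      ≤ ∑ i, ∑ j, R.testRicci g α ε y i j * V i * V j := by
  set φ : Model n → ℝ := fun z => R.cut α z * scaled R.ρ ε (y - z) with hφ
  have hφs := R.contDiff_test α ε y
  have hsupp := R.tsupport_test_subset α hε y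
  have hφ0 : ∀ z, z ∉ Metric.closedBall y ε → φ z = 0 := fun z hz =>
    image_eq_zero_of_notMem_tsupport fun h => hz (hsupp h).1
  have hcs : HasCompactSupport φ :=
    (isCompact_closedBall y ε).of_isClosed_subset (isClosed_tsupport _)
      (hsupp.trans inter_subset_left)
  have hss : ∀ i j, s * V i * (s * V j) = V i * V j := fun i j => by
    calc s * V i * (s * V j) = s ^ 2 * (V i * V j) := by ring
      _ = V i * V j := by rw [hs, one_mul]
  -- The density ξ_α ρ_ε(y - ·) is supported where W has components ±V, so the products of
  -- components are the constants V_i V_j.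
  have key := hW (R.chart α) (R.chart_mem α) φ hφs hcs
    (hsupp.trans (inter_subset_left.trans hsub)) (R.test_nonneg α hε y)
  have h1 : distRicci (R.chart α) g W φ = ∑ i, ∑ j, R.testRicci g α ε y i j * V i * V j := by
    refine Finset.sum_congr rfl fun i _ => Finset.sum_congr rfl fun j _ => ?_
    have : (fun z => vecComp (R.chart α) W i z * vecComp (R.chart α) W j z * φ z)
        = fun z => (V i * V j) * φ z := by
      ext z
      by_cases hz : z ∈ Metric.closedBall y ε
      · rw [hWV z hz, hWV z hz, hss]
      · rw [hφ0 z hz, mul_zero, mul_zero]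
    rw [this, distRicciCoord_const_mul _ _ _ _ _ hφs, Mollification.testRicci]
    ring
  have h2 : (∫ z in (R.chart α).target, g ((R.chart α).symm z) (W ((R.chart α).symm z))
      (W ((R.chart α).symm z)) * φ z) = ∑ i, ∑ j, R.convComp ε g α i j y * V i * V j := by
    have e1 : ∀ z ∈ (R.chart α).target, g ((R.chart α).symm z) (W ((R.chart α).symm z))
        (W ((R.chart α).symm z)) * φ z
        = ∑ i, ∑ j, (V i * V j) * (R.loc g α i j z * scaled R.ρ ε (y - z)) := by
      intro z hz
      by_cases hzb : z ∈ Metric.closedBall y ε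
      · rw [covTwo_apply_symm (R.chart_mem α) g hz, Finset.sum_mul]
        refine Finset.sum_congr rfl fun i _ => ?_
        rw [Finset.sum_mul]
        refine Finset.sum_congr rfl fun j _ => ?_
        have a1 : dcoord (R.chart α) ((R.chart α).symm z) i (W ((R.chart α).symm z)) = s * V i :=
          hWV z hzb i
        have a2 : dcoord (R.chart α) ((R.chart α).symm z) j (W ((R.chart α).symm z)) = s * V j :=
          hWV z hzb j
        rw [a1, a2, mul_assoc (comp _ _ _ _ _), hss, Mollification.loc]
        simp only [hφ]
        ring
      · have : scaled R.ρ ε (y - z) = 0 := R.isKernel.scaled_sub_eq_zero hε fun h =>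
          hzb (Metric.ball_subset_closedBall h)
        simp [hφ0 z hzb, this]
    have e2 : ∀ i j, Integrable fun z => (V i * V j) *
        (R.loc g α i j z * scaled R.ρ ε (y - z)) := fun i j =>
      (R.isKernel.integrable_mul_scaled_of_continuous hε
        (Mollification.continuous_loc hlip α i j) y).const_mul _
    rw [setIntegral_congr_fun (R.chart α).open_target.measurableSet e1,
      setIntegral_eq_integral_of_forall_compl_eq_zero]
    · rw [integral_finsetSum _ fun i _ => integrable_finsetSum _ fun j _ => e2 i j]
      refine Finset.sum_congr rfl fun i _ => ?_
      rw [integral_finsetSum _ fun j _ => e2 i j]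
      refine Finset.sum_congr rfl fun j _ => ?_
      rw [integral_const_mul, R.convComp_eq, moll]
      ring
    · intro z hz
      have : R.cut α z = 0 := indicator_of_notMem hz _
      simp [Mollification.loc, this]
  rwa [h1, h2] at key

/-- The mollified Ricci tensor satisfies the lower Ricci bound on all sufficiently timelike
vectors of bounded size. -/
theorem eventually_le_testRicci [IsManifold (𝓡 n) ∞ M] [T2Space M] [SecondCountableTopology M]
    (hlip : IsLocLipCov g) (hg : IsLorentzian g)
    (hg_time : ∃ T : VecField n M, IsSmoothVec T ∧ IsTimelike g T) {C : ℝ}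
    (hC : ∀ X : VecField n M, IsSmoothVec X → IsTimelike g X → DistRicciGE g C X)
    {ε : ℕ → ℝ} (hε : ∀ k, 0 < ε k) (hε0 : Tendsto ε atTop (𝓝 0)) {α : ℕ} {x₁ : M}
    (hx₁ : x₁ ∈ (R.chart α).source) (L : ℝ) {η : ℝ} (hη : η < 0) :
    ∀ᶠ p in (atTop : Filter ℕ) ×ˢ 𝓝 x₁, ∀ V : Model n, (∀ i, |V i| ≤ L) →
      ∑ i, ∑ j, comp (R.chart α) g (R.chart α p.2) i j * V i * V j ≤ η →
        C * ∑ i, ∑ j, R.convComp (ε p.1) g α i j (R.chart α p.2) * V i * V j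
          ≤ ∑ i, ∑ j, R.testRicci g α (ε p.1) (R.chart α p.2) i j * V i * V j := by
  obtain ⟨T, hT, hTt⟩ := hg_time
  obtain ⟨r, hr, hrt, hrV⟩ := exists_ball_timelike hlip (R.chart_mem α)
    ((R.chart α).map_source hx₁) L hη
  have hy : Tendsto (fun p : ℕ × M => R.chart α p.2) (atTop ×ˢ 𝓝 x₁) (𝓝 (R.chart α x₁)) :=
    ((R.chart α).continuousAt hx₁).tendsto.comp tendsto_snd
  -- The radius r/2 is fixed before V, so smallness of ε is uniform in V although the extension W
  -- depends on V.
  filter_upwards [eventually_ball_subset (tendsto_eps hε hε0 _) hy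
    (Metric.closedBall_mem_nhds (R.chart α x₁) (half_pos hr))] with p ⟨hp, hp1, hp2⟩ V hV hVη
  have hlt : r / 2 < r := half_lt_self hr
  obtain ⟨W, hW, hWt, s, hs, hWV⟩ := exists_timelike_extension hlip hg hT hTt (R.chart_mem α)
    hrt hlt (hrV V hV _ (Metric.closedBall_subset_ball hlt hp1) hVη)
  exact le_testRicci_of_distRicciGE hlip hp (hC W hW hWt) hs
    (hp2.trans ((Metric.closedBall_subset_closedBall hlt.le).trans hrt))
    fun z hz i => hWV z (hp2 hz) i

end Positivity

/-! ### Lower Ricci bounds for the approximating metrics -/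

section Approximation

variable {n : ℕ}

/-- Finitely many neighbourhoods cover K, and finitely many thresholds for k have a common bound. -/
theorem _root_.IsCompact.eventually_atTop_forall {X : Type*} [TopologicalSpace X] {K : Set X}
    (hK : IsCompact K) {P : ℕ → X → Prop}
    (h : ∀ x ∈ K, ∀ᶠ p in (atTop : Filter ℕ) ×ˢ 𝓝 x, P p.1 p.2) :
    ∀ᶠ k in atTop, ∀ x ∈ K, P k x := by
  refine hK.induction_on (p := fun s => ∀ᶠ k in atTop, ∀ x ∈ s, P k x) ?_ ?_ ?_ ?_
  · simp
  · exact fun s t hst ht => ht.mono fun k hk x hx => hk x (hst hx)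
  · intro s t hs ht
    filter_upwards [hs, ht] with k h1 h2 x hx using hx.elim (h1 x) (h2 x)
  · intro x hx
    obtain ⟨pa, ha, pb, hb, hab⟩ := eventually_prod_iff.1 (h x hx)
    exact ⟨{z | pb z}, mem_nhdsWithin_of_mem_nhds hb, ha.mono fun k hk z hz => hab hk hz⟩

theorem abs_sum_sum_mul_mul_le {V : Fin n → ℝ} {S : Fin n → Fin n → ℝ} {δ N : ℝ}
    (hS : ∀ i j, |S i j| ≤ δ) (hV : ∀ i, |V i| ≤ N) :
    |∑ i, ∑ j, S i j * V i * V j| ≤ n ^ 2 * δ * N ^ 2 := by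
  refine (Finset.abs_sum_le_sum_abs _ _).trans ?_
  calc ∑ i, |∑ j, S i j * V i * V j| ≤ ∑ _i : Fin n, ∑ _j : Fin n, δ * N ^ 2 := by
        refine Finset.sum_le_sum fun i _ => (Finset.abs_sum_le_sum_abs _ _).trans
          (Finset.sum_le_sum fun j _ => ?_)
        rw [abs_mul, abs_mul]
        have h1 : |V i| * |V j| ≤ N * N :=
          mul_le_mul (hV i) (hV j) (abs_nonneg _) ((abs_nonneg _).trans (hV i))
        have h2 := mul_le_mul (hS i j) h1 (by positivity) ((abs_nonneg _).trans (hS i j))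
        nlinarith
    _ = n ^ 2 * δ * N ^ 2 := by simp; ring

/-- Change of coordinates in a quadratic form. -/
theorem sum_sum_pullback (J : Matrix (Fin n) (Fin n) ℝ) (S : Fin n → Fin n → ℝ)
    {V W : Fin n → ℝ} (hW : ∀ a, W a = ∑ i, J a i * V i) :
    ∑ i, ∑ j, (∑ a, ∑ b, S a b * J a i * J b j) * V i * V j = ∑ a, ∑ b, S a b * W a * W b := by
  simp only [hW, Finset.sum_mul, Finset.mul_sum]
  rw [Finset.sum_congr rfl fun i _ => Finset.sum_comm, Finset.sum_comm]
  refine Finset.sum_congr rfl fun a _ => ?_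
  rw [Finset.sum_congr rfl fun i _ => Finset.sum_comm, Finset.sum_comm]
  refine Finset.sum_congr rfl fun b _ => ?_
  rw [Finset.sum_comm]
  exact Finset.sum_congr rfl fun i _ => Finset.sum_congr rfl fun j _ => by ring

theorem tendsto_prod_chart {M : Type*} [TopologicalSpace M]
    {e : OpenPartialHomeomorph M (Model n)} {x₁ : M} (hx₁ : x₁ ∈ e.source) :
    Tendsto (fun p : ℕ × M => (p.1, e p.2)) (atTop ×ˢ 𝓝 x₁) (atTop ×ˢ 𝓝 (e x₁)) :=
  tendsto_fst.prodMk ((e.continuousAt hx₁).tendsto.comp tendsto_snd)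

variable {M : Type*} [TopologicalSpace M] [ChartedSpace (Model n) M]
  {g : CovTwo n M} {R : Mollification n M} {ε : ℕ → ℝ} {gk : ℕ → CovTwo n M}
  {e : OpenPartialHomeomorph M (Model n)}

theorem IsInnerApprox.tendsto_comp_sub (hgk : IsInnerApprox R g ε gk)
    (he : e ∈ IsManifold.maximalAtlas (𝓡 n) ∞ M) {x₁ : M} (hx₁ : x₁ ∈ e.source) (i j : Fin n) :
    Tendsto (fun p : ℕ × Model n => comp e (gk p.1) p.2 i j
      - comp e (R.conv (ε p.1) g) p.2 i j) (atTop ×ˢ 𝓝 (e x₁)) (𝓝 0) := by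
  obtain ⟨r, hr, hrs⟩ := Metric.nhds_basis_closedBall.mem_iff.1
    (e.open_target.mem_nhds (e.map_source hx₁))
  -- Only the order-zero part of the smooth convergence is needed here.
  have h := hgk.close e he i j 0 _ (isCompact_closedBall (e x₁) r) hrs
  rw [Metric.tendstoUniformlyOn_iff] at h
  refine Metric.tendsto_nhds.2 fun δ hδ => ?_
  filter_upwards [(h δ hδ).prod_mk (Metric.closedBall_mem_nhds (e x₁) hr)] with p hp
  have h1 := hp.1 p.2 hp.2
  rw [dist_zero_left, norm_iteratedFDeriv_zero] at h1
  rw [dist_zero_right]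
  exact h1

theorem IsInnerApprox.tendsto_comp_sub_metric (hgk : IsInnerApprox R g ε gk)
    (hlip : IsLocLipCov g) (he : e ∈ IsManifold.maximalAtlas (𝓡 n) ∞ M) {x₁ : M}
    (hx₁ : x₁ ∈ e.source) (i j : Fin n) :
    Tendsto (fun p : ℕ × Model n => comp e (gk p.1) p.2 i j - comp e g p.2 i j)
      (atTop ×ˢ 𝓝 (e x₁)) (𝓝 0) := by
  have h1 := (comp_conv_sub_isBigO (R := R) he hlip hgk.ε_pos hgk.ε_tendsto hx₁ i j).trans_tendsto
    (hgk.ε_tendsto.comp tendsto_fst)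
  simpa using (hgk.tendsto_comp_sub he hx₁ i j).add h1

variable [IsManifold (𝓡 n) ∞ M]
  (h : Bundle.ContMDiffRiemannianMetric (𝓡 n) ∞ (Model n) (fun x : M => TangentSpace (𝓡 n) x))

theorem eventually_le_testRicci_tangent [T2Space M] [SecondCountableTopology M]
    (hlip : IsLocLipCov g) (hg : IsLorentzian g)
    (hg_time : ∃ T : VecField n M, IsSmoothVec T ∧ IsTimelike g T) {C : ℝ}
    (hC : ∀ X : VecField n M, IsSmoothVec X → IsTimelike g X → DistRicciGE g C X)
    (hε : ∀ k, 0 < ε k) (hε0 : Tendsto ε atTop (𝓝 0)) {α : ℕ} {x₁ : M}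
    (hx₁ : x₁ ∈ (R.chart α).source) (D : ℝ) {η : ℝ} (hη : η < 0) :
    ∀ᶠ p in (atTop : Filter ℕ) ×ˢ 𝓝 x₁, ∀ v : TangentSpace (𝓡 n) p.2,
      √(h.inner p.2 v v) ≤ D → g p.2 v v ≤ η →
        C * ∑ i, ∑ j, R.convComp (ε p.1) g α i j (R.chart α p.2) * dcoord (R.chart α) p.2 i v
            * dcoord (R.chart α) p.2 j v
          ≤ ∑ i, ∑ j, R.testRicci g α (ε p.1) (R.chart α p.2) i j * dcoord (R.chart α) p.2 i v
            * dcoord (R.chart α) p.2 j v := by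
  obtain ⟨c, hc, hcb⟩ := eventually_abs_dcoord_le h (R.chart_mem α) hx₁
  filter_upwards [eventually_le_testRicci (R := R) hlip hg hg_time hC hε hε0 hx₁ (c * D) hη,
    tendsto_snd.eventually hcb,
    tendsto_snd.eventually ((R.chart α).open_source.mem_nhds hx₁)] with p h1 h2 h3 v hv hvη
  refine h1 (mfderiv (𝓡 n) (𝓡 n) (R.chart α) p.2 v) (fun i => ?_) ?_
  · exact (h2 v i).trans (mul_le_mul_of_nonneg_left hv hc.le)
  · exact (covTwo_apply (R.chart_mem α) g h3 v v).symm.trans_le hvη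

theorem IsInnerApprox.eventually_apply_le (hgk : IsInnerApprox R g ε gk) (hlip : IsLocLipCov g)
    (x₁ : M) (D : ℝ) {η : ℝ} (hη : η < 0) :
    ∀ᶠ p in (atTop : Filter ℕ) ×ˢ 𝓝 x₁, ∀ v : TangentSpace (𝓡 n) p.2,
      √(h.inner p.2 v v) ≤ D → g p.2 v v ≤ η → gk p.1 p.2 v v ≤ η / 2 := by
  set e := chartAt (Model n) x₁
  have he : e ∈ IsManifold.maximalAtlas (𝓡 n) ∞ M := IsManifold.chart_mem_maximalAtlas x₁
  have hx₁ : x₁ ∈ e.source := mem_chart_source _ x₁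
  obtain ⟨c, hc, hcb⟩ := eventually_abs_dcoord_le h he hx₁
  -- Chosen so that n²δ(cD)² < -η/2: the error in passing from g to g_k then uses up at most half of
  -- η.
  set δ : ℝ := -η / 2 / (n ^ 2 * (c * D) ^ 2 + 1) with hδ
  have hδ0 : 0 < δ := div_pos (by linarith) (by positivity)
  have h1 : ∀ᶠ p in (atTop : Filter ℕ) ×ˢ 𝓝 (e x₁), ∀ i j,
      |comp e (gk p.1) p.2 i j - comp e g p.2 i j| < δ :=
    eventually_all.2 fun i => eventually_all.2 fun j => by
      simpa using (Metric.tendsto_nhds.1 (hgk.tendsto_comp_sub_metric hlip he hx₁ i j)) δ hδ0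
  filter_upwards [(tendsto_prod_chart hx₁).eventually h1, tendsto_snd.eventually hcb,
    tendsto_snd.eventually (e.open_source.mem_nhds hx₁)] with p h2 h3 h4 v hv hvη
  have h5 : gk p.1 p.2 v v - g p.2 v v = ∑ i, ∑ j,
      (comp e (gk p.1) (e p.2) i j - comp e g (e p.2) i j) * dcoord e p.2 i v
        * dcoord e p.2 j v := by
    rw [covTwo_apply he (gk p.1) h4, covTwo_apply he g h4]
    simp only [← Finset.sum_sub_distrib]
    exact Finset.sum_congr rfl fun i _ => Finset.sum_congr rfl fun j _ => by ring
  have h6 := abs_sum_sum_mul_mul_le (fun i j => (h2 i j).le)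
    (fun i => (h3 v i).trans (mul_le_mul_of_nonneg_left hv hc.le))
  rw [← h5] at h6
  have h7 : δ * (n ^ 2 * (c * D) ^ 2 + 1) = -η / 2 := by
    rw [hδ]; field_simp
  have := (abs_le.1 h6).2
  nlinarith

/-- Near every point, the Ricci tensor of the approximating metrics is bounded from below in terms
of the mollified distributional Ricci tensor. -/
theorem IsInnerApprox.exists_eventually_le_ricci (hgk : IsInnerApprox R g ε gk)
    (hlip : IsLocLipCov g) (hg : IsLorentzian g) (C : ℝ) (x₀ : M) :
    ∃ B : ℝ, 0 ≤ B ∧ ∀ᶠ p in (atTop : Filter ℕ) ×ˢ 𝓝 x₀, ∀ v : TangentSpace (𝓡 n) p.2,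
      C * gk p.1 p.2 v v - B * √(h.inner p.2 v v) ^ 2 ≤ ricci (gk p.1) p.2 v
        + ∑ α ∈ R.ξ.fintsupport x₀,
          (C * (∑ i, ∑ j, R.convComp (ε p.1) g α i j (R.chart α p.2)
            * dcoord (R.chart α) p.2 i v * dcoord (R.chart α) p.2 j v)
          - ∑ i, ∑ j, R.testRicci g α (ε p.1) (R.chart α p.2) i j
            * dcoord (R.chart α) p.2 i v * dcoord (R.chart α) p.2 j v) := by
  set e := chartAt (Model n) x₀
  have he : e ∈ IsManifold.maximalAtlas (𝓡 n) ∞ M := IsManifold.chart_mem_maximalAtlas x₀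
  have hx₀ : x₀ ∈ e.source := mem_chart_source _ x₀
  obtain ⟨c, hc, hcb⟩ := eventually_abs_dcoord_le h he hx₀
  choose b hb using fun i j => bddAlong_iff.1
    (bddAlong_ricciCoord_conv_sub R he hlip hg hgk.ε_pos hgk.ε_tendsto hx₀ i j)
  obtain ⟨r, hr, hrs⟩ := Metric.nhds_basis_closedBall.mem_iff.1
    (e.open_target.mem_nhds (e.map_source hx₀))
  obtain ⟨b', hb'⟩ := hgk.ricci_close e he _ (isCompact_closedBall (e x₀) r) hrs
  -- Two bounded errors on Ricci components: b' for passing from g_k to the regularisation, b for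
  -- the commutator estimate.
  set β : ℝ := |b'| + ∑ i, ∑ j, |b i j| with hβ
  have hβ0 : 0 ≤ β := by positivity
  have hbβ : ∀ i j, |b i j| ≤ ∑ i, ∑ j, |b i j| := fun i j =>
    (Finset.single_le_sum (f := fun j => |b i j|) (fun _ _ => abs_nonneg _)
      (Finset.mem_univ j)).trans (Finset.single_le_sum (f := fun i => ∑ j, |b i j|)
        (fun _ _ => Finset.sum_nonneg fun _ _ => abs_nonneg _) (Finset.mem_univ i))
  -- The term with |C| pays for replacing C g_k by C times the regularised metric, whose components
  -- are eventually within 1 of those of g_k. No timelike condition has entered, so the constant is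
  -- independent of D and η.
  refine ⟨n ^ 2 * (β + |C|) * c ^ 2, by positivity, ?_⟩
  have h1 : ∀ᶠ p in (atTop : Filter ℕ) ×ˢ 𝓝 (e x₀), ∀ i j,
      |comp e (gk p.1) p.2 i j - comp e (R.conv (ε p.1) g) p.2 i j| < 1 :=
    eventually_all.2 fun i => eventually_all.2 fun j => by
      simpa using (Metric.tendsto_nhds.1 (hgk.tendsto_comp_sub he hx₀ i j)) 1 one_pos
  have h2 := eventually_all.2 fun i => eventually_all.2 fun j => hb i j
  have h3 := hb'.prod_mk (Metric.closedBall_mem_nhds (e x₀) hr)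
  have hsrc : ∀ᶠ x in 𝓝 x₀, x ∈ e.source ∧ ∀ α ∈ R.ξ.fintsupport x₀, x ∈ (R.chart α).source :=
    Filter.Eventually.and (e.open_source.mem_nhds hx₀) ((Filter.eventually_all_finset _).2
      fun α hα => (R.chart α).open_source.mem_nhds (mem_source_of_mem_fintsupport hα))
  have hT := tendsto_prod_chart hx₀
  filter_upwards [hT.eventually h1, hT.eventually h2, hT.eventually h3, tendsto_snd.eventually hcb,
    tendsto_snd.eventually hsrc, conv_eventually (R := R) hgk.ε_pos hgk.ε_tendsto g x₀]
    with p g1 g2 g3 g4 g5 g6 v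
  set N := √(h.inner p.2 v v)
  set V : Fin n → ℝ := fun i => dcoord e p.2 i v with hV
  have hVN : ∀ i, |V i| ≤ c * N := fun i => g4 v i
  set S : Fin n → Fin n → ℝ := fun i j => ∑ α ∈ R.ξ.fintsupport x₀, ∑ a, ∑ b,
    R.testRicci g α (ε p.1) (transition e (R.chart α) (e p.2)) a b *
      jac (transition e (R.chart α)) (e p.2) a i * jac (transition e (R.chart α)) (e p.2) b j
    with hS
  have e1 : |∑ i, ∑ j, (ricciCoord (comp e (gk p.1)) i j (e p.2) - S i j) * V i * V j|
      ≤ n ^ 2 * β * (c * N) ^ 2 := by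
    refine abs_sum_sum_mul_mul_le (fun i j => ?_) hVN
    have a1 := g3.1 (e p.2) g3.2 i j
    have a2 := g2 i j
    have a3 := hbβ i j
    have a4 := le_abs_self b'
    have a5 := le_abs_self (b i j)
    rw [abs_le] at a1 a2 ⊢
    constructor <;> linarith [a1.1, a1.2, a2.1, a2.2]
  have e2 : ∑ i, ∑ j, S i j * V i * V j = ∑ α ∈ R.ξ.fintsupport x₀, ∑ i, ∑ j,
      R.testRicci g α (ε p.1) (R.chart α p.2) i j
        * dcoord (R.chart α) p.2 i v * dcoord (R.chart α) p.2 j v := by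
    simp only [hS, Finset.sum_mul]
    rw [Finset.sum_congr rfl fun i _ => Finset.sum_comm, Finset.sum_comm]
    refine Finset.sum_congr rfl fun α hα => ?_
    have ht : transition e (R.chart α) (e p.2) = R.chart α p.2 := by
      rw [transition, e.left_inv g5.1]
    rw [← sum_sum_pullback (jac (transition e (R.chart α)) (e p.2))
      (fun a b => R.testRicci g α (ε p.1) (R.chart α p.2) a b)
      (dcoord_transform he (R.chart_mem α) g5.1 (g5.2 α hα) · v), ht]
    simp only [Finset.sum_mul, hV]
  have e3 : R.conv (ε p.1) g p.2 v v = ∑ α ∈ R.ξ.fintsupport x₀, ∑ i, ∑ j,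
      R.convComp (ε p.1) g α i j (R.chart α p.2)
        * dcoord (R.chart α) p.2 i v * dcoord (R.chart α) p.2 j v := by
    rw [g6]
    simp only [_root_.sum_apply, _root_.smul_apply, ContinuousLinearMap.smulRight_apply,
      smul_eq_mul]
    exact Finset.sum_congr rfl fun α _ => Finset.sum_congr rfl fun i _ =>
      Finset.sum_congr rfl fun j _ => by ring
  have e4 : |gk p.1 p.2 v v - R.conv (ε p.1) g p.2 v v| ≤ n ^ 2 * 1 * (c * N) ^ 2 := by
    have : gk p.1 p.2 v v - R.conv (ε p.1) g p.2 v v = ∑ i, ∑ j,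
        (comp e (gk p.1) (e p.2) i j - comp e (R.conv (ε p.1) g) (e p.2) i j) * V i * V j := by
      rw [covTwo_apply he (gk p.1) g5.1, covTwo_apply he (R.conv (ε p.1) g) g5.1]
      simp only [← Finset.sum_sub_distrib]
      exact Finset.sum_congr rfl fun i _ => Finset.sum_congr rfl fun j _ => by ring
    rw [this]
    exact abs_sum_sum_mul_mul_le (fun i j => (g1 i j).le) hVN
  have e5 : ricci (gk p.1) p.2 v = ∑ i, ∑ j, ricciCoord (comp e (gk p.1)) i j (e p.2) * V i * V j :=
    ricci_eq_sum (hgk.smooth _) (hgk.lorentzian _) he g5.1 v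
  have e6 : ∑ i, ∑ j, (ricciCoord (comp e (gk p.1)) i j (e p.2) - S i j) * V i * V j
      = ricci (gk p.1) p.2 v - ∑ i, ∑ j, S i j * V i * V j := by
    rw [e5]
    simp only [← Finset.sum_sub_distrib, sub_mul]
  rw [e6, e2] at e1
  rw [Finset.sum_sub_distrib, ← Finset.mul_sum, ← e3]
  have e7 : |C * (gk p.1 p.2 v v - R.conv (ε p.1) g p.2 v v)| ≤
      |C| * (n ^ 2 * 1 * (c * N) ^ 2) := by
    rw [abs_mul]
    exact mul_le_mul_of_nonneg_left e4 (abs_nonneg _)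
  have e8 := (abs_le.1 e7).2
  have e9 := (abs_le.1 e1).1
  nlinarith

/-- The lower Ricci bound for the approximating metrics near a point, up to an error that is
quadratic in the size of the vector. -/
theorem IsInnerApprox.exists_nhds_le_ricci [T2Space M] [SecondCountableTopology M]
    (hgk : IsInnerApprox R g ε gk) (hlip : IsLocLipCov g) (hg : IsLorentzian g)
    (hg_time : ∃ T : VecField n M, IsSmoothVec T ∧ IsTimelike g T) {C : ℝ}
    (hC : ∀ X : VecField n M, IsSmoothVec X → IsTimelike g X → DistRicciGE g C X) (x₀ : M) :
    ∃ B : ℝ, 0 ≤ B ∧ ∃ N ∈ 𝓝 x₀, ∀ D : ℝ, ∀ η < 0, ∀ᶠ k in atTop, ∀ x ∈ N,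
      ∀ v : TangentSpace (𝓡 n) x, √(h.inner x v v) ≤ D → g x v v ≤ η →
        C * gk k x v v - B * D ^ 2 ≤ ricci (gk k) x v ∧ gk k x v v ≤ η / 2 := by
  have : LocallyCompactSpace M := ChartedSpace.locallyCompactSpace (Model n) M
  obtain ⟨B, hB, hev⟩ := hgk.exists_eventually_le_ricci h hlip hg C x₀
  obtain ⟨pa, ha, pb, hpb, hab⟩ := eventually_prod_iff.1 hev
  have hsrc : ∀ᶠ x in 𝓝 x₀, ∀ α ∈ R.ξ.fintsupport x₀, x ∈ (R.chart α).source :=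
    (Filter.eventually_all_finset _).2 fun α hα =>
      (R.chart α).open_source.mem_nhds (mem_source_of_mem_fintsupport hα)
  -- A compact neighbourhood must be fixed before D and η. The positivity estimate near a point of N
  -- holds only on a neighbourhood depending on D and η; covering N by finitely many of these moves
  -- that dependence into the threshold for k.
  obtain ⟨N, hN, hNs, hNc⟩ := local_compact_nhds (Filter.Eventually.and hpb hsrc)
  refine ⟨B, hB, N, hN, fun D η hη => ?_⟩
  have key : ∀ᶠ k in atTop, ∀ x ∈ N, ∀ v : TangentSpace (𝓡 n) x, √(h.inner x v v) ≤ D →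
      g x v v ≤ η → gk k x v v ≤ η / 2 ∧ ∀ α ∈ R.ξ.fintsupport x₀,
        C * ∑ i, ∑ j, R.convComp (ε k) g α i j (R.chart α x) * dcoord (R.chart α) x i v
            * dcoord (R.chart α) x j v
          ≤ ∑ i, ∑ j, R.testRicci g α (ε k) (R.chart α x) i j * dcoord (R.chart α) x i v
            * dcoord (R.chart α) x j v := by
    refine hNc.eventually_atTop_forall fun x₁ hx₁ => ?_
    filter_upwards [hgk.eventually_apply_le h hlip x₁ D hη,
      (Filter.eventually_all_finset _).2 fun α hα => eventually_le_testRicci_tangent h hlip hg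
        hg_time hC hgk.ε_pos hgk.ε_tendsto ((hNs hx₁).2 α hα) D hη] with p h1 h2 v hv hvη
    exact ⟨h1 v hv hvη, fun α hα => h2 α hα v hv hvη⟩
  filter_upwards [ha, key] with k hk hkey x hx v hv hvη
  obtain ⟨h1, h2⟩ := hkey x hx v hv hvη
  refine ⟨?_, h1⟩
  have h3 := hab hk (hNs hx).1 v
  have h4 := Finset.sum_nonpos fun α hα => sub_nonpos.2 (h2 α hα)
  have h5 : B * √(h.inner x v v) ^ 2 ≤ B * D ^ 2 :=
    mul_le_mul_of_nonneg_left (pow_le_pow_left₀ (Real.sqrt_nonneg _) hv 2) hB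
  linarith

end Approximation

end LipschitzRicci

end

/-! ### From local estimates to a compact set, and absorption of the error. -/

open LipschitzRicci
theorem mainTheorem5 {n : ℕ} (hn : 2 ≤ n) {M : Type*} [TopologicalSpace M]
    [ChartedSpace (Model n) M] [IsManifold (𝓡 n) ∞ M] [T2Space M]
    [SecondCountableTopology M] [ConnectedSpace M]
    (h : Bundle.ContMDiffRiemannianMetric (𝓡 n) ∞ (Model n)
      (fun x : M => TangentSpace (𝓡 n) x))
    (g : CovTwo n M) (hg_lip : IsLocLipCov g) (hg_lor : IsLorentzian g)
    (hg_time : ∃ T : VecField n M, IsSmoothVec T ∧ IsTimelike g T)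
    (R : Mollification n M) (ε : ℕ → ℝ) (gk : ℕ → CovTwo n M)
    (hgk : IsInnerApprox R g ε gk)
    (C : ℝ)
    (hC : ∀ X : VecField n M, IsSmoothVec X → IsTimelike g X → DistRicciGE g C X)
    (K : Set M) (hK : IsCompact K) :
    ∃ B : ℝ, 0 ≤ B ∧ ∀ D : ℝ, 0 < D → ∀ η : ℝ, η < 0 →
      ∃ k₀ : ℕ, ∀ k ≥ k₀, ∀ x ∈ K, ∀ v : TangentSpace (𝓡 n) x,
        √(h.inner x v v) ≤ D → g x v v ≤ η →
          (C - B * D ^ 2 / η) * gk k x v v ≤ ricci (gk k) x v := by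
  -- B is chosen before D and η, so the finite covering of K only adds up local constants, while
  -- thresholds for k may depend on D and η.
  have key : ∃ B : ℝ, 0 ≤ B ∧ ∀ D : ℝ, ∀ η < 0, ∀ᶠ k in atTop, ∀ x ∈ K,
      ∀ v : TangentSpace (𝓡 n) x, √(h.inner x v v) ≤ D → g x v v ≤ η →
        C * gk k x v v - B * D ^ 2 ≤ ricci (gk k) x v ∧ gk k x v v ≤ η / 2 := by
    refine hK.induction_on (p := fun s => ∃ B : ℝ, 0 ≤ B ∧ ∀ D : ℝ, ∀ η < 0, ∀ᶠ k in atTop,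
      ∀ x ∈ s, ∀ v : TangentSpace (𝓡 n) x, √(h.inner x v v) ≤ D → g x v v ≤ η →
        C * gk k x v v - B * D ^ 2 ≤ ricci (gk k) x v ∧ gk k x v v ≤ η / 2) ?_ ?_ ?_ ?_
    · exact ⟨0, le_rfl, fun D η _ => by simp⟩
    · rintro s t hst ⟨B, hB, H⟩
      exact ⟨B, hB, fun D η hη => (H D η hη).mono fun k hk x hx => hk x (hst hx)⟩
    · rintro s t ⟨B, hB, H⟩ ⟨B', hB', H'⟩
      refine ⟨B + B', add_nonneg hB hB', fun D η hη => ?_⟩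
      filter_upwards [H D η hη, H' D η hη] with k h1 h2 x hx v hv hvη
      have hD := mul_nonneg hB (sq_nonneg D)
      have hD' := mul_nonneg hB' (sq_nonneg D)
      rcases hx with hx | hx
      · obtain ⟨a, b⟩ := h1 x hx v hv hvη
        exact ⟨by linarith, b⟩
      · obtain ⟨a, b⟩ := h2 x hx v hv hvη
        exact ⟨by linarith, b⟩
    · intro x _
      obtain ⟨B, hB, N, hN, H⟩ := hgk.exists_nhds_le_ricci h hg_lip hg_lor hg_time hC x
      exact ⟨N, mem_nhdsWithin_of_mem_nhds hN, B, hB, H⟩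
  obtain ⟨B, hB, H⟩ := key
  -- The factor 2 compensates for knowing only g_k(v,v) ≤ η/2: multiplied by the nonnegative number
  -- -2BD²/η, this yields exactly the bound -BD².
  refine ⟨2 * B, by positivity, fun D _ η hη => ?_⟩
  obtain ⟨k₀, hk₀⟩ := eventually_atTop.1 (H D η hη)
  refine ⟨k₀, fun k hk x hx v hv hvη => ?_⟩
  obtain ⟨h1, h2⟩ := hk₀ k hk x hx v hv hvη
  have h3 : 0 ≤ -(2 * B * D ^ 2 / η) :=
    neg_nonneg.2 (div_nonpos_of_nonneg_of_nonpos (by positivity) hη.le)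
  have h4 := mul_le_mul_of_nonneg_left h2 h3
  have h5 : -(2 * B * D ^ 2 / η) * (η / 2) = -(B * D ^ 2) := by
    have := hη.ne
    field_simp
  rw [h5] at h4
  linarith
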